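/- Let $D\subset\mathbb R^2$ be a nonempty bounded open set, $|D|$ its area, $\langle f,g\rangle_D=\int_D\overline f g\,dx$. For $\omega\in\mathbb C\setminus\{0\}$ let $$\mathcal K_D^\omega[\varphi](x)=\int_D \tfrac i4 H^{(1)}_0(\omega|x-y|)\,\varphi(y)\,dy ,\qquad \mathcal K_D[\varphi](x)=-\frac1{2\pi}\int_D\ln|x-y|\,\varphi(y)\,dy,$$ and let $\widetilde{\mathcal K}_D[\varphi]=\mathcal K_D[\varphi]-\frac1{|D|}\int_D\mathcal K_D[\varphi]$ on $L^2_0(D)=\{\varphi\in L^2(D):\int_D\varphi=0\}$. For $\tau>0$, a nonlinear dielectric resonance is an $\omega\in\mathbb C$ for which some $0\not\equiv u\in H^2(D)$ (a resonant state) satisfies $$u=\tau\omega^2\mathcal K_D^\omega\big[u+|u|^2u\big]\quad\text{on } D; \tag{NL}$$ linear resonances and states are defined in the same way by $u=\tau\omega^2\mathcal K_D^\omega[u]$. For all sufficiently large $\tau$ let $\omega_*(\tau)$ be a linear resonance with resonant state $\varphi_*(\tau)$ such that, as $\tau\to\infty$, either (I) $\displaystyle \omega_*(\tau)=\sqrt{\frac{4\pi}{|D|\,\tau\ln\tau}}+O\Big(\frac{\ln\ln\tau}{\sqrt\tau\,\ln\tau}\Big)$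 and $\varphi_*(\tau)=1+O\big(\frac1{\ln\tau}\big)$ in $L^2(D)$; put $\psi=1/|D|$; or (II) $\displaystyle \omega_*(\tau)=\frac1{\sqrt{\tau\mu_j}}+O\Big(\frac1{\sqrt\tau\,\ln\tau}\Big)$ and $\varphi_*(\tau)=v_j+O\big(\frac1{\ln\tau}\big)$ in $L^2(D)$, where $\mu_j>0$ is a simple eigenvalue of $\widetilde{\mathcal K}_D$ on $L^2_0(D)$ with eigenfunction $v_j$, $\|v_j\|_{L^2(D)}=1$; put $\psi=v_j$. Then there are $\delta,\rho>0$, $C\in\mathbb R$ and, for all $(a,\tau)$ in $U=\{(a,\tau):a>0,\ \tau>0,\ a+\tau^{-1}<\delta\}$, a nonlinear resonance $\omega(a,\tau)$ with a resonant state $u(a,\tau)$, such that for all $(a,\tau)\in U$: 1. $\langle\psi,u(a,\tau)\rangle_D=a\,\langle\psi,\varphi_*(\tau)\rangle_D$, $\ |\omega(a,\tau)-\omega_*(\tau)|\le\rho|\omega_*(\tau)|$ and $\|u(a,\tau)\|_{L^\infty(D)}\le\rho$. 2. (Uniqueness up to phase.) If $(\omega',u')$ is a nonlinear resonance with a resonant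 state for the same $\tau$, $|\omega'-\omega_*(\tau)|\le\rho|\omega_*(\tau)|$, $\|u'\|_{L^\infty(D)}\le\rho$, and either $|\langle\psi,u'\rangle_D|=a\,|\langle\psi,\varphi_*(\tau)\rangle_D|$ or $\omega'=\omega(a,\tau)$, then $\omega'=\omega(a,\tau)$ and $u'=e^{i\theta}u(a,\tau)$ for some $\theta\in\mathbb R$. 3. $\|u(a,\tau)-a\varphi_*(\tau)\|_{H^2(D)}\le C a^2$. 4. $$|\omega(a,\tau)-\omega_*(\tau)|\le\begin{cases}C\Big(\dfrac{a^2}{\sqrt{\tau\ln\tau}}+\dfrac a{\sqrt\tau\,\ln\tau}\Big)&\text{in case (I)},\\[2mm] C\Big(\dfrac{a^2}{\sqrt\tau}+\dfrac a{\sqrt{\tau\ln\tau}}\Big)&\text{in case (II)}.\end{cases}$$ -/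

import Mathlib

open MeasureTheory Filter Asymptotics
open scoped ENNReal ComplexConjugate

noncomputable section

namespace Dielectric

/-- The Euclidean plane. -/
abbrev Plane : Type := EuclideanSpace ℝ (Fin 2)

/-- The restriction of Lebesgue measure to `D`. Functions on `D` are represented by functions on the
plane, of which only the class modulo equality almost everywhere on `D` matters. -/
abbrev volOn (D : Set Plane) : Measure Plane := volume.restrict D

/-! ### The Sobolev space `H²(D)` -/

/-- `g` is the weak partial derivative of `f` in the direction `i` on the open set `D` (used for
square integrable `f` and `g`). -/
def HasWeakPartial (D : Set Plane) (i : Fin 2) (f g : Plane → ℂ) : Prop :=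
  ∀ φ : Plane → ℝ, ContDiff ℝ (⊤ : ℕ∞) φ → HasCompactSupport φ → tsupport φ ⊆ D →
    ∫ x in D, (fderiv ℝ φ x (EuclideanSpace.single i 1)) • f x = - ∫ x in D, φ x • g x

/-- `f` is in `L²(D)`, with weak gradient `g` and weak Hessian `H` in `L²(D)`. -/
structure IsH2Jet (D : Set Plane) (f : Plane → ℂ) (g : Fin 2 → Plane → ℂ)
    (H : Fin 2 → Fin 2 → Plane → ℂ) : Prop where
  memLp : MemLp f 2 (volOn D)
  memLp_grad : ∀ i, MemLp (g i) 2 (volOn D)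
  memLp_hess : ∀ i j, MemLp (H i j) 2 (volOn D)
  grad : ∀ i, HasWeakPartial D i f (g i)
  hess : ∀ i j, HasWeakPartial D j (g i) (H i j)

/-- Membership in `H²(D)`. -/
def MemH2 (D : Set Plane) (f : Plane → ℂ) : Prop :=
  ∃ g H, IsH2Jet D f g H

/-- The `H²(D)` norm (weak derivatives are unique up to null sets, so the infimum is over equal
values); it is `∞` if `f` is not in `H²(D)`. -/
def eH2Norm (D : Set Plane) (f : Plane → ℂ) : ℝ≥0∞ :=
  ⨅ (g : Fin 2 → Plane → ℂ) (H : Fin 2 → Fin 2 → Plane → ℂ) (_ : IsH2Jet D f g H),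
    ((eLpNorm f 2 (volOn D)) ^ 2 + ∑ i, (eLpNorm (g i) 2 (volOn D)) ^ 2
      + ∑ i, ∑ j, (eLpNorm (H i j) 2 (volOn D)) ^ 2) ^ (1 / 2 : ℝ)

/-! ### The outgoing Green function and the volume potential -/

/-- The Bessel function `J₀`. -/
def besselJ0 (z : ℂ) : ℂ :=
  ∑' k : ℕ, (-1) ^ k / ((k.factorial : ℂ) ^ 2) * (z / 2) ^ (2 * k)

/-- The Bessel function of the second kind `Y₀`, principal branch. -/
def besselY0 (z : ℂ) : ℂ :=
  (2 / (Real.pi : ℂ)) *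
    ((Complex.log (z / 2) + (Real.eulerMascheroniConstant : ℂ)) * besselJ0 z
      - ∑' k : ℕ, (-1) ^ k * ((harmonic k : ℚ) : ℂ) / ((k.factorial : ℂ) ^ 2) * (z / 2) ^ (2 * k))

/-- The Hankel function `H₀⁽¹⁾`. -/
def hankelH0 (z : ℂ) : ℂ := besselJ0 z + Complex.I * besselY0 z

/-- The outgoing Green function of `-(Δ + ω²)` in the plane. -/
def green (ω : ℂ) (x : Plane) : ℂ := (Complex.I / 4) * hankelH0 (ω * (‖x‖ : ℂ))

/-- The volume potential `K_D^ω`. -/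
def volPotential (D : Set Plane) (ω : ℂ) (f : Plane → ℂ) (x : Plane) : ℂ :=
  ∫ y in D, green ω (x - y) * f y

/-! ### Resonances -/

/-- The Kerr response `q_η(u) u`, with `q_η(z) = 1 + η |z|²`. -/
def kerr (η : ℝ) (u : Plane → ℂ) (x : Plane) : ℂ := (1 + (η : ℂ) * (‖u x‖ : ℂ) ^ 2) * u x

/-- `ω` is a dielectric resonance with resonant state `u`: a nontrivial `u ∈ H²(D)` solves the
Lippmann-Schwinger equation `u = τ ω² K_D^ω[(1 + η |u|²) u]` on `D`. The linear problem is `η = 0`. -/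
structure IsResonantState (D : Set Plane) (η τ : ℝ) (ω : ℂ) (u : Plane → ℂ) : Prop where
  memH2 : MemH2 D u
  nontrivial : ¬ (u =ᵐ[volOn D] 0)
  lippmannSchwinger :
    u =ᵐ[volOn D] fun x => (τ : ℂ) * ω ^ 2 * volPotential D ω (kerr η u) x

/-! ### The projected Newtonian potential -/

/-- The `L²(D)` inner product, conjugate linear in the first argument. -/
def innerOn (D : Set Plane) (f g : Plane → ℂ) : ℂ := ∫ x in D, conj (f x) * g x

/-- The constant function `1_D = 1 / |D|`. -/
def oneOn (D : Set Plane) : Plane → ℂ := fun _ => ((1 / (volume D).toReal : ℝ) : ℂ)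

/-- The Newtonian potential `K_D`. -/
def newtonPotential (D : Set Plane) (f : Plane → ℂ) (x : Plane) : ℂ :=
  ∫ y in D, ((-(1 / (2 * Real.pi)) * Real.log ‖x - y‖ : ℝ) : ℂ) * f y

/-- The projected Newtonian potential `K_D[f] - ⟨1_D, K_D[f]⟩`. -/
def projNewtonPotential (D : Set Plane) (f : Plane → ℂ) (x : Plane) : ℂ :=
  newtonPotential D f x - innerOn D (oneOn D) (newtonPotential D f)

/-- `v` is in the eigenspace, for `μ`, of the projected Newtonian potential acting on the space
`L²₀(D)` of square integrable functions of mean zero. -/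
structure IsMeanZeroEigen (D : Set Plane) (μ : ℝ) (v : Plane → ℂ) : Prop where
  memLp : MemLp v 2 (volOn D)
  mean_zero : ∫ x in D, v x = 0
  eigen : projNewtonPotential D v =ᵐ[volOn D] fun x => (μ : ℂ) * v x

/-- `μ` is a simple eigenvalue of the projected Newtonian potential on `L²₀(D)`, with eigenfunction
`v` normalized in `L²(D)`. -/
structure IsSimpleEigenpair (D : Set Plane) (μ : ℝ) (v : Plane → ℂ) : Prop where
  eigen : IsMeanZeroEigen D μ v
  norm_eq_one : eLpNorm v 2 (volOn D) = 1
  simple : ∀ w, IsMeanZeroEigen D μ w → ∃ c : ℂ, w =ᵐ[volOn D] fun x => c * v x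

/-! ### Branches of nonlinear resonances -/

/-- Nonlinear resonant pairs `(ω, u)` near `(ω₀, 0)`, at scale `ρ`. The distance of frequencies is
measured relative to `ω₀`, that of states in `L^∞(D)`. -/
structure IsNearbyPair (D : Set Plane) (τ ρ : ℝ) (ω₀ ω : ℂ) (u : Plane → ℂ) : Prop where
  state : IsResonantState D 1 τ ω u
  freq_near : ‖ω - ω₀‖ ≤ ρ * ‖ω₀‖
  state_small : eLpNorm u ∞ (volOn D) ≤ ENNReal.ofReal ρ

/-- A family of nonlinear resonances `ω a τ` with states `u a τ`, defined for `a, τ > 0` with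
`a + 1 / τ < δ`, which bifurcates from the linear resonances `ωs τ` with states `φs τ`. The parameter
`a` is the amplitude of the state: the component of `u a τ` along `ψ` is `a` times that of `φs τ`.
Every nearby pair with the same amplitude, or with the same frequency, is the given one up to a
phase. All constants are uniform in `a` and `τ`. -/
def HasNonlinearBranch (D : Set Plane) (ψ : Plane → ℂ) (ωs : ℝ → ℂ) (φs : ℝ → Plane → ℂ)
    (err : ℝ → ℝ → ℝ) : Prop :=
  ∃ δ > 0, ∃ ρ > 0, ∃ C : ℝ, ∃ (ω : ℝ → ℝ → ℂ) (u : ℝ → ℝ → Plane → ℂ),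
    ∀ a τ : ℝ, 0 < a → 0 < τ → a + τ⁻¹ < δ →
      IsNearbyPair D τ ρ (ωs τ) (ω a τ) (u a τ) ∧
      innerOn D ψ (u a τ) = a * innerOn D ψ (φs τ) ∧
      (∀ (ω' : ℂ) (u' : Plane → ℂ), IsNearbyPair D τ ρ (ωs τ) ω' u' →
        (‖innerOn D ψ u'‖ = a * ‖innerOn D ψ (φs τ)‖ ∨ ω' = ω a τ) →
        ω' = ω a τ ∧
          ∃ θ : ℝ, u' =ᵐ[volOn D] fun x => Complex.exp (Complex.I * θ) * u a τ x) ∧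
      eH2Norm D (fun x => u a τ x - a * φs τ x) ≤ ENNReal.ofReal (C * a ^ 2) ∧
      ‖ω a τ - ωs τ‖ ≤ C * err a τ

end Dielectric

end

open Dielectric

/-! Put u = a w and ω = ω_*(1 + s). The equation becomes w = λ(1 + s)² K^ω[w + a²|w|²w] with λ =
τω_*², a perturbation of the linear problem, solved by s = 0, w = φ_*. This is bifurcation from a
simple eigenvalue; the point is uniformity as τ → ∞, where the Green function degenerates. At low
frequency it is κ(ω) + Newtonian kernel + small remainder (`green_eq`), with κ(ω) = `greenConst ω` ~
ln τ/(4π). So K^ω is |D|κ times the mean projection P, plus a bounded regular part.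

In case (I), λ → 0 and λ|D|κ → 1, so λK^ω → P. In case (II), λ → 1/μ while κ → ∞; applying the
injective operator R = (1 - P) - P/(λ|D|κ) to the equation removes the divergence, and the limit is
(1 - P)w = μ⁻¹(1 - P)K_D w - Pw. In both cases the equation takes the form R w = (1 + s)² S(s)(w +
N(w)) with R and S(s) close in norm to a fixed `BifModel`, and with a small Lipschitz constant in s
(`eventually_isLinearData_const`, `eventually_isLinearData_eigen`).

In the model, the bordered operator A = R - S + v ⊗ l is invertible. Under the normalization l w = l
φ, the linearization in (w, s) is (d, σ) ↦ (R - S)d - 2σv = A(d - 2σv), so `BifModel.exists_branch`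
gives existence and Lipschitz estimates with constants depending on the model only. It also gives
2Δs ≈ -l(ΔN). Since l of the cubic term of v is a positive multiple of the (truncated) ∫|v|⁴, the
frequency determines the modulus of the amplitude; the phase is removed by dividing by the complex
amplitude.

The cubic term does not act on L². It is replaced by the Lipschitz map `truncL`. A solution is a
constant plus a function bounded in L^∞ by its L² norm, so it is itself bounded and the truncation
is inactive. For H² bounds, second derivatives of a logarithmic potential are controlled in L² by
the Laplacian (`exists_radial_bound`), and the constant part has no derivatives, so κ does not
enter. -/

noncomputable section

namespace Dielectric

/-! ### Bifurcation from a simple eigenvalue, with uniform constants -/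

section Bifurcation

variable {E : Type*} [NormedAddCommGroup E] [NormedSpace ℂ E]

/-- The limit data of a bifurcation problem `R w = (1 + s)² S(s) (w + N(w))`: the bordered operator
`A = R - S + v ⊗ l` is invertible, and `l'` spans the cokernel of `R - S`. -/
structure BifModel (E : Type*) [NormedAddCommGroup E] [NormedSpace ℂ E] where
  R : E →L[ℂ] E
  S : E →L[ℂ] E
  v : E
  l : E →L[ℂ] ℂ
  l' : E →L[ℂ] ℂ
  A : E ≃L[ℂ] E
  A_apply : ∀ x, A x = R x - S x + l x • v
  R_v : R v = v
  S_v : S v = v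
  l_v : l v = 1
  l'_sub : ∀ x, l' (R x - S x) = 0
  l'_S : ∀ x, l' (S x) = l x

/-- Problems which are `η`-close to the limit, with a solution `φ` of the linear problem. -/
structure BifModel.Near (m : BifModel E) (η : ℝ) (R : E →L[ℂ] E) (S : ℂ → E →L[ℂ] E) (φ : E) :
    Prop where
  R_near : ‖R - m.R‖ ≤ η
  S_near : ∀ s : ℂ, ‖s‖ ≤ 1 / 4 → ‖S s - m.S‖ ≤ η
  S_lip : ∀ s t : ℂ, ‖s‖ ≤ 1 / 4 → ‖t‖ ≤ 1 / 4 → ‖S s - S t‖ ≤ η * ‖s - t‖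
  sol : R φ = S 0 φ
  φ_near : ‖φ - m.v‖ ≤ η

/-- The residual of the equation, where `g` is the value of the nonlinearity at `w`. -/
def bifResidual (R : E →L[ℂ] E) (S : ℂ → E →L[ℂ] E) (s : ℂ) (w g : E) : E :=
  R w - (1 + s) ^ 2 • S s (w + g)

namespace BifModel

variable (m : BifModel E)

/-- The constant in the linearization estimates. -/
def const : ℝ := 12 * (‖m.S‖ + 1) * (‖m.v‖ + 1)

lemma const_pos : 0 < m.const := by unfold const; positivity

variable {m} {R : E →L[ℂ] E} {S : ℂ → E →L[ℂ] E} {φ : E} {r : ℝ}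

lemma norm_one_add_sq_le {s : ℂ} (hs : ‖s‖ ≤ 1 / 4) : ‖(1 + s) ^ 2‖ ≤ 2 := by
  have : ‖1 + s‖ ≤ 5 / 4 := (norm_add_le _ _).trans (by rw [norm_one]; linarith)
  rw [norm_pow]; nlinarith [norm_nonneg (1 + s)]

lemma norm_one_add_sq_sub_le {s : ℂ} (hs : ‖s‖ ≤ 1 / 4) : ‖(1 + s) ^ 2 - 1‖ ≤ 3 * ‖s‖ := by
  have : (1 + s) ^ 2 - 1 = s * (2 + s) := by ring
  rw [this, norm_mul]
  have : ‖2 + s‖ ≤ 3 := (norm_add_le _ _).trans (by norm_num; linarith)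
  nlinarith [norm_nonneg s]

lemma Near.norm_S_le (h : m.Near r R S φ) (hr : r ≤ 1 / 4) {s : ℂ} (hs : ‖s‖ ≤ 1 / 4) :
    ‖S s‖ ≤ ‖m.S‖ + 1 := by
  have := norm_le_norm_add_norm_sub' (S s) m.S
  linarith [h.S_near s hs]

lemma Near.norm_smul_S_sub_le (h : m.Near r R S φ) (hr : r ≤ 1 / 4) {s : ℂ} (hs : ‖s‖ ≤ r) :
    ‖(1 + s) ^ 2 • S s - m.S‖ ≤ 4 * r * (‖m.S‖ + 1) := by
  have hs' : ‖s‖ ≤ 1 / 4 := hs.trans hr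
  have : (1 + s) ^ 2 • S s - m.S = ((1 + s) ^ 2 - 1) • S s + (S s - m.S) := by
    rw [sub_smul, one_smul]; abel
  rw [this]
  refine (norm_add_le _ _).trans ?_
  rw [norm_smul]
  have h1 := norm_one_add_sq_sub_le hs'
  have h2 := h.norm_S_le hr hs'
  have h3 := h.S_near s hs'
  have h4 : ‖(1 + s) ^ 2 - 1‖ * ‖S s‖ ≤ 3 * r * (‖m.S‖ + 1) :=
    mul_le_mul (by linarith) h2 (norm_nonneg _) (by linarith [norm_nonneg s])
  nlinarith [norm_nonneg m.S, norm_nonneg s]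

/-- The residual is close to its linearization at the limit. -/
lemma Near.residual_sub (h : m.Near r R S φ) (hr : r ≤ 1 / 4) {s₁ s₂ : ℂ}
    (hs₁ : ‖s₁‖ ≤ r) (hs₂ : ‖s₂‖ ≤ r) {w₁ w₂ g₁ g₁' g₂ : E} (hw : ‖w₂ - m.v‖ ≤ r)
    (hg₂ : ‖g₂‖ ≤ r) (hg : ‖g₁ - g₁'‖ ≤ r * ‖w₁ - w₂‖) :
    ‖bifResidual R S s₁ w₁ g₁ - bifResidual R S s₂ w₂ g₂
        - (m.R (w₁ - w₂) - m.S (w₁ - w₂) - (2 * (s₁ - s₂)) • m.v - m.S (g₁' - g₂))‖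
      ≤ m.const * r * (‖w₁ - w₂‖ + ‖s₁ - s₂‖ + ‖g₁' - g₂‖) := by
  have hr0 : 0 ≤ r := (norm_nonneg _).trans hs₁
  have hs₁' : ‖s₁‖ ≤ 1 / 4 := hs₁.trans hr
  have hs₂' : ‖s₂‖ ≤ 1 / 4 := hs₂.trans hr
  set d := w₁ - w₂ with hd
  set σ := s₁ - s₂ with hσ
  set n := g₁' - g₂ with hn
  set x := w₂ + g₂ with hx
  -- An exact telescoping. Every summand is an increment times a factor `O(r)`, since `R - m.R`, `(1
  -- + s₁)² S s₁ - m.S`, `x - m.v`, `s₁ + s₂` and the Lipschitz constant of `S` are all small, or it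
  -- contains `g₁ - g₁'`, which is `O(r ‖d‖)`.
  have key : bifResidual R S s₁ w₁ g₁ - bifResidual R S s₂ w₂ g₂
        - (m.R d - m.S d - (2 * σ) • m.v - m.S n)
      = (R - m.R) d - ((1 + s₁) ^ 2 • S s₁ - m.S) (d + n) - (1 + s₁) ^ 2 • S s₁ (g₁ - g₁')
        - ((2 * σ) • ((S s₁ - m.S) x + m.S (x - m.v)) + (σ * (s₁ + s₂)) • S s₁ x
          + (1 + s₂) ^ 2 • (S s₁ - S s₂) x) := by
    have e1 : w₁ + g₁ = x + d + n + (g₁ - g₁') := by rw [hx, hd, hn]; abel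
    have e2 : R w₁ = R d + R w₂ := by rw [← map_add]; congr 1; rw [hd]; abel
    simp only [bifResidual, e1, e2, ← hx, sub_apply, map_add, map_sub, m.S_v, smul_sub, smul_add,
      smul_apply]
    have : σ = s₁ - s₂ := hσ
    rw [this]
    module
  rw [key]
  have hx1 : ‖x - m.v‖ ≤ 2 * r := by
    have : x - m.v = (w₂ - m.v) + g₂ := by rw [hx]; abel
    rw [this]; exact (norm_add_le _ _).trans (by linarith)
  have hx2 : ‖x‖ ≤ ‖m.v‖ + 1 := by
    have := norm_le_norm_add_norm_sub' x m.v
    linarith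
  have hS1 := h.norm_S_le hr hs₁'
  have b1 : ‖(R - m.R) d‖ ≤ r * ‖d‖ :=
    (ContinuousLinearMap.le_opNorm _ _).trans (mul_le_mul_of_nonneg_right h.R_near (norm_nonneg _))
  have b2 : ‖((1 + s₁) ^ 2 • S s₁ - m.S) (d + n)‖ ≤ 4 * r * (‖m.S‖ + 1) * (‖d‖ + ‖n‖) :=
    (ContinuousLinearMap.le_opNorm _ _).trans
      (mul_le_mul (h.norm_smul_S_sub_le hr hs₁) (norm_add_le _ _) (norm_nonneg _) (by positivity))
  have b3 : ‖(1 + s₁) ^ 2 • S s₁ (g₁ - g₁')‖ ≤ 2 * ((‖m.S‖ + 1) * (r * ‖d‖)) := by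
    rw [norm_smul]
    exact mul_le_mul (norm_one_add_sq_le hs₁') ((ContinuousLinearMap.le_opNorm _ _).trans
      (mul_le_mul hS1 hg (norm_nonneg _) (by positivity))) (norm_nonneg _) (by positivity)
  have b4 : ‖(2 * σ) • ((S s₁ - m.S) x + m.S (x - m.v))‖
      ≤ 2 * ‖σ‖ * (r * (‖m.v‖ + 1) + ‖m.S‖ * (2 * r)) := by
    rw [norm_smul, norm_mul, Complex.norm_two]
    refine mul_le_mul_of_nonneg_left ((norm_add_le _ _).trans (add_le_add ?_ ?_)) (by positivity)
    · exact (ContinuousLinearMap.le_opNorm _ _).trans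
        (mul_le_mul (h.S_near _ hs₁') hx2 (norm_nonneg _) (by positivity))
    · exact (ContinuousLinearMap.le_opNorm _ _).trans
        (mul_le_mul_of_nonneg_left hx1 (norm_nonneg _))
  have b5 : ‖(σ * (s₁ + s₂)) • S s₁ x‖ ≤ ‖σ‖ * (2 * r) * ((‖m.S‖ + 1) * (‖m.v‖ + 1)) := by
    rw [norm_smul, norm_mul]
    refine mul_le_mul (mul_le_mul_of_nonneg_left ((norm_add_le _ _).trans (by linarith))
      (norm_nonneg _)) ((ContinuousLinearMap.le_opNorm _ _).trans
        (mul_le_mul hS1 hx2 (norm_nonneg _) (by positivity))) (norm_nonneg _) (by positivity)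
  have b6 : ‖(1 + s₂) ^ 2 • (S s₁ - S s₂) x‖ ≤ 2 * (r * ‖σ‖ * (‖m.v‖ + 1)) := by
    rw [norm_smul]
    exact mul_le_mul (norm_one_add_sq_le hs₂') ((ContinuousLinearMap.le_opNorm _ _).trans
      (mul_le_mul (h.S_lip _ _ hs₁' hs₂') hx2 (norm_nonneg _) (by positivity))) (norm_nonneg _)
      (by positivity)
  have tri : ∀ a b c e f k : E, ‖a - b - c - (e + f + k)‖
      ≤ ‖a‖ + ‖b‖ + ‖c‖ + (‖e‖ + ‖f‖ + ‖k‖) := fun a b c e f k =>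
    (norm_sub_le _ _).trans (add_le_add ((norm_sub_le _ _).trans (add_le_add_left
      (norm_sub_le _ _) _)) (norm_add₃_le))
  refine (tri _ _ _ _ _ _).trans ?_
  refine (add_le_add (add_le_add (add_le_add b1 b2) b3) (add_le_add (add_le_add b4 b5) b6)).trans ?_
  unfold const
  have ha := norm_nonneg m.S
  have hb := norm_nonneg m.v
  have hp := norm_nonneg d
  have hq := norm_nonneg σ
  have ht := norm_nonneg n
  generalize ‖m.S‖ = a, ‖m.v‖ = b, ‖d‖ = p, ‖σ‖ = q, ‖n‖ = t at *
  rw [← sub_nonneg]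
  have : 12 * (a + 1) * (b + 1) * r * (p + q + t) - (r * p + 4 * r * (a + 1) * (p + t)
      + 2 * ((a + 1) * (r * p)) + (2 * q * (r * (b + 1) + a * (2 * r))
        + q * (2 * r) * ((a + 1) * (b + 1)) + 2 * (r * q * (b + 1))))
      = r * (p * (12 * a * b + 6 * a + 12 * b + 5) + t * (12 * a * b + 8 * a + 12 * b + 8)
        + q * (10 * a * b + 6 * a + 6 * b + 6)) := by ring
  rw [this]
  positivity

lemma A_v : m.A m.v = m.v := by
  rw [m.A_apply, m.R_v, m.S_v, m.l_v]; simp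

/-- The row `l'` annihilates the range of `R - S`, and `l' v = l' (S v) = l v = 1`, so `l' ∘ A = l`.
Pairing with `l'` thus extracts the frequency component of a solution of `A x = y`. -/
lemma l_A_symm (x : E) : m.l (m.A.symm x) = m.l' x := by
  obtain ⟨y, rfl⟩ := m.A.surjective x
  have h1 : m.l' m.v = 1 := by rw [← m.S_v, m.l'_S, m.l_v]
  rw [ContinuousLinearEquiv.symm_apply_apply, m.A_apply, map_add, m.l'_sub]
  simp [h1]

lemma v_ne_zero : m.v ≠ 0 := fun h => by simpa [h] using m.l_v

lemma norm_A_symm_pos : 0 < ‖(m.A.symm : E →L[ℂ] E)‖ := by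
  rw [norm_pos_iff]
  intro h
  have h1 : (m.A.symm : E →L[ℂ] E) m.v = m.v := by
    have := m.A.symm_apply_apply m.v
    rw [m.A_v] at this
    exact this
  rw [h] at h1
  exact m.v_ne_zero h1.symm

lemma norm_le_A (x : E) : ‖x‖ ≤ ‖(m.A.symm : E →L[ℂ] E)‖ * ‖m.A x‖ := by
  simpa using (m.A.symm : E →L[ℂ] E).le_opNorm (m.A x)

lemma Near.mono (h : m.Near r R S φ) {r' : ℝ} (hr : r ≤ r') : m.Near r' R S φ where
  R_near := h.R_near.trans hr
  S_near s hs := (h.S_near s hs).trans hr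
  S_lip s t hs ht := (h.S_lip s t hs ht).trans (mul_le_mul_of_nonneg_right hr (norm_nonneg _))
  sol := h.sol
  φ_near := h.φ_near.trans hr

/-- Solutions are nearly multiples of `v`. -/
lemma Near.norm_sub_le (h : m.Near r R S φ) (hr : r ≤ 1 / 4) {s : ℂ} (hs : ‖s‖ ≤ r) {w g : E}
    (hg : ‖g‖ ≤ r * ‖w‖) (hw : bifResidual R S s w g = 0) :
    ‖w - m.l w • m.v‖ ≤ ‖(m.A.symm : E →L[ℂ] E)‖ * (m.const * r * ‖w‖) := by
  have hr0 : 0 ≤ r := (norm_nonneg _).trans hs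
  refine (m.norm_le_A _).trans (mul_le_mul_of_nonneg_left ?_ (norm_nonneg _))
  -- As `A` fixes `v`, the left side is `m.R w - m.S w`, which the equation turns into perturbation
  -- terms only.
  have e : m.A (w - m.l w • m.v)
      = -((R - m.R) w) + ((1 + s) ^ 2 • S s - m.S) w + (1 + s) ^ 2 • S s g := by
    have h1 : R w = (1 + s) ^ 2 • S s w + (1 + s) ^ 2 • S s g := by
      have := sub_eq_zero.1 hw
      rw [this, map_add, smul_add]
    rw [map_sub, map_smul, m.A_v, m.A_apply]
    simp only [sub_apply, smul_apply, h1]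
    abel
  rw [e]
  have b1 : ‖(R - m.R) w‖ ≤ r * ‖w‖ :=
    (ContinuousLinearMap.le_opNorm _ _).trans (mul_le_mul_of_nonneg_right h.R_near (norm_nonneg _))
  have b2 : ‖((1 + s) ^ 2 • S s - m.S) w‖ ≤ 4 * r * (‖m.S‖ + 1) * ‖w‖ :=
    (ContinuousLinearMap.le_opNorm _ _).trans
      (mul_le_mul_of_nonneg_right (h.norm_smul_S_sub_le hr hs) (norm_nonneg _))
  have b3 : ‖(1 + s) ^ 2 • S s g‖ ≤ 2 * ((‖m.S‖ + 1) * (r * ‖w‖)) := by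
    rw [norm_smul]
    exact mul_le_mul (norm_one_add_sq_le (hs.trans hr)) ((ContinuousLinearMap.le_opNorm _ _).trans
      (mul_le_mul (h.norm_S_le hr (hs.trans hr)) hg (norm_nonneg _) (by positivity)))
      (norm_nonneg _) (by positivity)
  refine norm_add₃_le.trans ?_
  rw [norm_neg]
  refine (add_le_add (add_le_add b1 b2) b3).trans ?_
  unfold const
  have ha := norm_nonneg m.S
  have hb := norm_nonneg m.v
  have hp := norm_nonneg w
  generalize ‖m.S‖ = a, ‖m.v‖ = b, ‖w‖ = p at *
  rw [← sub_nonneg]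
  have : 12 * (a + 1) * (b + 1) * r * p - (r * p + 4 * r * (a + 1) * p
      + 2 * ((a + 1) * (r * p))) = r * p * (12 * a * b + 6 * a + 12 * b + 5) := by ring
  rw [this]
  positivity

variable (m) in
/-- Near solutions of a problem close to the limit are close to `v`. -/
lemma exists_near_v (ε : ℝ) (hε : 0 < ε) : ∃ r > 0, r ≤ 1 / 4 ∧
    ∀ (R : E →L[ℂ] E) (S : ℂ → E →L[ℂ] E) (φ : E), m.Near r R S φ →
      ∀ (s : ℂ) (w g : E), ‖s‖ ≤ r → ‖g‖ ≤ r * ‖w‖ → bifResidual R S s w g = 0 →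
        ‖w - m.l w • m.v‖ ≤ 1 / 2 * ‖w‖ ∧
          (m.l w = m.l φ → ‖w - m.v‖ ≤ ε ∧ ‖g‖ ≤ ε) := by
  set K := ‖(m.A.symm : E →L[ℂ] E)‖ * m.const with hK
  have hK0 : 0 < K := mul_pos m.norm_A_symm_pos m.const_pos
  set M := 2 * (1 + ‖m.l‖) * ‖m.v‖ + 1 with hM
  have hM0 : 0 < M := by positivity
  set B := K * M + ‖m.l‖ * ‖m.v‖ + M with hB
  have hB0 : 0 < B := by positivity
  -- `K r ≤ 1/2` absorbs the deviation from the line of `v` into `‖w‖`; then `M` bounds `‖w‖` for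
  -- normalized solutions, and `B r ≤ ε` covers both `‖w - v‖` and `‖g‖ ≤ M r`.
  refine ⟨min (1 / 4) (min (1 / (2 * K)) (ε / B)), by positivity, min_le_left _ _, ?_⟩
  intro R S φ h s w g hs hg hw
  set r := min (1 / 4) (min (1 / (2 * K)) (ε / B)) with hr
  have hr0 : 0 < r := by positivity
  have hr1 : r ≤ 1 / 4 := min_le_left _ _
  have hr2 : K * r ≤ 1 / 2 := by
    have : r ≤ 1 / (2 * K) := (min_le_right _ _).trans (min_le_left _ _)
    rw [le_div_iff₀ (by positivity)] at this
    linarith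
  have hr3 : B * r ≤ ε := by
    have : r ≤ ε / B := (min_le_right _ _).trans (min_le_right _ _)
    rw [le_div_iff₀ (by positivity)] at this
    linarith
  have h1 : ‖w - m.l w • m.v‖ ≤ K * r * ‖w‖ := by
    refine (h.norm_sub_le hr1 hs hg hw).trans (le_of_eq ?_)
    rw [hK]; ring
  refine ⟨h1.trans (mul_le_mul_of_nonneg_right hr2 (norm_nonneg _)), fun hl => ?_⟩
  have h2 : ‖m.l w - 1‖ ≤ ‖m.l‖ * r := by
    rw [hl, ← m.l_v, ← map_sub]
    exact (ContinuousLinearMap.le_opNorm _ _).trans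
      (mul_le_mul_of_nonneg_left h.φ_near (norm_nonneg _))
  have h3 : ‖m.l w‖ ≤ 1 + ‖m.l‖ := by
    have := norm_le_norm_add_norm_sub' (m.l w) 1
    rw [norm_one] at this
    nlinarith [norm_nonneg m.l]
  have h4 : ‖w‖ ≤ M := by
    have h5 := norm_le_norm_add_norm_sub' w (m.l w • m.v)
    rw [norm_smul] at h5
    have h6 : ‖m.l w‖ * ‖m.v‖ ≤ (1 + ‖m.l‖) * ‖m.v‖ :=
      mul_le_mul_of_nonneg_right h3 (norm_nonneg _)
    have h7 : K * r * ‖w‖ ≤ 1 / 2 * ‖w‖ := mul_le_mul_of_nonneg_right hr2 (norm_nonneg _)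
    rw [hM]; linarith
  constructor
  · have e : w - m.v = (w - m.l w • m.v) + (m.l w - 1) • m.v := by rw [sub_smul, one_smul]; abel
    rw [e]
    refine (norm_add_le _ _).trans ?_
    rw [norm_smul]
    have h5 : K * r * ‖w‖ ≤ K * r * M := mul_le_mul_of_nonneg_left h4 (by positivity)
    have h6 : ‖m.l w - 1‖ * ‖m.v‖ ≤ ‖m.l‖ * r * ‖m.v‖ :=
      mul_le_mul_of_nonneg_right h2 (norm_nonneg _)
    rw [hB] at hr3
    nlinarith
  · refine hg.trans ((mul_le_mul_of_nonneg_left h4 hr0.le).trans ?_)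
    refine le_trans ?_ hr3
    rw [hB, mul_comm]
    refine mul_le_mul_of_nonneg_right ?_ hr0.le
    have : 0 ≤ K * M + ‖m.l‖ * ‖m.v‖ := by positivity
    linarith

variable (m) in
/-- Bifurcation, uniformly for all problems close to the limit. -/
theorem exists_branch [CompleteSpace E] (ε : ℝ) (hε : 0 < ε) : ∃ r > 0, r ≤ 1 / 4 ∧ ∃ η > 0, η ≤ r ∧
    ∃ C > 0, ∀ (R : E →L[ℂ] E) (S : ℂ → E →L[ℂ] E) (φ : E), m.Near η R S φ →
      (∀ (s : ℂ) (w g : E), ‖s‖ ≤ r → ‖g‖ ≤ η * ‖w‖ → bifResidual R S s w g = 0 →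
        ‖w - m.l w • m.v‖ ≤ 1 / 2 * ‖w‖ ∧ (m.l w = m.l φ → ‖w - m.v‖ ≤ ε)) ∧
      (∀ (s₁ s₂ : ℂ) (w₁ w₂ g₁ g₁' g₂ : E), ‖s₁‖ ≤ r → ‖s₂‖ ≤ r → ‖g₁‖ ≤ η * ‖w₁‖ →
        ‖g₂‖ ≤ η * ‖w₂‖ → ‖g₁ - g₁'‖ ≤ η * ‖w₁ - w₂‖ → bifResidual R S s₁ w₁ g₁ = 0 →
        bifResidual R S s₂ w₂ g₂ = 0 → m.l w₁ = m.l φ → m.l w₂ = m.l φ →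
        ‖w₁ - w₂‖ + ‖s₁ - s₂‖ ≤ C * ‖g₁' - g₂‖ ∧
          ‖2 * (s₁ - s₂) + m.l (g₁' - g₂)‖ ≤ ε * ‖g₁' - g₂‖) ∧
      (∀ N : E → E, N 0 = 0 → (∀ x y, ‖N x - N y‖ ≤ η * ‖x - y‖) →
        ∃ (s : ℂ) (w : E), ‖s‖ ≤ r ∧ m.l w = m.l φ ∧ bifResidual R S s w (N w) = 0) := by
  set α := ‖(m.A.symm : E →L[ℂ] E)‖ with hα
  have hα0 : 0 < α := m.norm_A_symm_pos
  -- `‖d‖ + ‖σ‖ ≤ L ‖d - 2 σ v‖` if `l d = 0`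
  set L := 1 + ‖m.l‖ * ‖m.v‖ + ‖m.l‖ with hL
  have hL1 : 1 ≤ L := by 
    rw [hL]; linarith [norm_nonneg m.l, mul_nonneg (norm_nonneg m.l) (norm_nonneg m.v)]
  have hL0 : 0 < L := by linarith
  set C₀ := 2 * L * α * (‖m.S‖ + 1) + 1 with hC₀
  have hC₀0 : 0 < C₀ := by positivity
  -- the radius for the linearization
  obtain ⟨r₀, hr₀0, hr₀1, hr₀2, hr₀3⟩ : ∃ r₀ > 0, r₀ ≤ 1 / 4 ∧
      L * α * (m.const * r₀) ≤ 1 / 2 ∧ ‖m.l'‖ * (m.const * r₀) * (C₀ + 1) ≤ ε := by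
    have hc := m.const_pos
    set B₁ := L * α * m.const
    have hB₁ : 0 < B₁ := by positivity
    set B₂ := (‖m.l'‖ + 1) * m.const * (C₀ + 1)
    have hB₂ : 0 < B₂ := by positivity
    refine ⟨min (1 / 4) (min (1 / (2 * B₁)) (ε / B₂)), by positivity, min_le_left _ _, ?_, ?_⟩
    · have : min (1 / 4) (min (1 / (2 * B₁)) (ε / B₂)) ≤ 1 / (2 * B₁) :=
        (min_le_right _ _).trans (min_le_left _ _)
      rw [le_div_iff₀ (by positivity)] at this
      simp only [B₁] at *
      linarith
    · have : min (1 / 4) (min (1 / (2 * B₁)) (ε / B₂)) ≤ ε / B₂ :=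
        (min_le_right _ _).trans (min_le_right _ _)
      rw [le_div_iff₀ (by positivity)] at this
      have h0 : 0 ≤ min (1 / 4) (min (1 / (2 * B₁)) (ε / B₂)) := by positivity
      have h1 : 0 ≤ m.const * min (1 / 4) (min (1 / (2 * B₁)) (ε / B₂)) * (C₀ + 1) := by positivity
      simp only [B₂] at *
      linarith
  obtain ⟨r, hr0, hr1, hr⟩ := m.exists_near_v (min ε r₀) (by positivity)
  set r' := min r r₀ with hr'
  have hr'0 : 0 < r' := by positivity
  set ρ := r' / (2 * L) with hρ
  have hρ0 : 0 < ρ := by positivity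
  have hρL : L * ρ = r' / 2 := by rw [hρ]; field_simp
  set B := (‖m.S‖ + 1) * (‖m.v‖ + 1) * (2 * α) with hB
  have hB0 : 0 < B := by positivity
  -- `r'/2` shares the radius `r'` between `φ - v` and the ball of radius `ρ`, where `L ρ = r'/2`;
  -- `r₀ / (‖v‖ + 1)` keeps `N (W z)` below `r₀`; `ρ / B` makes the residual at the centre small
  -- enough for surjectivity.
  set η := min (r' / 2) (min (r₀ / (‖m.v‖ + 1)) (ρ / B)) with hη
  have hη0 : 0 < η := by positivity
  have hηr' : η ≤ r' / 2 := min_le_left _ _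
  have hηr : η ≤ r := by linarith [min_le_left r r₀]
  have hηr₀ : η ≤ r₀ := by linarith [min_le_right r r₀]
  have hr'r : r' ≤ r := min_le_left _ _
  have hr'r₀ : r' ≤ r₀ := min_le_right _ _
  refine ⟨r', hr'0, hr'r.trans hr1, η, hη0, by linarith, C₀, hC₀0, ?_⟩
  intro R S φ h
  have hgr : ∀ {g w : E}, ‖g‖ ≤ η * ‖w‖ → ‖g‖ ≤ r * ‖w‖ := fun hg =>
    hg.trans (mul_le_mul_of_nonneg_right hηr (norm_nonneg _))
  refine ⟨?_, ?_, ?_⟩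
  · intro s w g hs hg hw
    obtain ⟨h1, h2⟩ := hr R S φ (h.mono hηr) s w g (hs.trans hr'r) (hgr hg) hw
    exact ⟨h1, fun hl => (h2 hl).1.trans (min_le_left _ _)⟩
  · intro s₁ s₂ w₁ w₂ g₁ g₁' g₂ hs₁ hs₂ hg₁ hg₂ hg hw₁ hw₂ hl₁ hl₂
    obtain ⟨-, h2⟩ := hr R S φ (h.mono hηr) s₂ w₂ g₂ (hs₂.trans hr'r) (hgr hg₂) hw₂
    obtain ⟨h3, h4⟩ := h2 hl₂
    have key := (h.mono hηr₀).residual_sub hr₀1 (hs₁.trans hr'r₀) (hs₂.trans hr'r₀)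
      (h3.trans (min_le_right _ _)) (h4.trans (min_le_right _ _))
      (hg.trans (mul_le_mul_of_nonneg_right hηr₀ (norm_nonneg _)))
    rw [hw₁, hw₂, sub_zero, zero_sub, norm_neg] at key
    have hld : m.l (w₁ - w₂) = 0 := by rw [map_sub, hl₁, hl₂, sub_self]
    set d := w₁ - w₂
    set σ := s₁ - s₂
    set n := g₁' - g₂
    -- One vector carries both unknowns: as `l d = 0`, one has `l x = -2σ`, `d = x - l(x) v` and `A
    -- x = (R - S) d - 2σ v`. Inverting `A` solves for state and frequency together.
    set x := d - (2 * σ) • m.v with hx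
    set err := m.R d - m.S d - (2 * σ) • m.v - m.S n with herr
    have hAx : m.A x = m.S n + err := by
      rw [hx, map_sub, map_smul, m.A_v, m.A_apply, hld, herr]; simp
    have hlx : m.l x = -(2 * σ) := by rw [hx, map_sub, map_smul, hld, m.l_v]; simp
    have hdσ : ‖d‖ + ‖σ‖ ≤ L * ‖x‖ := by
      have h5 : ‖σ‖ ≤ ‖m.l‖ * ‖x‖ := by
        have := m.l.le_opNorm x
        rw [hlx, norm_neg, norm_mul, Complex.norm_two] at this
        linarith [norm_nonneg σ]
      have h6 : ‖d‖ ≤ ‖x‖ + ‖m.l‖ * ‖x‖ * ‖m.v‖ := by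
        have e : d = x - m.l x • m.v := by rw [hlx, hx]; module
        rw [e]
        refine (norm_sub_le _ _).trans (add_le_add_right ?_ _)
        rw [norm_smul]
        refine mul_le_mul_of_nonneg_right ?_ (norm_nonneg _)
        exact m.l.le_opNorm x
      rw [hL]; linarith
    have hx1 : ‖x‖ ≤ α * (‖m.S‖ * ‖n‖ + m.const * r₀ * (‖d‖ + ‖σ‖ + ‖n‖)) := by
      refine (m.norm_le_A x).trans (mul_le_mul_of_nonneg_left ?_ hα0.le)
      rw [hAx]
      exact (norm_add_le _ _).trans (add_le_add (m.S.le_opNorm _) key)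
    have hmain : ‖d‖ + ‖σ‖ ≤ C₀ * ‖n‖ := by
      have h7 : ‖d‖ + ‖σ‖ ≤ L * α * (‖m.S‖ * ‖n‖)
          + L * α * (m.const * r₀) * (‖d‖ + ‖σ‖ + ‖n‖) := by
        refine hdσ.trans ((mul_le_mul_of_nonneg_left hx1 hL0.le).trans (le_of_eq ?_))
        ring
      have h8 : L * α * (m.const * r₀) * (‖d‖ + ‖σ‖) ≤ 1 / 2 * (‖d‖ + ‖σ‖) :=
        mul_le_mul_of_nonneg_right hr₀2 (by positivity)
      have h9 : L * α * (m.const * r₀) * ‖n‖ ≤ 1 / 2 * ‖n‖ :=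
        mul_le_mul_of_nonneg_right hr₀2 (norm_nonneg _)
      have h10 : 0 ≤ L * α * ‖n‖ := by positivity
      rw [hC₀]
      linarith
    refine ⟨hmain, ?_⟩
    -- Pairing `A x = S n + err` with `l'` gives `-2σ = l n + l'(err)`, the first order change of
    -- the frequency.
    have e : 2 * σ + m.l n = -m.l' err := by
      have h7 : m.l x = m.l' (m.S n + err) := by
        rw [← m.l_A_symm, ← hAx, ContinuousLinearEquiv.symm_apply_apply]
      rw [hlx, map_add, m.l'_S] at h7
      linear_combination -h7
    rw [e, norm_neg]
    refine (m.l'.le_opNorm _).trans ?_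
    have h7 : ‖err‖ ≤ m.const * r₀ * ((C₀ + 1) * ‖n‖) := by
      refine key.trans (mul_le_mul_of_nonneg_left ?_ (by have := m.const_pos; positivity))
      linarith
    calc ‖m.l'‖ * ‖err‖ ≤ ‖m.l'‖ * (m.const * r₀ * ((C₀ + 1) * ‖n‖)) :=
          mul_le_mul_of_nonneg_left h7 (norm_nonneg _)
      _ = ‖m.l'‖ * (m.const * r₀) * (C₀ + 1) * ‖n‖ := by ring
      _ ≤ ε * ‖n‖ := mul_le_mul_of_nonneg_right hr₀3 (norm_nonneg _)
  · intro N hN0 hN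
    -- The same parametrization in reverse: a single `z` encodes a state with `l (W z) = l φ` and a
    -- frequency shift, and the linearization of `F` is then exactly `A`.
    set W : E → E := fun z => φ + (z - m.l z • m.v) with hW
    set s : E → ℂ := fun z => -m.l z / 2 with hs
    set F : E → E := fun z => bifResidual R S (s z) (W z) (N (W z)) with hF
    have hsz : ∀ z, ‖s z‖ ≤ L * ‖z‖ := fun z => by
      have : ‖s z‖ = ‖m.l z‖ / 2 := by simp [hs]
      rw [this]
      have h1 := m.l.le_opNorm z
      have h2 : 0 ≤ ‖m.l‖ * ‖m.v‖ * ‖z‖ := by positivity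
      have h3 := norm_nonneg (m.l z)
      rw [hL]; linarith [norm_nonneg z]
    have hWz : ∀ z, ‖z - m.l z • m.v‖ ≤ L * ‖z‖ := fun z => by
      refine (norm_sub_le _ _).trans ?_
      rw [norm_smul]
      have h1 : ‖m.l z‖ * ‖m.v‖ ≤ ‖m.l‖ * ‖z‖ * ‖m.v‖ :=
        mul_le_mul_of_nonneg_right (m.l.le_opNorm z) (norm_nonneg _)
      have h2 : 0 ≤ ‖m.l‖ * ‖z‖ := by positivity
      rw [hL]; linarith
    have hdd : ∀ z, ‖z - m.l z • m.v‖ + ‖s z‖ ≤ L * ‖z‖ := fun z => by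
      have : ‖s z‖ = ‖m.l z‖ / 2 := by simp [hs]
      have h1 : ‖z - m.l z • m.v‖ ≤ ‖z‖ + ‖m.l‖ * ‖z‖ * ‖m.v‖ := by
        refine (norm_sub_le _ _).trans (add_le_add_right ?_ _)
        rw [norm_smul]
        exact mul_le_mul_of_nonneg_right (m.l.le_opNorm z) (norm_nonneg _)
      have h2 := m.l.le_opNorm z
      have h3 := norm_nonneg (m.l z)
      rw [this, hL]; linarith
    obtain ⟨c, hc⟩ : ∃ c : NNReal, (c : ℝ) = m.const * r₀ * L :=
      ⟨⟨m.const * r₀ * L, by have := m.const_pos; positivity⟩, rfl⟩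
    have happ : ApproximatesLinearOn F (m.A : E →L[ℂ] E) (Metric.closedBall 0 ρ) c := by
      intro z₁ hz₁ z₂ hz₂
      rw [mem_closedBall_zero_iff] at hz₁ hz₂
      have hLz : ∀ z : E, ‖z‖ ≤ ρ → L * ‖z‖ ≤ r' / 2 := fun z hz => by
        rw [← hρL]; exact mul_le_mul_of_nonneg_left hz hL0.le
      have hw2 : ‖W z₂ - m.v‖ ≤ r' := by
        have e : W z₂ - m.v = (φ - m.v) + (z₂ - m.l z₂ • m.v) := by simp only [hW]; abel
        rw [e]
        refine (norm_add_le _ _).trans ?_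
        linarith [h.φ_near, hWz z₂, hLz z₂ hz₂]
      have hNw : ‖N (W z₂)‖ ≤ r₀ := by
        have h1 := hN (W z₂) 0
        rw [hN0, sub_zero, sub_zero] at h1
        have h2 : ‖W z₂‖ ≤ ‖m.v‖ + 1 := by
          have := norm_le_norm_add_norm_sub' (W z₂) m.v
          linarith
        have h3 : η ≤ r₀ / (‖m.v‖ + 1) := (min_le_right _ _).trans (min_le_left _ _)
        rw [le_div_iff₀ (by positivity)] at h3
        exact h1.trans ((mul_le_mul_of_nonneg_left h2 hη0.le).trans h3)
      have key := (h.mono hηr₀).residual_sub hr₀1 (s₁ := s z₁) (s₂ := s z₂)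
        (by linarith [hsz z₁, hLz z₁ hz₁]) (by linarith [hsz z₂, hLz z₂ hz₂])
        (w₁ := W z₁) (w₂ := W z₂) (g₁ := N (W z₁)) (g₁' := N (W z₂)) (g₂ := N (W z₂))
        (by linarith) hNw
        ((hN _ _).trans (mul_le_mul_of_nonneg_right hηr₀ (norm_nonneg _)))
      have hd : W z₁ - W z₂ = (z₁ - z₂) - m.l (z₁ - z₂) • m.v := by
        simp only [hW, map_sub]; module
      have hσ : s z₁ - s z₂ = s (z₁ - z₂) := by simp only [hs, map_sub]; ring
      have hA : (m.A : E →L[ℂ] E) (z₁ - z₂) = m.R (W z₁ - W z₂) - m.S (W z₁ - W z₂)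
          - (2 * (s z₁ - s z₂)) • m.v - m.S (N (W z₂) - N (W z₂)) := by
        rw [hd, hσ, sub_self, map_zero, sub_zero]
        simp only [ContinuousLinearEquiv.coe_coe, m.A_apply, map_sub, map_smul, m.R_v, m.S_v, hs]
        module
      rw [hA]
      refine key.trans ?_
      rw [sub_self, norm_zero, add_zero, hd, hσ, hc, mul_assoc _ L]
      exact mul_le_mul_of_nonneg_left (hdd _) (by have := m.const_pos; positivity)
    -- `F - A` has Lipschitz constant `c ≤ 1/(2α)` and `A⁻¹` has norm `α`, so the image of the
    -- `ρ`-ball covers the ball of radius `ρ/(2α)` about `F 0`. It remains to see that `‖F 0‖ = ‖S 0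
    -- (N φ)‖` is at most that.
    have hsurj := happ.surjOn_closedBall_of_nonlinearRightInverse
      m.A.toNonlinearRightInverse hρ0.le subset_rfl
    have h0 : (0 : E) ∈ Metric.closedBall (F 0)
        (((m.A.toNonlinearRightInverse.nnnorm : ℝ)⁻¹ - c) * ρ) := by
      have e : (m.A.toNonlinearRightInverse.nnnorm : ℝ) = α := rfl
      have eF : F 0 = -S 0 (N φ) := by
        simp [hF, hs, hW, bifResidual, h.sol]
      rw [Metric.mem_closedBall, dist_zero_left, e, eF, norm_neg, hc]
      have h1 : 1 / (2 * α) ≤ α⁻¹ - m.const * r₀ * L := by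
        have : m.const * r₀ * L ≤ 1 / (2 * α) := by
          rw [le_div_iff₀ (by positivity)]; linarith
        have e2 : α⁻¹ = 1 / (2 * α) + 1 / (2 * α) := by field_simp; norm_num
        linarith
      refine le_trans ?_ (mul_le_mul_of_nonneg_right h1 hρ0.le)
      have h2 : ‖N φ‖ ≤ η * (‖m.v‖ + 1) := by
        have h3 := hN φ 0
        rw [hN0, sub_zero, sub_zero] at h3
        refine h3.trans (mul_le_mul_of_nonneg_left ?_ hη0.le)
        have := norm_le_norm_add_norm_sub' φ m.v
        linarith [h.φ_near]
      have h3 : ‖S 0 (N φ)‖ ≤ (‖m.S‖ + 1) * (η * (‖m.v‖ + 1)) :=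
        (ContinuousLinearMap.le_opNorm _ _).trans (mul_le_mul
          (h.norm_S_le (by linarith) (by simp)) h2 (norm_nonneg _) (by positivity))
      refine h3.trans ?_
      have h4 : η ≤ ρ / B := (min_le_right _ _).trans (min_le_right _ _)
      rw [le_div_iff₀ hB0] at h4
      rw [one_div_mul_eq_div, le_div_iff₀ (by positivity)]
      refine le_trans (le_of_eq ?_) h4
      rw [hB]; ring
    obtain ⟨z, hz, hFz⟩ := hsurj h0
    rw [mem_closedBall_zero_iff] at hz
    refine ⟨s z, W z, ?_, ?_, hFz⟩
    · have := mul_le_mul_of_nonneg_left hz hL0.le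
      linarith [hsz z]
    · simp [hW, m.l_v]

end BifModel

end Bifurcation

/-! ### L² bounds for derivatives of convolutions of test functions -/

section Test

/-- The partial derivative in the direction `i`. -/
def pd (i : Fin 2) (f : Plane → ℂ) (x : Plane) : ℂ := fderiv ℝ f x (EuclideanSpace.single i 1)

/-- Smooth functions with compact support. -/
structure IsTest (f : Plane → ℂ) : Prop where
  smooth : ContDiff ℝ (⊤ : ℕ∞) f
  compact : HasCompactSupport f

namespace IsTest

variable {f g : Plane → ℂ}

lemma continuous (hf : IsTest f) : Continuous f := hf.smooth.continuous

lemma differentiable (hf : IsTest f) : Differentiable ℝ f := hf.smooth.differentiable (by simp)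

lemma pd (hf : IsTest f) (i : Fin 2) : IsTest (pd i f) where
  smooth := (hf.smooth.fderiv_right (m := (⊤ : ℕ∞)) (by simp)).clm_apply contDiff_const
  compact := by
    refine (hf.compact.fderiv (𝕜 := ℝ)).mono ?_
    intro x hx hx'
    apply hx
    simp only [Dielectric.pd, hx', zero_apply]

lemma add (hf : IsTest f) (hg : IsTest g) : IsTest (f + g) :=
  ⟨hf.smooth.add hg.smooth, hf.compact.add hg.compact⟩

lemma mul (hf : IsTest f) (hg : IsTest g) : IsTest (f * g) :=
  ⟨hf.smooth.mul hg.smooth, hf.compact.mul_right⟩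

lemma conjugate (hf : IsTest f) : IsTest (fun x => conj (f x)) where
  smooth := Complex.conjCLE.contDiff.comp hf.smooth
  compact := hf.compact.comp_left (g := fun z : ℂ => (starRingEnd ℂ) z) (map_zero _)

lemma integrable (hf : IsTest f) : Integrable f := hf.continuous.integrable_of_hasCompactSupport hf.compact

lemma memLp (hf : IsTest f) (p : ℝ≥0∞) : MemLp f p :=
  hf.continuous.memLp_of_hasCompactSupport hf.compact

end IsTest

variable {f g : Plane → ℂ}

lemma pd_conj (hf : IsTest f) (i : Fin 2) (x : Plane) :
    pd i (fun y => conj (f y)) x = conj (pd i f x) := by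
  have h : HasFDerivAt (fun y => Complex.conjCLE (f y)) _ x :=
    (Complex.conjCLE : ℂ →L[ℝ] ℂ).hasFDerivAt.comp x (hf.differentiable x).hasFDerivAt
  have h' : fderiv ℝ (fun y => conj (f y)) x = _ := h.fderiv
  simp only [pd, h']
  rfl

lemma pd_comm (hf : IsTest f) (i j : Fin 2) : pd i (pd j f) = pd j (pd i f) := by
  have hd : ContDiff ℝ (⊤ : ℕ∞) (fderiv ℝ f) := hf.smooth.fderiv_right (by simp)
  have key : ∀ (k l : Fin 2) (x : Plane), pd k (pd l f) x
      = fderiv ℝ (fderiv ℝ f) x (EuclideanSpace.single k 1) (EuclideanSpace.single l 1) := by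
    intro k l x
    have : pd l f = fun y => fderiv ℝ f y (EuclideanSpace.single l 1) := rfl
    rw [pd, this, fderiv_clm_apply (hd.differentiable (by simp) x) (differentiableAt_const _)]
    simp
  ext x
  rw [key, key]
  exact (second_derivative_symmetric (fun y => (hf.differentiable y).hasFDerivAt)
    (hd.differentiable (by simp) x).hasFDerivAt _ _)

lemma integral_pd_mul (hf : IsTest f) (hg : IsTest g) (i : Fin 2) :
    ∫ x, f x * pd i g x = - ∫ x, pd i f x * g x :=
  integral_mul_fderiv_eq_neg_fderiv_mul_of_integrable (((hf.pd i).mul hg).integrable)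
    ((hf.mul (hg.pd i)).integrable) ((hf.mul hg).integrable)
    (fun x _ => hf.differentiable x) (fun x _ => hg.differentiable x)

/-- The Laplacian. -/
def lap (f : Plane → ℂ) : Plane → ℂ := pd 0 (pd 0 f) + pd 1 (pd 1 f)

lemma IsTest.lap (hf : IsTest f) : IsTest (lap f) := ((hf.pd 0).pd 0).add ((hf.pd 1).pd 1)

lemma integral_norm_sq (f : Plane → ℂ) : ((∫ x, ‖f x‖ ^ 2 : ℝ) : ℂ) = ∫ x, f x * conj (f x) := by
  rw [← integral_complex_ofReal]
  congr 1; ext x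
  rw [Complex.mul_conj, Complex.normSq_eq_norm_sq]

/-- One integration by parts on each side: both equal minus the integral of `∂₀∂₀∂₁f` against `conj
(∂₁f)`. -/
lemma integral_mixed (hf : IsTest f) :
    ((∫ x, ‖pd 0 (pd 1 f) x‖ ^ 2 : ℝ) : ℂ) = ∫ x, pd 0 (pd 0 f) x * conj (pd 1 (pd 1 f) x) := by
  rw [integral_norm_sq]
  have h1 := integral_pd_mul (hf.pd 0 |>.pd 0) (hf.conjugate.pd 1) 1
  have h2 := integral_pd_mul (hf.pd 1 |>.pd 0) (hf.conjugate.pd 1) 0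
  have e1 : pd 1 (pd 0 (pd 0 f)) = pd 0 (pd 0 (pd 1 f)) := by
    rw [pd_comm (hf.pd 0), pd_comm hf 1 0]
  rw [e1] at h1
  have e2 : ∀ i j, pd i (pd j fun y => conj (f y)) = fun x => conj (pd i (pd j f) x) := by
    intro i j
    have : pd j (fun y => conj (f y)) = fun x => conj (pd j f x) := funext (pd_conj hf j)
    rw [this]
    exact funext (pd_conj (hf.pd j) i)
  rw [e2] at h1 h2
  rw [h1, h2]

lemma IsTest.integrable_norm_sq (hf : IsTest f) : Integrable (fun x => ‖f x‖ ^ 2) := by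
  have := (hf.memLp 2).integrable_norm_pow (by simp)
  simpa using this

/-- Expand `|a + b|²`; by `integral_mixed` the cross term is a squared norm. All terms being
nonnegative, the Laplacian controls every second derivative. -/
lemma integral_lap (hf : IsTest f) :
    ∫ x, ‖lap f x‖ ^ 2 = (∫ x, ‖pd 0 (pd 0 f) x‖ ^ 2) + (∫ x, ‖pd 1 (pd 1 f) x‖ ^ 2)
      + 2 * ∫ x, ‖pd 0 (pd 1 f) x‖ ^ 2 := by
  have hm := congrArg Complex.re (integral_mixed hf)
  have hi : Integrable fun x => pd 0 (pd 0 f) x * conj (pd 1 (pd 1 f) x) :=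
    (((hf.pd 0).pd 0).mul ((hf.pd 1).pd 1).conjugate).integrable
  rw [Complex.ofReal_re] at hm
  have hre : (∫ x, pd 0 (pd 0 f) x * conj (pd 1 (pd 1 f) x)).re
      = ∫ x, (pd 0 (pd 0 f) x * conj (pd 1 (pd 1 f) x)).re :=
    (integral_re hi).symm
  rw [hre] at hm
  rw [hm, ← integral_const_mul, ← integral_add ((hf.pd 0).pd 0).integrable_norm_sq
    ((hf.pd 1).pd 1).integrable_norm_sq, ← integral_add]
  · congr 1; ext x
    simp only [lap, Pi.add_apply, ← Complex.normSq_eq_norm_sq, Complex.normSq_add]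
  · exact ((hf.pd 0).pd 0).integrable_norm_sq.add ((hf.pd 1).pd 1).integrable_norm_sq
  · exact hi.re.const_mul 2

lemma integral_hess_le (hf : IsTest f) (i j : Fin 2) :
    ∫ x, ‖pd i (pd j f) x‖ ^ 2 ≤ ∫ x, ‖lap f x‖ ^ 2 := by
  have h := integral_lap hf
  have p : ∀ i j, 0 ≤ ∫ x, ‖pd i (pd j f) x‖ ^ 2 := fun i j =>
    integral_nonneg fun x => by positivity
  have p0 := p 0 0; have p1 := p 1 1; have p2 := p 0 1
  have e := pd_comm hf 1 0
  fin_cases i <;> fin_cases j <;> simp only [Fin.zero_eta, Fin.mk_one] <;> (try rw [e]) <;> linarith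

lemma eLpNorm_two_le_of_integral {f g : Plane → ℂ} (hf : IsTest f) (hg : IsTest g)
    (h : ∫ x, ‖f x‖ ^ 2 ≤ ∫ x, ‖g x‖ ^ 2) : eLpNorm f 2 volume ≤ eLpNorm g 2 volume := by
  rw [(hf.memLp 2).eLpNorm_eq_integral_rpow_norm (by simp) (by simp),
    (hg.memLp 2).eLpNorm_eq_integral_rpow_norm (by simp) (by simp)]
  refine ENNReal.ofReal_le_ofReal ?_
  simp only [ENNReal.toReal_ofNat, Real.rpow_two]
  exact Real.rpow_le_rpow (integral_nonneg fun x => by positivity) h (by norm_num)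

lemma eLpNorm_hess_le (hf : IsTest f) (i j : Fin 2) :
    eLpNorm (pd i (pd j f)) 2 volume ≤ eLpNorm (lap f) 2 volume :=
  eLpNorm_two_le_of_integral ((hf.pd j).pd i) hf.lap (integral_hess_le hf i j)

/-- **Young's inequality** for `L¹ * L² ⊆ L²`. -/
lemma lintegral_conv_sq_le {f g : Plane → ℝ≥0∞} (hf : Measurable f) (hg : Measurable g) :
    ∫⁻ x, (∫⁻ y, f y * g (x - y)) ^ 2 ≤ (∫⁻ y, f y) ^ 2 * ∫⁻ y, g y ^ 2 := by
  have h1 : ∀ x, (∫⁻ y, f y * g (x - y)) ^ 2 ≤ (∫⁻ y, f y) * ∫⁻ y, f y * g (x - y) ^ 2 := by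
    intro x
    have hm : Measurable fun y => g (x - y) := hg.comp (measurable_const.sub measurable_id)
    -- Cauchy–Schwarz for the splitting `f g = f^{1/2} · (f^{1/2} g)`.
    have h := ENNReal.lintegral_mul_le_Lp_mul_Lq volume (p := 2) (q := 2)
      (by constructor <;> norm_num) (f := fun y => f y ^ (1 / 2 : ℝ))
      (g := fun y => f y ^ (1 / 2 : ℝ) * g (x - y)) (hf.pow_const _).aemeasurable
      ((hf.pow_const _).mul hm).aemeasurable
    have e : ∀ a : ℝ≥0∞, a ^ (1 / 2 : ℝ) * a ^ (1 / 2 : ℝ) = a := fun a => by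
      rw [← ENNReal.rpow_add_of_nonneg _ _ (by norm_num) (by norm_num)]; norm_num
    have e2 : ∀ a : ℝ≥0∞, (a ^ (1 / 2 : ℝ)) ^ (2 : ℝ) = a := fun a => by
      rw [← ENNReal.rpow_mul]; norm_num
    simp only [Pi.mul_apply, ← mul_assoc, e, ENNReal.mul_rpow_of_nonneg _ _ zero_le_two, e2] at h
    calc (∫⁻ y, f y * g (x - y)) ^ 2
        ≤ ((∫⁻ y, f y) ^ (1 / 2 : ℝ) * (∫⁻ y, f y * g (x - y) ^ (2 : ℝ)) ^ (1 / 2 : ℝ)) ^ 2 := by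
          gcongr
      _ = (∫⁻ y, f y) * ∫⁻ y, f y * g (x - y) ^ 2 := by
          rw [mul_pow, ← ENNReal.rpow_two, ← ENNReal.rpow_two, e2, e2]
          simp
  have hm2 : Measurable fun p : Plane × Plane => f p.2 * g (p.1 - p.2) ^ 2 :=
    (hf.comp measurable_snd).mul ((hg.comp (measurable_fst.sub measurable_snd)).pow_const _)
  calc ∫⁻ x, (∫⁻ y, f y * g (x - y)) ^ 2
      ≤ ∫⁻ x, (∫⁻ y, f y) * ∫⁻ y, f y * g (x - y) ^ 2 := lintegral_mono h1
    _ = (∫⁻ y, f y) * ∫⁻ x, ∫⁻ y, f y * g (x - y) ^ 2 :=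
        lintegral_const_mul _ (hm2.lintegral_prod_right')
    _ = (∫⁻ y, f y) * ∫⁻ y, ∫⁻ x, f y * g (x - y) ^ 2 := by
        rw [lintegral_lintegral_swap hm2.aemeasurable]
    _ = (∫⁻ y, f y) * ∫⁻ y, f y * ∫⁻ x, g x ^ 2 := by
        congr 1
        refine lintegral_congr fun y => ?_
        have hm : Measurable fun x => g (x - y) ^ 2 :=
          (hg.comp (measurable_id.sub measurable_const)).pow_const _
        rw [lintegral_const_mul _ hm]
        congr 1
        exact lintegral_sub_right_eq_self (fun x => g x ^ 2) y
    _ = (∫⁻ y, f y) ^ 2 * ∫⁻ y, g y ^ 2 := by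
        rw [lintegral_mul_const _ hf]; ring

/-- Convolution on the plane. -/
abbrev cv (f g : Plane → ℂ) : Plane → ℂ := convolution f g (ContinuousLinearMap.mul ℝ ℂ) volume

lemma eLpNorm_cv_le (hf : Measurable f) (hg : Measurable g) :
    eLpNorm (cv f g) 2 volume ≤ eLpNorm f 1 volume * eLpNorm g 2 volume := by
  have e2 : ∀ a : ℝ≥0∞, (a ^ 2) ^ (1 / 2 : ℝ) = a := fun a => by
    rw [← ENNReal.rpow_two, ← ENNReal.rpow_mul]; norm_num
  rw [eLpNorm_eq_lintegral_rpow_enorm_toReal (by simp) (by simp),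
    eLpNorm_eq_lintegral_rpow_enorm_toReal (p := 2) (by simp) (by simp), eLpNorm_one_eq_lintegral_enorm]
  simp only [ENNReal.toReal_ofNat, ENNReal.rpow_two]
  rw [← e2 (∫⁻ x, ‖f x‖ₑ), ← ENNReal.mul_rpow_of_nonneg _ _ (by norm_num)]
  refine ENNReal.rpow_le_rpow (le_trans (lintegral_mono fun x => ?_)
    (lintegral_conv_sq_le hf.enorm hg.enorm)) (by norm_num)
  refine pow_le_pow_left₀ zero_le ?_ 2
  rw [cv, convolution_def]
  refine (enorm_integral_le_lintegral_enorm _).trans (le_of_eq ?_)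
  refine lintegral_congr fun y => ?_
  simp [enorm_mul]

lemma IsTest.cv (hf : IsTest f) (hg : IsTest g) : IsTest (cv f g) where
  smooth := hg.compact.contDiff_convolution_right _ hf.integrable.locallyIntegrable hg.smooth
  compact := hf.compact.convolution _ hg.compact

lemma pd_cv_right (hf : IsTest f) (hg : IsTest g) (i : Fin 2) : pd i (cv f g) = cv f (pd i g) := by
  ext x
  have h := hg.compact.hasFDerivAt_convolution_right (ContinuousLinearMap.mul ℝ ℂ)
    hf.integrable.locallyIntegrable (hg.smooth.of_le (by simp)) x
  rw [pd, h.fderiv, convolution_precompR_apply _ hf.integrable.locallyIntegrable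
    (hg.compact.fderiv (𝕜 := ℝ)) (hg.smooth.continuous_fderiv (by simp))]
  rfl

lemma cv_comm (f g : Plane → ℂ) : cv f g = cv g f := by
  rw [cv, ← convolution_flip]
  congr 1
  ext
  simp

lemma pd_cv_left (hf : IsTest f) (hg : IsTest g) (i : Fin 2) : pd i (cv f g) = cv (pd i f) g := by
  rw [cv_comm f g, pd_cv_right hg hf, cv_comm]

lemma lap_cv (hf : IsTest f) (hg : IsTest g) : lap (cv f g) = cv (lap f) g := by
  have : ∀ i, pd i (pd i (cv f g)) = cv (pd i (pd i f)) g := fun i => by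
    rw [pd_cv_left hf hg, pd_cv_left (hf.pd i) hg]
  rw [lap, this, this]
  have h := fun i => hg.compact.convolutionExists_right (ContinuousLinearMap.mul ℝ ℂ)
    ((hf.pd i).pd i).integrable.locallyIntegrable hg.continuous
  exact (ConvolutionExists.add_distrib (h 0) (h 1)).symm

/-- Both derivatives are moved onto the convolution, traded there for the Laplacian, and the
Laplacian is put on `f`. Only `Δf` is needed in L¹: for regularized logarithmic kernels it stays
bounded there, whereas single second derivatives, of size `|x|⁻²`, do not. -/
lemma eLpNorm_cv_hess_le (hf : IsTest f) (hg : IsTest g) (i j : Fin 2) :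
    eLpNorm (cv f (pd i (pd j g))) 2 volume ≤ eLpNorm (lap f) 1 volume * eLpNorm g 2 volume := by
  rw [← pd_cv_right hf (hg.pd j), ← pd_cv_right hf hg]
  refine (eLpNorm_hess_le (hf.cv hg) i j).trans ?_
  rw [lap_cv hf hg]
  exact eLpNorm_cv_le hf.lap.continuous.measurable hg.continuous.measurable

lemma IsTest.eLpNorm_two_sq (hf : IsTest f) :
    eLpNorm f 2 volume = ENNReal.ofReal ((∫ x, ‖f x‖ ^ 2) ^ (1 / 2 : ℝ)) := by
  rw [(hf.memLp 2).eLpNorm_eq_integral_rpow_norm (by simp) (by simp)]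
  simp

/-- Interpolation: `‖∂ᵢf‖² = -∫ ∂ᵢ∂ᵢf · conj f` is at most the larger of `‖f‖²` and `‖∂ᵢ∂ᵢf‖²`. -/
lemma eLpNorm_pd_le (hf : IsTest f) (i : Fin 2) {c : ℝ≥0∞} (h0 : eLpNorm f 2 volume ≤ c)
    (h2 : eLpNorm (pd i (pd i f)) 2 volume ≤ c) : eLpNorm (pd i f) 2 volume ≤ c := by
  have hn : ∀ {g : Plane → ℂ}, 0 ≤ ∫ x, ‖g x‖ ^ 2 := fun {g} =>
    integral_nonneg fun x => by positivity
  have key : ∫ x, ‖pd i f x‖ ^ 2 ≤ max (∫ x, ‖f x‖ ^ 2) (∫ x, ‖pd i (pd i f) x‖ ^ 2) := by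
    have h := integral_norm_sq (pd i f)
    have h' := integral_pd_mul (hf.pd i) hf.conjugate i
    rw [show pd i (fun x => conj (f x)) = fun x => conj (pd i f x) from funext (pd_conj hf i)] at h'
    rw [h'] at h
    have h3 : ∫ x, ‖pd i f x‖ ^ 2 = ‖∫ x, pd i (pd i f) x * conj (f x)‖ := by
      rw [← Complex.norm_of_nonneg (hn (g := pd i f)), h, norm_neg]
    have hi := ((hf.pd i).pd i).integrable_norm_sq
    have h4 : ∫ x, ‖pd i f x‖ ^ 2 ≤ ∫ x, (‖f x‖ ^ 2 + ‖pd i (pd i f) x‖ ^ 2) / 2 := by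
      rw [h3]
      refine norm_integral_le_of_norm_le ((hf.integrable_norm_sq.add hi).div_const 2)
        (Eventually.of_forall fun x => ?_)
      rw [norm_mul, RCLike.norm_conj]
      nlinarith [sq_nonneg (‖f x‖ - ‖pd i (pd i f) x‖)]
    rw [integral_div, integral_add hf.integrable_norm_sq hi] at h4
    rcases le_total (∫ x, ‖f x‖ ^ 2) (∫ x, ‖pd i (pd i f) x‖ ^ 2) with hle | hle
    · rw [max_eq_right hle]; linarith
    · rw [max_eq_left hle]; linarith
  rw [(hf.pd i).eLpNorm_two_sq]
  rw [hf.eLpNorm_two_sq] at h0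
  rw [((hf.pd i).pd i).eLpNorm_two_sq] at h2
  rcases le_max_iff.1 key with h | h
  · exact (ENNReal.ofReal_le_ofReal (Real.rpow_le_rpow hn h (by norm_num))).trans h0
  · exact (ENNReal.ofReal_le_ofReal (Real.rpow_le_rpow hn h (by norm_num))).trans h2

lemma eLpNorm_cv_grad_le (hf : IsTest f) (hg : IsTest g) (i : Fin 2) {c : ℝ≥0∞}
    (h0 : eLpNorm f 1 volume ≤ c) (h2 : eLpNorm (lap f) 1 volume ≤ c) :
    eLpNorm (cv f (pd i g)) 2 volume ≤ c * eLpNorm g 2 volume := by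
  rw [← pd_cv_right hf hg]
  refine eLpNorm_pd_le (hf.cv hg) i ?_ ?_
  · exact (eLpNorm_cv_le hf.continuous.measurable hg.continuous.measurable).trans (by gcongr)
  · rw [pd_cv_right hf hg, pd_cv_right hf (hg.pd i)]
    exact (eLpNorm_cv_hess_le hf hg i i).trans (by gcongr)

end Test

/-! ### Radial kernels with a logarithmic singularity -/

section Radial

/-- The laplacian of a radial function of `t = |x|²`. -/
lemma lap_radial {m m₁ m₂ : ℝ → ℂ} (h1 : ∀ t, 0 ≤ t → HasDerivAt m (m₁ t) t)
    (h2 : ∀ t, 0 ≤ t → HasDerivAt m₁ (m₂ t) t) (x : Plane) :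
    lap (fun x => m (‖x‖ ^ 2)) x = 4 * ((‖x‖ ^ 2 : ℝ) * m₂ (‖x‖ ^ 2) + m₁ (‖x‖ ^ 2)) := by
  have hpd : ∀ (m m₁ : ℝ → ℂ), (∀ t, 0 ≤ t → HasDerivAt m (m₁ t) t) → ∀ (i : Fin 2) (x : Plane),
      HasFDerivAt (fun x : Plane => m (‖x‖ ^ 2))
        ((ContinuousLinearMap.toSpanSingleton ℝ (m₁ (‖x‖ ^ 2))).comp
          (2 • (innerSL ℝ x : Plane →L[ℝ] ℝ))) x := by
    intro m m₁ h i x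
    exact (h (‖x‖ ^ 2) (by positivity)).hasFDerivAt.comp x (hasStrictFDerivAt_norm_sq x).hasFDerivAt
  have hin : ∀ (i : Fin 2) (x : Plane), inner ℝ x (EuclideanSpace.single i (1 : ℝ)) = x i := by
    intro i x
    simp [EuclideanSpace.inner_single_right]
  have hpd' : ∀ (m m₁ : ℝ → ℂ), (∀ t, 0 ≤ t → HasDerivAt m (m₁ t) t) → ∀ (i : Fin 2),
      pd i (fun x : Plane => m (‖x‖ ^ 2)) = fun x => ((2 * x i : ℝ) : ℂ) * m₁ (‖x‖ ^ 2) := by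
    intro m m₁ h i
    ext x
    rw [pd, (hpd m m₁ h i x).fderiv]
    simp [hin, mul_assoc]
  have hpp : ∀ i : Fin 2, pd i (pd i (fun x : Plane => m (‖x‖ ^ 2))) x
      = 4 * (x i : ℂ) ^ 2 * m₂ (‖x‖ ^ 2) + 2 * m₁ (‖x‖ ^ 2) := by
    intro i
    rw [hpd' m m₁ h1 i, pd]
    have hl : HasFDerivAt (fun x : Plane => ((2 * x i : ℝ) : ℂ))
        (Complex.ofRealCLM.comp ((2 : ℝ) • (EuclideanSpace.proj i : Plane →L[ℝ] ℝ))) x :=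
      Complex.ofRealCLM.hasFDerivAt.comp x
        ((EuclideanSpace.proj i : Plane →L[ℝ] ℝ).hasFDerivAt.const_mul 2)
    erw [(hl.mul (hpd m₁ m₂ h2 i x)).fderiv]
    simp [hin]
    ring
  have hsq : ((‖x‖ ^ 2 : ℝ) : ℂ) = (x 0 : ℂ) ^ 2 + (x 1 : ℂ) ^ 2 := by
    rw [EuclideanSpace.norm_sq_eq, Fin.sum_univ_two]
    simp
  rw [lap, Pi.add_apply, hpp, hpp, hsq]
  ring

/-- The radial kernel `A(|x|²) log |x|² + B(|x|²)`. -/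
def rk (A B : ℝ → ℂ) (x : Plane) : ℂ := A (‖x‖ ^ 2) * (Real.log (‖x‖ ^ 2) : ℝ) + B (‖x‖ ^ 2)

/-- The regularization of the radial kernel. -/
def rkε (A B : ℝ → ℂ) (ε : ℝ) (x : Plane) : ℂ :=
  A (‖x‖ ^ 2) * (Real.log (‖x‖ ^ 2 + ε ^ 2) : ℝ) + B (‖x‖ ^ 2)

/-- Smooth functions with first two derivatives bounded by `M` on `[0, T]`. -/
structure C2Bound (A : ℝ → ℂ) (T M : ℝ) : Prop where
  smooth : ContDiff ℝ (⊤ : ℕ∞) A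
  b0 : ∀ t ∈ Set.Icc 0 T, ‖A t‖ ≤ M
  b1 : ∀ t ∈ Set.Icc 0 T, ‖deriv A t‖ ≤ M
  b2 : ∀ t ∈ Set.Icc 0 T, ‖deriv (deriv A) t‖ ≤ M

/-- As `log |x|²` is harmonic off the origin, the terms `A/(t + ε²)` and `-tA/(t + ε²)²` nearly
cancel and leave `A ε²/(t + ε²)²`, an approximate Dirac mass. It is the only term not dominated by a
logarithm uniformly in `ε`. -/
lemma lap_rkε {A B : ℝ → ℂ} (hA : ContDiff ℝ (⊤ : ℕ∞) A) (hB : ContDiff ℝ (⊤ : ℕ∞) B) {ε : ℝ}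
    (hε : 0 < ε) (x : Plane) (t : ℝ) (ht : t = ‖x‖ ^ 2) :
    lap (rkε A B ε) x = 4 * ((t * deriv (deriv A) t + deriv A t) * (Real.log (t + ε ^ 2) : ℝ)
      + 2 * deriv A t * (t / (t + ε ^ 2) : ℝ) + A t * (ε ^ 2 / (t + ε ^ 2) ^ 2 : ℝ)
      + (t * deriv (deriv B) t + deriv B t)) := by
  have hdiff : ∀ {F : ℝ → ℂ}, ContDiff ℝ (⊤ : ℕ∞) F → ∀ t, HasDerivAt F (deriv F t) t :=
    fun hF t => (hF.differentiable (by simp) t).hasDerivAt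
  have hd : ∀ {F : ℝ → ℂ}, ContDiff ℝ (⊤ : ℕ∞) F → ContDiff ℝ (⊤ : ℕ∞) (deriv F) := fun hF =>
    hF.iterate_deriv 1
  have hlog : ∀ t : ℝ, 0 ≤ t → HasDerivAt (fun t : ℝ => ((Real.log (t + ε ^ 2) : ℝ) : ℂ))
      (((t + ε ^ 2)⁻¹ : ℝ) : ℂ) t := fun t ht => by
    have h : HasDerivAt (fun t : ℝ => Real.log (t + ε ^ 2)) ((t + ε ^ 2)⁻¹) t := by
      simpa using ((hasDerivAt_id t).add_const (ε ^ 2)).log (by simp; positivity)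
    exact h.ofReal_comp
  have hinv : ∀ t : ℝ, 0 ≤ t → HasDerivAt (fun t : ℝ => (((t + ε ^ 2)⁻¹ : ℝ) : ℂ))
      ((-(1 / (t + ε ^ 2) ^ 2) : ℝ) : ℂ) t := fun t ht => by
    have h : HasDerivAt (fun t : ℝ => (t + ε ^ 2)⁻¹) (-(1 / (t + ε ^ 2) ^ 2)) t := by
      have := ((hasDerivAt_id t).add_const (ε ^ 2)).inv (by simp; positivity)
      simpa [neg_div] using! this
    exact h.ofReal_comp
  have h1 : ∀ t, 0 ≤ t → HasDerivAt (fun t => A t * (Real.log (t + ε ^ 2) : ℝ) + B t)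
      (deriv A t * (Real.log (t + ε ^ 2) : ℝ) + A t * ((t + ε ^ 2)⁻¹ : ℝ) + deriv B t) t :=
    fun t ht => ((hdiff hA t).mul (hlog t ht)).add (hdiff hB t)
  have h2 : ∀ t, 0 ≤ t → HasDerivAt
      (fun t => deriv A t * (Real.log (t + ε ^ 2) : ℝ) + A t * ((t + ε ^ 2)⁻¹ : ℝ) + deriv B t)
      (deriv (deriv A) t * (Real.log (t + ε ^ 2) : ℝ) + deriv A t * ((t + ε ^ 2)⁻¹ : ℝ)
        + (deriv A t * ((t + ε ^ 2)⁻¹ : ℝ) + A t * (-(1 / (t + ε ^ 2) ^ 2) : ℝ))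
        + deriv (deriv B) t) t :=
    fun t ht => (((hdiff (hd hA) t).mul (hlog t ht)).add ((hdiff hA t).mul (hinv t ht))).add
      (hdiff (hd hB) t)
  have key := lap_radial h1 h2 x
  rw [show rkε A B ε = fun x => (fun t => A t * (Real.log (t + ε ^ 2) : ℝ) + B t) (‖x‖ ^ 2) from rfl,
    key, ← ht]
  have hne : ((t : ℂ) + (ε : ℂ) ^ 2) ≠ 0 := by
    have : 0 < t + ε ^ 2 := by rw [ht]; positivity
    exact_mod_cast this.ne'
  push_cast
  field_simp
  ring

lemma isTest_rkε {A B : ℝ → ℂ} (hA : ContDiff ℝ (⊤ : ℕ∞) A) (hB : ContDiff ℝ (⊤ : ℕ∞) B) {T : ℝ}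
    (hAT : ∀ t, T ≤ t → A t = 0) (hBT : ∀ t, T ≤ t → B t = 0) {ε : ℝ} (hε : 0 < ε) :
    IsTest (rkε A B ε) where
  smooth := by
    have hn : ContDiff ℝ (⊤ : ℕ∞) (fun x : Plane => ‖x‖ ^ 2) := contDiff_norm_sq ℝ
    have hl : ContDiff ℝ (⊤ : ℕ∞) (fun x : Plane => Real.log (‖x‖ ^ 2 + ε ^ 2)) :=
      (hn.add contDiff_const).log fun x => by positivity
    exact ((hA.comp hn).mul (Complex.ofRealCLM.contDiff.comp hl)).add (hB.comp hn)
  compact := by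
    refine HasCompactSupport.intro (isCompact_closedBall (0 : Plane) (Real.sqrt T)) fun x hx => ?_
    rw [mem_closedBall_zero_iff, not_le] at hx
    have : T ≤ ‖x‖ ^ 2 := (Real.lt_sq_of_sqrt_lt hx).le
    simp [rkε, hAT _ this, hBT _ this]

/-- In polar coordinates the density is `r f(r)`, and this product is continuous up to `r = 0` even
when `f` has a logarithm. -/
lemma integrable_radial {f : ℝ → ℝ} {ρ : ℝ} (hf : ContinuousOn (fun r => r * f r) (Set.Icc 0 ρ))
    (h0 : ∀ r, ρ < r → f r = 0) : Integrable fun x : Plane => f ‖x‖ := by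
  rw [integrable_fun_norm_addHaar]
  have e : (fun y : ℝ => y ^ (Module.finrank ℝ Plane - 1) • f y) = fun r => r * f r := by
    ext y; simp
  rw [e]
  have h1 : IntegrableOn (fun r => r * f r) (Set.Icc 0 ρ) := hf.integrableOn_Icc
  refine (h1.of_forall_sdiff_eq_zero measurableSet_Ioi ?_)
  rintro r ⟨hr, hr'⟩
  have : ρ < r := by
    by_contra hh
    exact hr' ⟨le_of_lt hr, not_lt.1 hh⟩
  rw [h0 r this, mul_zero]

/-- The dominating function for logarithmic kernels. -/
def logDom (T : ℝ) (x : Plane) : ℝ :=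
  if ‖x‖ ≤ Real.sqrt T then |Real.log (‖x‖ ^ 2)| + Real.log (T + 1) + 3 else 0

lemma integrable_logDom (T : ℝ) : Integrable (logDom T) := by
  refine integrable_radial (f := fun r => if r ≤ Real.sqrt T then
    |Real.log (r ^ 2)| + Real.log (T + 1) + 3 else 0) (ρ := Real.sqrt T) ?_ ?_
  · have hc : Continuous fun r : ℝ => |2 * (r * Real.log r)| + r * (Real.log (T + 1) + 3) :=
      ((continuous_const.mul Real.continuous_mul_log).abs).add (continuous_id.mul continuous_const)
    refine hc.continuousOn.congr fun r hr => ?_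
    simp only [hr.2, if_true, Real.log_pow, abs_mul, abs_of_nonneg hr.1]
    push_cast
    ring
  · intro r hr
    simp [not_le.2 hr]

lemma integrable_logDom_sq (T : ℝ) : Integrable fun x => logDom T x ^ 2 := by
  refine integrable_radial (f := fun r => (if r ≤ Real.sqrt T then
    |Real.log (r ^ 2)| + Real.log (T + 1) + 3 else 0) ^ 2) (ρ := Real.sqrt T) ?_ ?_
  -- Continuity at `0` is made visible by writing the density as a square: `√r log(r²) = 4 √r log
  -- √r`, and `x log x` is continuous.
  · have hc : Continuous fun r : ℝ => (|4 * (Real.sqrt r * Real.log (Real.sqrt r))|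
        + Real.sqrt r * (Real.log (T + 1) + 3)) ^ 2 := by
      refine (((continuous_const.mul (Real.continuous_mul_log.comp Real.continuous_sqrt)).abs).add
        (Real.continuous_sqrt.mul continuous_const)).pow 2
    refine hc.continuousOn.congr fun r hr => ?_
    have h1 : r = Real.sqrt r ^ 2 := (Real.sq_sqrt hr.1).symm
    have h2 : 0 ≤ Real.sqrt r := Real.sqrt_nonneg r
    simp only [hr.2, if_true]
    rw [abs_mul, abs_mul, abs_of_nonneg h2, Real.log_sqrt hr.1, Real.log_pow, abs_mul, abs_div]
    conv_lhs => enter [1]; rw [h1]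
    push_cast
    norm_num
    ring
  · intro r hr
    simp [not_le.2 hr]

lemma logDom_nonneg {T : ℝ} (hT : 0 ≤ T) (x : Plane) : 0 ≤ logDom T x := by
  unfold logDom
  split_ifs
  · have : 0 ≤ Real.log (T + 1) := Real.log_nonneg (by linarith)
    positivity
  · exact le_rfl

lemma abs_log_add_le {t T ε : ℝ} (ht : 0 < t) (htT : t ≤ T) (hε1 : ε ≤ 1) (hε : 0 ≤ ε) :
    |Real.log (t + ε ^ 2)| ≤ |Real.log t| + Real.log (T + 1) := by
  have h1 : Real.log t ≤ Real.log (t + ε ^ 2) := Real.log_le_log ht (by nlinarith)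
  have h2 : Real.log (t + ε ^ 2) ≤ Real.log (T + 1) :=
    Real.log_le_log (by positivity) (by nlinarith)
  have h3 : 0 ≤ Real.log (T + 1) := Real.log_nonneg (by linarith)
  rw [abs_le]
  constructor
  · linarith [neg_abs_le (Real.log t)]
  · linarith [abs_nonneg (Real.log t)]

lemma C2Bound.nonneg {A : ℝ → ℂ} {T M : ℝ} (h : C2Bound A T M) (hT : 0 ≤ T) : 0 ≤ M :=
  (norm_nonneg _).trans (h.b0 0 ⟨le_rfl, hT⟩)

variable {A B : ℝ → ℂ} {T M : ℝ}

lemma norm_rkε_le (hT : 0 ≤ T) (hA : C2Bound A T M) (hB : C2Bound B T M)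
    (hAT : ∀ t, T ≤ t → A t = 0) (hBT : ∀ t, T ≤ t → B t = 0) {ε : ℝ} (hε : 0 ≤ ε) (hε1 : ε ≤ 1)
    {x : Plane} (hx : x ≠ 0) : ‖rkε A B ε x‖ ≤ M * logDom T x := by
  have hM := hA.nonneg hT
  have ht0 : 0 < ‖x‖ ^ 2 := by have := norm_pos_iff.2 hx; positivity
  rcases le_or_gt (‖x‖ ^ 2) T with h | h
  · have h' : ‖x‖ ≤ Real.sqrt T := Real.le_sqrt_of_sq_le h
    have hm : ‖x‖ ^ 2 ∈ Set.Icc 0 T := ⟨ht0.le, h⟩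
    simp only [logDom, h', if_true, rkε]
    refine (norm_add_le _ _).trans ?_
    rw [norm_mul, Complex.norm_real, Real.norm_eq_abs]
    have h1 := abs_log_add_le ht0 h hε1 hε
    have h2 := mul_le_mul (hA.b0 _ hm) h1 (abs_nonneg _) hM
    have h3 := hB.b0 _ hm
    nlinarith
  · simp only [rkε, hAT _ h.le, hBT _ h.le, zero_mul, add_zero, norm_zero]
    exact mul_nonneg hM (logDom_nonneg hT x)

lemma norm_lap_rkε_le (hT : 0 ≤ T) (hA : C2Bound A T M) (hB : C2Bound B T M)
    (hAT : ∀ t, T ≤ t → A t = 0) (hBT : ∀ t, T ≤ t → B t = 0) {ε : ℝ} (hε : 0 < ε) (hε1 : ε ≤ 1)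
    {x : Plane} (hx : x ≠ 0) : ‖lap (rkε A B ε) x‖
      ≤ M * (4 * (T + 1) * logDom T x) + M * (4 * (ε ^ 2 / (‖x‖ ^ 2 + ε ^ 2) ^ 2)) := by
  have hM := hA.nonneg hT
  have ht0 : 0 < ‖x‖ ^ 2 := by have := norm_pos_iff.2 hx; positivity
  rcases le_or_gt (‖x‖ ^ 2) T with h | h
  · have h' : ‖x‖ ≤ Real.sqrt T := Real.le_sqrt_of_sq_le h
    simp only [logDom, h', if_true]
    rw [lap_rkε hA.smooth hB.smooth hε x _ rfl]
    have hm : ‖x‖ ^ 2 ∈ Set.Icc 0 T := ⟨ht0.le, h⟩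
    have h1 := abs_log_add_le ht0 h hε1 hε.le
    have a0 := hA.b0 _ hm; have a1 := hA.b1 _ hm; have a2 := hA.b2 _ hm
    have c1 := hB.b1 _ hm; have c2 := hB.b2 _ hm
    generalize ‖x‖ ^ 2 = t at *
    have hP : 0 ≤ ε ^ 2 / (t + ε ^ 2) ^ 2 := by positivity
    have hQ0 : 0 ≤ t / (t + ε ^ 2) := by positivity
    have hQ : t / (t + ε ^ 2) ≤ 1 := by
      rw [div_le_one (by positivity)]; nlinarith
    have hL : 0 ≤ Real.log (T + 1) := Real.log_nonneg (by linarith)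
    have e1 : ∀ {F : ℝ → ℂ}, ‖deriv F t‖ ≤ M → ‖deriv (deriv F) t‖ ≤ M →
        ‖(t : ℂ) * deriv (deriv F) t + deriv F t‖ ≤ M * (T + 1) := fun f1 f2 => by
      refine (norm_add_le _ _).trans ?_
      rw [norm_mul, Complex.norm_real, Real.norm_eq_abs, abs_of_pos ht0]
      nlinarith
    have n1 : ‖(t * deriv (deriv A) t + deriv A t) * (Real.log (t + ε ^ 2) : ℝ)‖
        ≤ M * (T + 1) * (|Real.log t| + Real.log (T + 1)) := by
      rw [norm_mul, Complex.norm_real, Real.norm_eq_abs]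
      exact mul_le_mul (e1 a1 a2) h1 (abs_nonneg _) (by positivity)
    have n2 : ‖2 * deriv A t * (t / (t + ε ^ 2) : ℝ)‖ ≤ 2 * M := by
      rw [norm_mul, norm_mul, Complex.norm_real, Real.norm_eq_abs, abs_of_nonneg hQ0,
        Complex.norm_two]
      nlinarith [norm_nonneg (deriv A t)]
    have n3 : ‖A t * (ε ^ 2 / (t + ε ^ 2) ^ 2 : ℝ)‖ ≤ M * (ε ^ 2 / (t + ε ^ 2) ^ 2) := by
      rw [norm_mul, Complex.norm_real, Real.norm_eq_abs, abs_of_nonneg hP]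
      exact mul_le_mul_of_nonneg_right a0 hP
    have n4 := e1 c1 c2
    rw [norm_mul]
    have n5 := (norm_add_le _ _).trans (add_le_add ((norm_add_le _ _).trans (add_le_add
      ((norm_add_le _ _).trans (add_le_add n1 n2)) n3)) n4)
    have n6 : ‖(4 : ℂ)‖ = 4 := by norm_num
    rw [n6]
    have : 0 ≤ M * T := mul_nonneg hM hT
    nlinarith
  -- `T < ‖x‖²` is strict, so the kernel vanishes on a whole neighbourhood of `x`.
  · have h0 : lap (rkε A B ε) x = 0 := by
      have hev : rkε A B ε =ᶠ[nhds x] 0 := by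
        have ho : IsOpen {y : Plane | T < ‖y‖ ^ 2} :=
          isOpen_lt continuous_const (continuous_norm.pow 2)
        filter_upwards [ho.mem_nhds h] with y hy
        simp [rkε, hAT _ (le_of_lt hy), hBT _ (le_of_lt hy)]
      have hpd : ∀ (i : Fin 2) {f : Plane → ℂ}, f =ᶠ[nhds x] 0 → pd i f =ᶠ[nhds x] 0 := by
        intro i f hf
        have := hf.fderiv (𝕜 := ℝ)
        filter_upwards [this] with y hy
        rw [pd, hy]
        simp
      have h2 := fun i => (hpd i (hpd i hev)).self_of_nhds
      simp only [lap, Pi.add_apply, h2]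
      simp
    rw [h0, norm_zero]
    have := logDom_nonneg hT x
    positivity

/-- The integral of the Poisson-type kernel. -/
def poissonMass : ℝ := ∫ x : Plane, 1 / (1 + ‖x‖ ^ 2) ^ 2

lemma integrable_poisson : Integrable fun x : Plane => 1 / (1 + ‖x‖ ^ 2) ^ 2 := by
  have h := integrable_rpow_neg_one_add_norm_sq (E := Plane) (μ := volume) (r := 4) (by simp; norm_num)
  refine h.congr (Eventually.of_forall fun x => ?_)
  show (1 + ‖x‖ ^ 2) ^ (-(4 : ℝ) / 2) = _
  rw [show (-(4 : ℝ) / 2) = -((2 : ℕ) : ℝ) by norm_num, Real.rpow_neg (by positivity), Real.rpow_natCast]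
  simp

lemma poisson_scale {ε : ℝ} (hε : 0 < ε) (x : Plane) :
    ε ^ 2 / (‖x‖ ^ 2 + ε ^ 2) ^ 2 = (ε⁻¹) ^ 2 * (1 / (1 + ‖ε⁻¹ • x‖ ^ 2) ^ 2) := by
  rw [norm_smul, Real.norm_eq_abs, abs_of_pos (inv_pos.2 hε)]
  field_simp
  ring_nf

lemma integrable_poissonε {ε : ℝ} (hε : 0 < ε) :
    Integrable fun x : Plane => ε ^ 2 / (‖x‖ ^ 2 + ε ^ 2) ^ 2 := by
  simp_rw [poisson_scale hε]
  exact (integrable_poisson.comp_smul (inv_ne_zero hε.ne')).const_mul _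

/-- By dilation in dimension two the mass does not depend on `ε`; this is the uniform L¹ bound for
the singular part of the Laplacian. -/
lemma integral_poissonε {ε : ℝ} (hε : 0 < ε) :
    ∫ x : Plane, ε ^ 2 / (‖x‖ ^ 2 + ε ^ 2) ^ 2 = poissonMass := by
  simp_rw [poisson_scale hε]
  rw [integral_const_mul, Measure.integral_comp_smul volume (fun x : Plane => 1 / (1 + ‖x‖ ^ 2) ^ 2)]
  have : Module.finrank ℝ Plane = 2 := by simp
  rw [this, abs_of_pos (by positivity), poissonMass, smul_eq_mul, ← mul_assoc]
  field_simp

/-- The constant in the `L¹` bounds of regularized kernels. -/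
def radialConst (T : ℝ) : ℝ := 4 * (T + 1) * (∫ x, logDom T x) + 4 * poissonMass

lemma poissonMass_nonneg : 0 ≤ poissonMass := integral_nonneg fun x => by positivity

lemma radialConst_nonneg (hT : 0 ≤ T) : 0 ≤ radialConst T := by
  have h1 := poissonMass_nonneg
  have h2 : 0 ≤ ∫ x, logDom T x := integral_nonneg (logDom_nonneg hT)
  unfold radialConst; positivity

lemma ae_ne_zero : ∀ᵐ x : Plane, x ≠ 0 := by
  rw [ae_iff]; simp

lemma eLpNorm_one_le_of_ae {f : Plane → ℂ} {g : Plane → ℝ} {c : ℝ} (hg : Integrable g)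
    (h : ∀ᵐ x, ‖f x‖ ≤ g x) (hc : ∫ x, g x ≤ c) : eLpNorm f 1 volume ≤ ENNReal.ofReal c := by
  rw [eLpNorm_one_eq_lintegral_enorm]
  calc ∫⁻ x, ‖f x‖ₑ ≤ ∫⁻ x, ENNReal.ofReal (g x) := by
        refine lintegral_mono_ae ?_
        filter_upwards [h] with x hx
        rw [← ofReal_norm]; exact ENNReal.ofReal_le_ofReal hx
    _ = ENNReal.ofReal (∫ x, g x) := (ofReal_integral_eq_lintegral_ofReal hg (by
        filter_upwards [h] with x hx using (norm_nonneg _).trans hx)).symm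
    _ ≤ _ := ENNReal.ofReal_le_ofReal hc

lemma eLpNorm_rkε_le (hT : 0 ≤ T) (hA : C2Bound A T M) (hB : C2Bound B T M)
    (hAT : ∀ t, T ≤ t → A t = 0) (hBT : ∀ t, T ≤ t → B t = 0) {ε : ℝ} (hε : 0 < ε) (hε1 : ε ≤ 1) :
    eLpNorm (rkε A B ε) 1 volume ≤ ENNReal.ofReal (radialConst T * M) := by
  refine eLpNorm_one_le_of_ae ((integrable_logDom T).const_mul M) ?_ ?_
  · filter_upwards [ae_ne_zero] with x hx using norm_rkε_le hT hA hB hAT hBT hε.le hε1 hx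
  · have hM := hA.nonneg hT
    have h1 := poissonMass_nonneg
    have h2 : 0 ≤ ∫ x, logDom T x := integral_nonneg (logDom_nonneg hT)
    rw [integral_const_mul, radialConst, mul_comm]
    refine mul_le_mul_of_nonneg_right ?_ hM
    nlinarith [mul_nonneg hT h2]

lemma eLpNorm_lap_rkε_le (hT : 0 ≤ T) (hA : C2Bound A T M) (hB : C2Bound B T M)
    (hAT : ∀ t, T ≤ t → A t = 0) (hBT : ∀ t, T ≤ t → B t = 0) {ε : ℝ} (hε : 0 < ε) (hε1 : ε ≤ 1) :
    eLpNorm (lap (rkε A B ε)) 1 volume ≤ ENNReal.ofReal (radialConst T * M) := by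
  have i1 := ((integrable_logDom T).const_mul (4 * (T + 1))).const_mul M
  have i2 := ((integrable_poissonε hε).const_mul 4).const_mul M
  refine eLpNorm_one_le_of_ae (i1.add i2) ?_ ?_
  · filter_upwards [ae_ne_zero] with x hx using norm_lap_rkε_le hT hA hB hAT hBT hε hε1 hx
  · refine le_of_eq ((integral_add' i1 i2).trans ?_)
    simp only [integral_const_mul, integral_poissonε hε, radialConst]
    ring

lemma measurable_rk (hA : ContDiff ℝ (⊤ : ℕ∞) A) (hB : ContDiff ℝ (⊤ : ℕ∞) B) :
    Measurable (rk A B) := by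
  have hn : Measurable fun x : Plane => ‖x‖ ^ 2 := measurable_norm.pow_const 2
  exact ((hA.continuous.measurable.comp hn).mul (Complex.measurable_ofReal.comp
    (Real.measurable_log.comp hn))).add (hB.continuous.measurable.comp hn)

/-- Convolutions with regularized kernels converge. -/
lemma tendsto_cv_rkε (hT : 0 ≤ T) (hA : C2Bound A T M) (hB : C2Bound B T M)
    (hAT : ∀ t, T ≤ t → A t = 0) (hBT : ∀ t, T ≤ t → B t = 0) {φ : Plane → ℂ} (hφ : IsTest φ)
    (x : Plane) : Tendsto (fun n : ℕ => cv (rkε A B (1 / ((n : ℝ) + 1))) φ x) atTop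
      (nhds (cv (rk A B) φ x)) := by
  have hε : ∀ n : ℕ, 0 < 1 / ((n : ℝ) + 1) := fun n => by positivity
  have hε1 : ∀ n : ℕ, 1 / ((n : ℝ) + 1) ≤ 1 := fun n => by
    rw [div_le_one (by positivity)]; linarith [Nat.cast_nonneg (α := ℝ) n]
  obtain ⟨b, hb⟩ := hφ.continuous.bounded_above_of_compact_support hφ.compact
  have hb0 : 0 ≤ b := (norm_nonneg _).trans (hb 0)
  refine tendsto_integral_of_dominated_convergence (fun y => M * logDom T y * b) ?_ ?_ ?_ ?_
  · intro n
    exact ((isTest_rkε hA.smooth hB.smooth hAT hBT (hε n)).continuous.mul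
      (hφ.continuous.comp (continuous_const.sub continuous_id))).aestronglyMeasurable
  · exact ((integrable_logDom T).const_mul M).mul_const b
  · intro n
    filter_upwards [ae_ne_zero] with y hy
    rw [ContinuousLinearMap.mul_apply', norm_mul]
    exact mul_le_mul (norm_rkε_le hT hA hB hAT hBT (hε n).le (hε1 n) hy) (hb _) (norm_nonneg _)
      (mul_nonneg (hA.nonneg hT) (logDom_nonneg hT y))
  · filter_upwards [ae_ne_zero] with y hy
    have ht0 : 0 < ‖y‖ ^ 2 := by have := norm_pos_iff.2 hy; positivity
    simp only [ContinuousLinearMap.mul_apply']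
    refine Tendsto.mul_const _ ?_
    have hz : Tendsto (fun n : ℕ => 1 / ((n : ℝ) + 1)) atTop (nhds 0) :=
      tendsto_one_div_add_atTop_nhds_zero_nat
    have h1 : Tendsto (fun n : ℕ => ‖y‖ ^ 2 + (1 / ((n : ℝ) + 1)) ^ 2) atTop
        (nhds (‖y‖ ^ 2)) := by simpa using tendsto_const_nhds.add (hz.pow 2)
    have h2 := (Real.continuousAt_log ht0.ne').tendsto.comp h1
    exact (tendsto_const_nhds.mul ((Complex.continuous_ofReal.tendsto _).comp h2)).add
      tendsto_const_nhds

lemma eLpNorm_le_of_tendsto {f : ℕ → Plane → ℂ} {g : Plane → ℂ} {c : ℝ≥0∞}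
    (hf : ∀ n, Continuous (f n)) (h : ∀ x, Tendsto (fun n => f n x) atTop (nhds (g x)))
    (hc : ∀ n, eLpNorm (f n) 2 volume ≤ c) : eLpNorm g 2 volume ≤ c :=
  (Lp.eLpNorm_lim_le_liminf_eLpNorm (fun n => (hf n).aestronglyMeasurable) g
    (Eventually.of_forall h)).trans (liminf_le_of_frequently_le'
      (Frequently.of_forall hc))

/-- The bound for test functions applies to the regularized kernels with a constant independent of
`ε`, and Fatou's lemma passes it to the limit. -/
theorem eLpNorm_cv_rk_hess_le (hT : 0 ≤ T) (hA : C2Bound A T M) (hB : C2Bound B T M)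
    (hAT : ∀ t, T ≤ t → A t = 0) (hBT : ∀ t, T ≤ t → B t = 0) {φ : Plane → ℂ} (hφ : IsTest φ)
    (i j : Fin 2) : eLpNorm (cv (rk A B) (pd i (pd j φ))) 2 volume
      ≤ ENNReal.ofReal (radialConst T * M) * eLpNorm φ 2 volume := by
  have hε : ∀ n : ℕ, 0 < 1 / ((n : ℝ) + 1) := fun n => by positivity
  have hε1 : ∀ n : ℕ, 1 / ((n : ℝ) + 1) ≤ 1 := fun n => by
    rw [div_le_one (by positivity)]; linarith [Nat.cast_nonneg (α := ℝ) n]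
  have ht := fun n => isTest_rkε hA.smooth hB.smooth hAT hBT (hε n)
  refine eLpNorm_le_of_tendsto (fun n => ((ht n).cv ((hφ.pd j).pd i)).continuous)
    (tendsto_cv_rkε hT hA hB hAT hBT ((hφ.pd j).pd i)) fun n => ?_
  exact (eLpNorm_cv_hess_le (ht n) hφ i j).trans
    (mul_le_mul_left (eLpNorm_lap_rkε_le hT hA hB hAT hBT (hε n) (hε1 n)) _)

theorem eLpNorm_cv_rk_grad_le (hT : 0 ≤ T) (hA : C2Bound A T M) (hB : C2Bound B T M)
    (hAT : ∀ t, T ≤ t → A t = 0) (hBT : ∀ t, T ≤ t → B t = 0) {φ : Plane → ℂ} (hφ : IsTest φ)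
    (i : Fin 2) : eLpNorm (cv (rk A B) (pd i φ)) 2 volume
      ≤ ENNReal.ofReal (radialConst T * M) * eLpNorm φ 2 volume := by
  have hε : ∀ n : ℕ, 0 < 1 / ((n : ℝ) + 1) := fun n => by positivity
  have hε1 : ∀ n : ℕ, 1 / ((n : ℝ) + 1) ≤ 1 := fun n => by
    rw [div_le_one (by positivity)]; linarith [Nat.cast_nonneg (α := ℝ) n]
  have ht := fun n => isTest_rkε hA.smooth hB.smooth hAT hBT (hε n)
  refine eLpNorm_le_of_tendsto (fun n => ((ht n).cv (hφ.pd i)).continuous)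
    (tendsto_cv_rkε hT hA hB hAT hBT (hφ.pd i)) fun n => ?_
  exact eLpNorm_cv_grad_le (ht n) hφ i (eLpNorm_rkε_le hT hA hB hAT hBT (hε n) (hε1 n))
    (eLpNorm_lap_rkε_le hT hA hB hAT hBT (hε n) (hε1 n))

/-- A smooth cutoff, `1` on `(-∞, T]` and `0` on `[T + 1, ∞)`. -/
def cutoff (T t : ℝ) : ℂ := (Real.smoothTransition (T + 1 - t) : ℝ)

lemma contDiff_cutoff (T : ℝ) : ContDiff ℝ (⊤ : ℕ∞) (cutoff T) :=
  Complex.ofRealCLM.contDiff.comp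
    (Real.smoothTransition.contDiff.comp (contDiff_const.sub contDiff_id))

lemma cutoff_eq_one {t : ℝ} (ht : t ≤ T) : cutoff T t = 1 := by
  rw [cutoff, Real.smoothTransition.one_of_one_le (by linarith)]; simp

lemma cutoff_eq_zero {t : ℝ} (ht : T + 1 ≤ t) : cutoff T t = 0 := by
  rw [cutoff, Real.smoothTransition.zero_of_nonpos (by linarith)]; simp

lemma exists_C2Bound {F : ℝ → ℂ} (hF : ContDiff ℝ (⊤ : ℕ∞) F) (T : ℝ) : ∃ c > 0, C2Bound F T c := by
  have hd : ∀ {F : ℝ → ℂ}, ContDiff ℝ (⊤ : ℕ∞) F → ContDiff ℝ (⊤ : ℕ∞) (deriv F) := fun hF =>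
    hF.iterate_deriv 1
  have hb : ∀ {F : ℝ → ℂ}, ContDiff ℝ (⊤ : ℕ∞) F → ∃ c, ∀ t ∈ Set.Icc 0 T, ‖F t‖ ≤ c := fun hF =>
    isCompact_Icc.exists_bound_of_continuousOn hF.continuous.continuousOn
  obtain ⟨c0, h0⟩ := hb hF
  obtain ⟨c1, h1⟩ := hb (hd hF)
  obtain ⟨c2, h2⟩ := hb (hd (hd hF))
  refine ⟨|c0| + |c1| + |c2| + 1, by positivity, hF, fun t ht => ?_, fun t ht => ?_, fun t ht => ?_⟩
  · linarith [h0 t ht, le_abs_self c0, abs_nonneg c1, abs_nonneg c2]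
  · linarith [h1 t ht, le_abs_self c1, abs_nonneg c0, abs_nonneg c2]
  · linarith [h2 t ht, le_abs_self c2, abs_nonneg c0, abs_nonneg c1]

lemma C2Bound.mul {F G : ℝ → ℂ} {a b : ℝ} (hF : C2Bound F T a) (hG : C2Bound G T b) :
    C2Bound (fun t => F t * G t) T (4 * a * b) := by
  have hd : ∀ {F : ℝ → ℂ}, ContDiff ℝ (⊤ : ℕ∞) F → ContDiff ℝ (⊤ : ℕ∞) (deriv F) := fun hF =>
    hF.iterate_deriv 1
  have hdf : ∀ {F : ℝ → ℂ}, ContDiff ℝ (⊤ : ℕ∞) F → Differentiable ℝ F := fun hF =>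
    hF.differentiable (by simp)
  have e1 : deriv (fun t => F t * G t) = fun t => deriv F t * G t + F t * deriv G t := by
    ext t; exact deriv_fun_mul (hdf hF.smooth t) (hdf hG.smooth t)
  have e2 : deriv (deriv (fun t => F t * G t)) = fun t =>
      deriv (deriv F) t * G t + deriv F t * deriv G t
        + (deriv F t * deriv G t + F t * deriv (deriv G) t) := by
    rw [e1]; ext t
    exact (((hdf (hd hF.smooth) t).hasDerivAt.fun_mul (hdf hG.smooth t).hasDerivAt).fun_add
      ((hdf hF.smooth t).hasDerivAt.fun_mul (hdf (hd hG.smooth) t).hasDerivAt)).deriv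
  have hp : ∀ {x y : ℂ}, ‖x‖ ≤ a → ‖y‖ ≤ b → ‖x * y‖ ≤ a * b := fun hx hy => by
    rw [norm_mul]
    exact mul_le_mul hx hy (norm_nonneg _) ((norm_nonneg _).trans hx)
  have hab : ∀ t ∈ Set.Icc 0 T, 0 ≤ a * b := fun t ht =>
    mul_nonneg ((norm_nonneg _).trans (hF.b0 t ht)) ((norm_nonneg _).trans (hG.b0 t ht))
  refine ⟨hF.smooth.mul hG.smooth, fun t ht => ?_, fun t ht => ?_, fun t ht => ?_⟩
  · linarith [hp (hF.b0 t ht) (hG.b0 t ht), hab t ht]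
  · rw [e1]
    refine (norm_add_le _ _).trans ?_
    linarith [hp (hF.b1 t ht) (hG.b0 t ht), hp (hF.b0 t ht) (hG.b1 t ht), hab t ht]
  · rw [e2]
    refine ((norm_add_le _ _).trans (add_le_add (norm_add_le _ _) (norm_add_le _ _))).trans ?_
    linarith [hp (hF.b2 t ht) (hG.b0 t ht), hp (hF.b1 t ht) (hG.b1 t ht),
      hp (hF.b0 t ht) (hG.b2 t ht)]

/-- Second derivatives of convolutions with radial kernels, which may be changed away from the
origin. -/
theorem exists_radial_bound (hT : 0 ≤ T) : ∃ c > 0, ∀ (A B : ℝ → ℂ) (M : ℝ), C2Bound A (T + 1) M →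
    C2Bound B (T + 1) M → ∃ k : Plane → ℂ, Measurable k ∧ (∀ x, ‖x‖ ^ 2 ≤ T → k x = rk A B x) ∧
      eLpNorm k 2 volume ≤ ENNReal.ofReal (c * M) ∧
      ∀ φ, IsTest φ → ∀ i j,
        eLpNorm (cv k (pd i φ)) 2 volume ≤ ENNReal.ofReal (c * M) * eLpNorm φ 2 volume ∧
        eLpNorm (cv k (pd i (pd j φ))) 2 volume
          ≤ ENNReal.ofReal (c * M) * eLpNorm φ 2 volume := by
  obtain ⟨c, hc, hcut⟩ := exists_C2Bound (contDiff_cutoff T) (T + 1)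
  have hT' : 0 ≤ T + 1 := by linarith
  have hr := radialConst_nonneg hT'
  set s := ∫ x, logDom (T + 1) x ^ 2 with hs
  have hs0 : 0 ≤ s := integral_nonneg fun x => by positivity
  -- `4 c M` bounds the profiles after multiplication by the cutoff. The summand `s + 1` serves the
  -- L² norm of the kernel, `radialConst (T + 1)` the derivatives.
  refine ⟨(radialConst (T + 1) + s + 1) * (4 * c), by positivity, fun A B M hA hB => ?_⟩
  have hM : 0 ≤ M := hA.nonneg hT'
  have hA' := hcut.mul hA
  have hB' := hcut.mul hB
  have hAT : ∀ t, T + 1 ≤ t → cutoff T t * A t = 0 := fun t ht => by rw [cutoff_eq_zero ht, zero_mul]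
  have hBT : ∀ t, T + 1 ≤ t → cutoff T t * B t = 0 := fun t ht => by rw [cutoff_eq_zero ht, zero_mul]
  have hle : radialConst (T + 1) * (4 * c * M) ≤ (radialConst (T + 1) + s + 1) * (4 * c) * M := by
    rw [mul_assoc _ (4 * c)]
    refine mul_le_mul_of_nonneg_right (by linarith) (by positivity)
  -- The cutoff is `1` up to `T`, so the kernel is unchanged there, and `0` from `T + 1` on, so the
  -- new kernel has compact support.
  refine ⟨rk (fun t => cutoff T t * A t) (fun t => cutoff T t * B t),
    measurable_rk hA'.smooth hB'.smooth, fun x hx => ?_, ?_, fun φ hφ i j => ⟨?_, ?_⟩⟩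
  · simp [rk, cutoff_eq_one hx]
  · have hm : MemLp (fun x => logDom (T + 1) x) 2 volume := by
      refine (memLp_two_iff_integrable_sq ?_).2 (integrable_logDom_sq _)
      exact (integrable_logDom _).aestronglyMeasurable
    have h1 : eLpNorm (rk (fun t => cutoff T t * A t) (fun t => cutoff T t * B t)) 2 volume
        ≤ ENNReal.ofReal (4 * c * M) * eLpNorm (logDom (T + 1)) 2 volume := by
      refine eLpNorm_le_mul_eLpNorm_of_ae_le_mul ?_ 2
      filter_upwards [ae_ne_zero] with x hx
      have := norm_rkε_le hT' hA' hB' hAT hBT le_rfl zero_le_one hx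
      rw [Real.norm_of_nonneg (logDom_nonneg hT' x)]
      simpa [rkε, rk] using this
    have h2 : eLpNorm (logDom (T + 1)) 2 volume ≤ ENNReal.ofReal (s + 1) := by
      rw [hm.eLpNorm_eq_integral_rpow_norm (by simp) (by simp)]
      refine ENNReal.ofReal_le_ofReal ?_
      have e : ∫ x, ‖logDom (T + 1) x‖ ^ (2 : ℝ) = s := by
        rw [hs]; congr 1; ext x; rw [Real.rpow_two, Real.norm_eq_abs, sq_abs]
      simp only [ENNReal.toReal_ofNat, e]
      calc s ^ (2 : ℝ)⁻¹ ≤ (s + 1) ^ (2 : ℝ)⁻¹ :=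
            Real.rpow_le_rpow hs0 (by linarith) (by norm_num)
        _ ≤ (s + 1) ^ (1 : ℝ) :=
            Real.rpow_le_rpow_of_exponent_le (by linarith) (by norm_num)
        _ = s + 1 := Real.rpow_one _
    refine h1.trans ((mul_le_mul_right h2 _).trans ?_)
    rw [← ENNReal.ofReal_mul (by positivity)]
    refine ENNReal.ofReal_le_ofReal ?_
    have : 0 ≤ radialConst (T + 1) * (4 * c * M) := by positivity
    linarith
  · exact (eLpNorm_cv_rk_grad_le hT' hA' hB' hAT hBT hφ i).trans
      (mul_le_mul_left (ENNReal.ofReal_le_ofReal hle) _)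
  · exact (eLpNorm_cv_rk_hess_le hT' hA' hB' hAT hBT hφ i j).trans
      (mul_le_mul_left (ENNReal.ofReal_le_ofReal hle) _)

end Radial

/-! ### Weak derivatives by duality -/

section WeakDerivatives

/-- The Riesz representation of a functional which is bounded with respect to a map into a Hilbert
space. -/
lemma exists_riesz {V H : Type*} [AddCommGroup V] [Module ℂ V] [NormedAddCommGroup H]
    [InnerProductSpace ℂ H] [CompleteSpace H] (j : V →ₗ[ℂ] H) (ℓ : V →ₗ[ℂ] ℂ) {C : ℝ} (hC : 0 ≤ C)
    (h : ∀ x, ‖ℓ x‖ ≤ C * ‖j x‖) : ∃ y : H, ‖y‖ ≤ C ∧ ∀ x, ℓ x = inner ℂ y (j x) := by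
  -- The bound makes `ℓ` descend to the range of `j`, where it is continuous; Hahn–Banach extends it
  -- to `H` with the same norm.
  have hker : LinearMap.ker j ≤ LinearMap.ker ℓ := fun x hx => by
    rw [LinearMap.mem_ker] at hx ⊢
    have := h x
    rw [hx, norm_zero, mul_zero] at this
    exact norm_le_zero_iff.1 this
  set g₀ : LinearMap.range j →ₗ[ℂ] ℂ :=
    ((LinearMap.ker j).liftQ ℓ hker).comp j.quotKerEquivRange.symm.toLinearMap with hg₀
  have hg : ∀ x, g₀ ⟨j x, x, rfl⟩ = ℓ x := fun x => by
    have e : j.quotKerEquivRange.symm ⟨j x, x, rfl⟩ = (LinearMap.ker j).mkQ x := by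
      rw [LinearEquiv.symm_apply_eq]; rfl
    simp only [hg₀, LinearMap.comp_apply, LinearEquiv.coe_coe, e, Submodule.mkQ_apply,
      Submodule.liftQ_apply]
  have hb : ∀ p, ‖g₀ p‖ ≤ C * ‖p‖ := by
    rintro ⟨_, x, rfl⟩
    rw [hg]; exact h x
  obtain ⟨G, hG, hGn⟩ := exists_extension_norm_eq _ (g₀.mkContinuous C hb)
  refine ⟨(InnerProductSpace.toDual ℂ H).symm G, ?_, fun x => ?_⟩
  · rw [LinearIsometryEquiv.norm_map, hGn]
    exact LinearMap.mkContinuous_norm_le _ hC _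
  · rw [InnerProductSpace.toDual_symm_apply, ← hg]
    exact (hG ⟨j x, x, rfl⟩).symm

/-- Test functions supported in `D`. -/
def testSpace (D : Set Plane) : Submodule ℂ (Plane → ℂ) where
  carrier := {φ | IsTest φ ∧ tsupport φ ⊆ D}
  zero_mem' := ⟨⟨contDiff_const, HasCompactSupport.zero⟩, by simp [tsupport]⟩
  add_mem' := fun ha hb => ⟨ha.1.add hb.1,
    (tsupport_add _ _).trans (Set.union_subset ha.2 hb.2)⟩
  smul_mem' := fun c f hf => ⟨⟨contDiff_const.smul hf.1.smooth,
    hf.1.compact.smul_left (f := fun _ => c)⟩, (closure_mono (Function.support_const_smul_subset c f)).trans hf.2⟩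

variable {D : Set Plane}

lemma tsupport_pd_subset (i : Fin 2) (f : Plane → ℂ) : tsupport (pd i f) ⊆ tsupport f := by
  refine (closure_mono ?_).trans (tsupport_fderiv_subset ℝ (f := f))
  |>.trans subset_rfl
  intro x hx hx'
  exact hx (by simp [pd, hx'])

lemma testSpace_pd {φ : Plane → ℂ} (h : φ ∈ testSpace D) (i : Fin 2) : pd i φ ∈ testSpace D :=
  ⟨h.1.pd i, (tsupport_pd_subset i φ).trans h.2⟩

lemma eLpNorm_volOn_of_tsupport {φ : Plane → ℂ} (h : tsupport φ ⊆ D)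
    (p : ℝ≥0∞) : eLpNorm φ p (volOn D) = eLpNorm φ p volume := by
  refine eLpNorm_restrict_eq_of_support_subset ?_
  exact (subset_tsupport φ).trans h

/-- A weak derivative of any order, from a bound on the corresponding functional. -/
lemma exists_weak {w : Plane → ℂ} (hw : MemLp w 2 (volOn D)) (P : (Plane → ℂ) → (Plane → ℂ))
    (hP : ∀ φ ∈ testSpace D, P φ ∈ testSpace D)
    (hadd : ∀ φ ∈ testSpace D, ∀ ψ ∈ testSpace D, P (φ + ψ) = P φ + P ψ)
    (hsmul : ∀ (c : ℂ), ∀ φ ∈ testSpace D, P (c • φ) = c • P φ) {C : ℝ} (hC : 0 ≤ C)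
    (h : ∀ φ ∈ testSpace D, ‖∫ x in D, w x * P φ x‖ ≤ C * (eLpNorm φ 2 (volOn D)).toReal) :
    ∃ g : Plane → ℂ, MemLp g 2 (volOn D) ∧ eLpNorm g 2 (volOn D) ≤ ENNReal.ofReal C ∧
      ∀ φ ∈ testSpace D, ∫ x in D, w x * P φ x = ∫ x in D, φ x * g x := by
  have hint : ∀ φ ∈ testSpace D, Integrable (fun x => w x * φ x) (volOn D) := fun φ hφ =>
    hw.integrable_mul ((hφ.1.memLp 2).restrict D)
  have hm : ∀ φ : testSpace D, MemLp φ.1 2 (volOn D) := fun φ => (φ.2.1.memLp 2).restrict D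
  set j : testSpace D →ₗ[ℂ] Lp ℂ 2 (volOn D) :=
    { toFun := fun φ => (hm φ).toLp φ.1
      map_add' := fun a b => rfl
      map_smul' := fun c a => rfl } with hj
  set ℓ : testSpace D →ₗ[ℂ] ℂ :=
    { toFun := fun φ => ∫ x in D, w x * P φ.1 x
      map_add' := fun a b => by
        rw [← integral_add (hint _ (hP _ a.2)) (hint _ (hP _ b.2)), Submodule.coe_add,
          hadd _ a.2 _ b.2]
        congr 1; ext x; simp [mul_add]
      map_smul' := fun c a => by
        rw [Submodule.coe_smul, hsmul c _ a.2, RingHom.id_apply, smul_eq_mul, ← integral_const_mul]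
        congr 1; ext x; simp [mul_left_comm] } with hℓ
  obtain ⟨y, hy, hyx⟩ := exists_riesz j ℓ hC (fun φ => by
    have e : ‖j φ‖ = (eLpNorm φ.1 2 (volOn D)).toReal := Lp.norm_toLp _ (hm φ)
    rw [e]
    exact h φ.1 φ.2)
  refine ⟨fun x => conj (y x), ?_, ?_, fun φ hφ => ?_⟩
  · exact (Lp.memLp y).star
  · have e : eLpNorm (fun x => conj (y x)) 2 (volOn D) = eLpNorm y 2 (volOn D) :=
      eLpNorm_congr_norm_ae (Eventually.of_forall fun x => RCLike.norm_conj _)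
    rw [e, ← ENNReal.ofReal_toReal (Lp.eLpNorm_ne_top y)]
    exact ENNReal.ofReal_le_ofReal hy
  · have := hyx ⟨φ, hφ⟩
    rw [L2.inner_def] at this
    refine this.trans (integral_congr_ae ?_)
    filter_upwards [MemLp.coeFn_toLp (hm ⟨φ, hφ⟩)] with x hx
    have hx' : j ⟨φ, hφ⟩ x = φ x := hx
    rw [hx', RCLike.inner_apply]

lemma pd_add {f g : Plane → ℂ} (hf : IsTest f) (hg : IsTest g) (i : Fin 2) :
    pd i (f + g) = pd i f + pd i g := by
  ext x
  simp [pd, fderiv_add (hf.differentiable x) (hg.differentiable x)]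

lemma pd_smul {f : Plane → ℂ} (hf : IsTest f) (c : ℂ) (i : Fin 2) :
    pd i (c • f) = c • pd i f := by
  ext x
  simp [pd, fderiv_const_smul (hf.differentiable x)]

lemma sum_sq_le {a b : ℝ≥0∞} {x : Fin 2 → ℝ≥0∞} {y : Fin 2 → Fin 2 → ℝ≥0∞} (hx : ∀ i, x i ≤ b)
    (hy : ∀ i j, y i j ≤ b) :
    a ^ 2 + ∑ i, x i ^ 2 + ∑ i, ∑ j, y i j ^ 2 ≤ (a + 3 * b) ^ 2 := by
  have h1 : ∑ i, x i ^ 2 ≤ ∑ _i : Fin 2, b ^ 2 :=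
    Finset.sum_le_sum fun i _ => pow_le_pow_left₀ zero_le (hx i) 2
  have h2 : ∑ i, ∑ j, y i j ^ 2 ≤ ∑ _i : Fin 2, ∑ _j : Fin 2, b ^ 2 :=
    Finset.sum_le_sum fun i _ => Finset.sum_le_sum fun j _ =>
      pow_le_pow_left₀ zero_le (hy i j) 2
  calc a ^ 2 + ∑ i, x i ^ 2 + ∑ i, ∑ j, y i j ^ 2
      ≤ a ^ 2 + ∑ _i : Fin 2, b ^ 2 + ∑ _i : Fin 2, ∑ _j : Fin 2, b ^ 2 :=
        add_le_add (add_le_add le_rfl h1) h2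
    _ ≤ a ^ 2 + ∑ _i : Fin 2, b ^ 2 + ∑ _i : Fin 2, ∑ _j : Fin 2, b ^ 2
          + (6 * (a * b) + 3 * b ^ 2) := le_self_add
    _ = (a + 3 * b) ^ 2 := by simp only [Finset.sum_const, Finset.card_univ, Fintype.card_fin]; ring

/-- Functions whose weak derivatives are bounded functionals on `L²` are in `H²`. -/
theorem memH2_of_bound {w : Plane → ℂ} (hw : MemLp w 2 (volOn D)) {C : ℝ} (hC : 0 ≤ C)
    (h1 : ∀ φ ∈ testSpace D, ∀ i,
      ‖∫ x in D, w x * pd i φ x‖ ≤ C * (eLpNorm φ 2 (volOn D)).toReal)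
    (h2 : ∀ φ ∈ testSpace D, ∀ i j,
      ‖∫ x in D, w x * pd i (pd j φ) x‖ ≤ C * (eLpNorm φ 2 (volOn D)).toReal) :
    MemH2 D w ∧ eH2Norm D w ≤ eLpNorm w 2 (volOn D) + ENNReal.ofReal (3 * C) := by
  have hg := fun i => exists_weak hw (pd i) (fun φ hφ => testSpace_pd hφ i)
    (fun φ hφ ψ hψ => pd_add hφ.1 hψ.1 i) (fun c φ hφ => pd_smul hφ.1 c i) hC
    (fun φ hφ => h1 φ hφ i)
  have hH := fun i j => exists_weak hw (fun φ => pd i (pd j φ))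
    (fun φ hφ => testSpace_pd (testSpace_pd hφ j) i)
    (fun φ hφ ψ hψ => by rw [pd_add hφ.1 hψ.1, pd_add (hφ.1.pd j) (hψ.1.pd j)])
    (fun c φ hφ => by rw [pd_smul hφ.1, pd_smul (hφ.1.pd j)]) hC
    (fun φ hφ => h2 φ hφ i j)
  choose g hg1 hg2 hg3 using hg
  choose H hH1 hH2 hH3 using hH
  have hc : ∀ φ : Plane → ℝ, ContDiff ℝ (⊤ : ℕ∞) φ → HasCompactSupport φ → tsupport φ ⊆ D →
      (fun x => (φ x : ℂ)) ∈ testSpace D ∧ ∀ i, pd i (fun x => (φ x : ℂ))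
        = fun x => ((fderiv ℝ φ x (EuclideanSpace.single i 1) : ℝ) : ℂ) := by
    intro φ h h' h''
    refine ⟨⟨⟨Complex.ofRealCLM.contDiff.comp h, h'.comp_left (g := Complex.ofReal) rfl⟩, ?_⟩,
      fun i => ?_⟩
    · refine (closure_mono ?_).trans h''
      intro x hx hx'
      exact hx (by simp [hx'])
    · ext x
      have : HasFDerivAt (fun x => (φ x : ℂ)) _ x := Complex.ofRealCLM.hasFDerivAt.comp x
        (h.differentiable (by simp) x).hasFDerivAt
      rw [pd, this.fderiv]; rfl
  -- `g i` represents `φ ↦ ∫ w ∂ᵢφ`, so the weak gradient is `-g`; in the Hessian the two signs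
  -- cancel.
  have hjet : IsH2Jet D w (fun i x => -g i x) H := by
    refine ⟨hw, fun i => (hg1 i).neg, hH1, fun i φ h h' h'' => ?_, fun i j φ h h' h'' => ?_⟩
    · obtain ⟨hφ, hd⟩ := hc φ h h' h''
      have := hg3 i _ hφ
      rw [hd] at this
      simp only [Complex.real_smul, mul_neg, integral_neg, neg_neg]
      rw [← this]
      congr 1; ext x; ring
    · obtain ⟨hφ, hd⟩ := hc φ h h' h''
      have e1 := hg3 i _ (testSpace_pd hφ j)
      have e2 := hH3 i j _ hφ
      rw [e1] at e2
      rw [hd] at e2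
      simp only [Complex.real_smul, mul_neg, integral_neg]
      rw [e2]
  refine ⟨⟨_, _, hjet⟩, ?_⟩
  unfold eH2Norm
  refine iInf₂_le_of_le (fun i x => -g i x) H (iInf_le_of_le hjet ?_)
  set a := eLpNorm w 2 (volOn D)
  set b := ENNReal.ofReal C with hb
  have hg4 : ∀ i, eLpNorm (fun x => -g i x) 2 (volOn D) ≤ b := fun i => by
    have : eLpNorm (fun x => -g i x) 2 (volOn D) = eLpNorm (g i) 2 (volOn D) := eLpNorm_neg (g i) 2 _
    rw [this]; exact hg2 i
  have h3 : ENNReal.ofReal (3 * C) = 3 * b := by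
    rw [ENNReal.ofReal_mul (by norm_num)]; simp [hb]
  rw [h3]
  have hsum := sum_sq_le (a := a) hg4 hH2
  refine (ENNReal.rpow_le_rpow hsum (by norm_num)).trans ?_
  rw [← ENNReal.rpow_two, ← ENNReal.rpow_mul]
  norm_num

end WeakDerivatives

/-! ### Convolution operators from L²(D) to L^∞(D) -/

section ConvolutionOperators

lemma lintegral_enorm_mul_le {α : Type*} [MeasurableSpace α] {μ : Measure α} {f g : α → ℂ}
    (hf : AEStronglyMeasurable f μ) (hg : AEStronglyMeasurable g μ) :
    ∫⁻ x, ‖f x‖ₑ * ‖g x‖ₑ ∂μ ≤ eLpNorm f 2 μ * eLpNorm g 2 μ := by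
  have h := eLpNorm_smul_le_mul_eLpNorm (p := 2) (q := 2) (r := 1) hg hf
  rw [eLpNorm_one_eq_lintegral_enorm] at h
  simpa [enorm_mul] using h

lemma norm_integral_mul_le {α : Type*} [MeasurableSpace α] {μ : Measure α} {f g : α → ℂ}
    (hf : MemLp f 2 μ) (hg : MemLp g 2 μ) :
    ‖∫ x, f x * g x ∂μ‖ ≤ (eLpNorm f 2 μ).toReal * (eLpNorm g 2 μ).toReal := by
  rw [← ENNReal.toReal_mul, ← toReal_enorm]
  refine ENNReal.toReal_mono (ENNReal.mul_ne_top hf.eLpNorm_ne_top hg.eLpNorm_ne_top) ?_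
  refine (enorm_integral_le_lintegral_enorm _).trans ?_
  simp only [enorm_mul]
  exact lintegral_enorm_mul_le hf.1 hg.1

/-- Measurable kernels `k(x - y)` which are bounded by `M` in `L²(D, dy)`, uniformly in `x ∈ D`. -/
structure IsKernel (D : Set Plane) (k : Plane → ℂ) (M : ℝ) : Prop where
  meas : Measurable k
  nonneg : 0 ≤ M
  bound : ∀ x ∈ D, eLpNorm (fun y => k (x - y)) 2 (volOn D) ≤ ENNReal.ofReal M

variable {D : Set Plane} {k k' : Plane → ℂ} {M M' : ℝ}

lemma eLpNorm_comp_sub_le (hk : Measurable k) (D : Set Plane) (x : Plane) :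
    eLpNorm (fun y => k (x - y)) 2 (volOn D) ≤ eLpNorm k 2 volume := by
  refine (eLpNorm_mono_measure _ Measure.restrict_le_self).trans (le_of_eq ?_)
  exact eLpNorm_comp_measurePreserving (g := k) hk.aestronglyMeasurable
    (Measure.measurePreserving_sub_left volume x)

/-- Only values on `D - D` matter, so a kernel may be compared with one that is square integrable
over the plane, where reflection and translation preserve the norm. -/
lemma IsKernel.of_eLpNorm (hk : Measurable k) (hk' : Measurable k') (hM : 0 ≤ M)
    (h : eLpNorm k 2 volume ≤ ENNReal.ofReal M) (he : ∀ x ∈ D, ∀ y ∈ D, k' (x - y) = k (x - y))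
    (hD : MeasurableSet D) : IsKernel D k' M where
  meas := hk'
  nonneg := hM
  bound x hx := by
    have : eLpNorm (fun y => k' (x - y)) 2 (volOn D) = eLpNorm (fun y => k (x - y)) 2 (volOn D) :=
      eLpNorm_congr_ae (by
        filter_upwards [ae_restrict_mem hD] with y hy using he x hx y hy)
    rw [this]
    exact (eLpNorm_comp_sub_le hk D x).trans h

lemma IsKernel.mono (h : IsKernel D k M) (hM : M ≤ M') : IsKernel D k M' :=
  ⟨h.meas, h.nonneg.trans hM, fun x hx => (h.bound x hx).trans (ENNReal.ofReal_le_ofReal hM)⟩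

lemma IsKernel.add (h : IsKernel D k M) (h' : IsKernel D k' M') :
    IsKernel D (fun x => k x + k' x) (M + M') where
  meas := h.meas.add h'.meas
  nonneg := add_nonneg h.nonneg h'.nonneg
  bound x hx := by
    rw [ENNReal.ofReal_add h.nonneg h'.nonneg]
    have m : ∀ {k : Plane → ℂ}, Measurable k → AEStronglyMeasurable (fun y => k (x - y)) (volOn D) :=
      fun hk => (hk.comp (measurable_const.sub measurable_id)).aestronglyMeasurable
    exact (eLpNorm_add_le (m h.meas) (m h'.meas) one_le_two).trans
      (add_le_add (h.bound x hx) (h'.bound x hx))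

lemma IsKernel.smul (h : IsKernel D k M) (c : ℂ) : IsKernel D (fun x => c * k x) (‖c‖ * M) where
  meas := h.meas.const_mul c
  nonneg := mul_nonneg (norm_nonneg _) h.nonneg
  bound x hx := by
    rw [ENNReal.ofReal_mul (norm_nonneg _), ofReal_norm]
    have := eLpNorm_const_smul c (fun y => k (x - y)) 2 (volOn D)
    exact this.le.trans (mul_le_mul_right (h.bound x hx) _)

lemma isKernel_of_bound [IsFiniteMeasure (volOn D)] (hk : Measurable k) (hM : 0 ≤ M)
    (hD : MeasurableSet D) (hb : ∀ x ∈ D, ∀ y ∈ D, ‖k (x - y)‖ ≤ M) :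
    IsKernel D k (M * (volOn D Set.univ ^ (1 / 2 : ℝ)).toReal) where
  meas := hk
  nonneg := by positivity
  bound x hx := by
    have h := eLpNorm_le_of_ae_bound (p := 2) (μ := volOn D) (f := fun y => k (x - y)) (C := M)
      (by filter_upwards [ae_restrict_mem hD] with y hy using hb x hx y hy)
    refine h.trans (le_of_eq ?_)
    rw [ENNReal.ofReal_mul hM, ENNReal.ofReal_toReal
      (ENNReal.rpow_ne_top_of_nonneg (by norm_num) (measure_ne_top _ _)), mul_comm]
    norm_num

/-- Convolution over `D`. -/
def convF (D : Set Plane) (k f : Plane → ℂ) (x : Plane) : ℂ := ∫ y in D, k (x - y) * f y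

lemma IsKernel.memLp (h : IsKernel D k M) {x : Plane} (hx : x ∈ D) :
    MemLp (fun y => k (x - y)) 2 (volOn D) :=
  ⟨(h.meas.comp (measurable_const.sub measurable_id)).aestronglyMeasurable,
    (h.bound x hx).trans_lt ENNReal.ofReal_lt_top⟩

lemma IsKernel.integrable (h : IsKernel D k M) {f : Plane → ℂ} (hf : MemLp f 2 (volOn D))
    {x : Plane} (hx : x ∈ D) : Integrable (fun y => k (x - y) * f y) (volOn D) :=
  (h.memLp hx).integrable_mul hf

lemma IsKernel.norm_convF_le (h : IsKernel D k M) {f : Plane → ℂ} (hf : MemLp f 2 (volOn D))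
    {x : Plane} (hx : x ∈ D) : ‖convF D k f x‖ ≤ M * (eLpNorm f 2 (volOn D)).toReal := by
  refine (norm_integral_mul_le (h.memLp hx) hf).trans ?_
  refine mul_le_mul_of_nonneg_right ?_ ENNReal.toReal_nonneg
  exact ENNReal.toReal_le_of_le_ofReal h.nonneg (h.bound x hx)

lemma IsKernel.aestronglyMeasurable_convF (h : IsKernel D k M) {f : Plane → ℂ}
    (hf : AEStronglyMeasurable f (volOn D)) : AEStronglyMeasurable (convF D k f) (volOn D) := by
  have hm : AEStronglyMeasurable (fun p : Plane × Plane => k (p.1 - p.2) * f p.2)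
      ((volOn D).prod (volOn D)) :=
    (h.meas.comp (measurable_fst.sub measurable_snd)).aestronglyMeasurable.mul hf.comp_snd
  exact hm.integral_prod_right'

lemma IsKernel.memLp_convF [IsFiniteMeasure (volOn D)] (hD : MeasurableSet D) (h : IsKernel D k M)
    {f : Plane → ℂ} (hf : MemLp f 2 (volOn D)) : MemLp (convF D k f) 2 (volOn D) :=
  MemLp.of_bound (h.aestronglyMeasurable_convF hf.1) (M * (eLpNorm f 2 (volOn D)).toReal) (by
    filter_upwards [ae_restrict_mem hD] with x hx using h.norm_convF_le hf hx)

lemma convF_congr {f g : Plane → ℂ} (h : f =ᵐ[volOn D] g) : convF D k f = convF D k g := by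
  ext x
  refine integral_congr_ae ?_
  filter_upwards [h] with y hy
  rw [hy]

/-- Fubini's theorem for convolutions over `D`. -/
lemma IsKernel.integral_convF_mul [IsFiniteMeasure (volOn D)] (hD : MeasurableSet D)
    (h : IsKernel D k M) {f g : Plane → ℂ} (hf : MemLp f 2 (volOn D)) (hg : MemLp g 2 (volOn D)) :
    ∫ x in D, convF D k f x * g x = ∫ y in D, f y * convF D (fun z => k (-z)) g y := by
  have hm : AEStronglyMeasurable (fun p : Plane × Plane => k (p.1 - p.2) * f p.2 * g p.1)
      ((volOn D).prod (volOn D)) :=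
    ((h.meas.comp (measurable_fst.sub measurable_snd)).aestronglyMeasurable.mul
      hf.1.comp_snd).mul hg.1.comp_fst
  have hg1 : Integrable g (volOn D) := hg.integrable one_le_two
  -- For fixed `x` the inner integral of the modulus is at most `M ‖f‖₂ |g x|` by Cauchy–Schwarz,
  -- and `g` is integrable because `D` has finite measure.
  have hi : Integrable (fun p : Plane × Plane => k (p.1 - p.2) * f p.2 * g p.1)
      ((volOn D).prod (volOn D)) := by
    rw [integrable_prod_iff hm]
    constructor
    · filter_upwards [ae_restrict_mem hD] with x hx
      exact (h.integrable hf hx).mul_const _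
    · refine (hg1.norm.const_mul (M * (eLpNorm f 2 (volOn D)).toReal)).mono'
        hm.norm.integral_prod_right' ?_
      filter_upwards [ae_restrict_mem hD] with x hx
      have e : (fun y => ‖k (x - y) * f y * g x‖) = fun y => ‖k (x - y) * f y‖ * ‖g x‖ := by
        ext y; rw [norm_mul]
      simp only [e, integral_mul_const]
      rw [norm_mul, norm_norm]
      refine mul_le_mul_of_nonneg_right ?_ (norm_nonneg _)
      rw [Real.norm_of_nonneg (integral_nonneg fun _ => norm_nonneg _),
        integral_norm_eq_lintegral_enorm (h.integrable hf hx).1]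
      refine ENNReal.toReal_le_of_le_ofReal (mul_nonneg h.nonneg ENNReal.toReal_nonneg) ?_
      simp only [enorm_mul]
      refine (lintegral_enorm_mul_le (h.memLp hx).1 hf.1).trans ?_
      rw [ENNReal.ofReal_mul h.nonneg, ENNReal.ofReal_toReal hf.eLpNorm_ne_top]
      exact mul_le_mul_left (h.bound x hx) _
  have e1 : ∫ x in D, convF D k f x * g x = ∫ x in D, ∫ y in D, k (x - y) * f y * g x := by
    congr 1; ext x
    rw [integral_mul_const]; rfl
  rw [e1, integral_integral_swap hi]
  congr 1; ext y
  rw [convF, ← integral_const_mul]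
  congr 1; ext x
  rw [neg_sub]; ring

/-- The Hilbert space of the problem. -/
abbrev L2 (D : Set Plane) : Type := Lp ℂ 2 (volOn D)

/-- The square root of the area. -/
def sqrtArea (D : Set Plane) : ℝ := (volOn D Set.univ ^ (1 / 2 : ℝ)).toReal

lemma sqrtArea_nonneg : 0 ≤ sqrtArea D := ENNReal.toReal_nonneg

lemma norm_le_of_ae_bound [IsFiniteMeasure (volOn D)] {f : L2 D} {c : ℝ} (hc : 0 ≤ c)
    (h : ∀ᵐ x ∂volOn D, ‖f x‖ ≤ c) : ‖f‖ ≤ sqrtArea D * c := by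
  have h' := eLpNorm_le_of_ae_bound (p := 2) h
  rw [Lp.norm_def]
  refine ENNReal.toReal_le_of_le_ofReal (mul_nonneg sqrtArea_nonneg hc) (h'.trans (le_of_eq ?_))
  rw [ENNReal.ofReal_mul sqrtArea_nonneg, sqrtArea, ENNReal.ofReal_toReal
      (ENNReal.rpow_ne_top_of_nonneg (by norm_num) (measure_ne_top _ _))]
  norm_num

/-- Convolution over `D` as a linear map on `L²(D)`. -/
def convLin [IsFiniteMeasure (volOn D)] (hD : MeasurableSet D) (h : IsKernel D k M) :
    L2 D →ₗ[ℂ] L2 D where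
  toFun f := (h.memLp_convF hD (Lp.memLp f)).toLp _
  map_add' f g := by
    rw [← MemLp.toLp_add, MemLp.toLp_eq_toLp_iff]
    filter_upwards [ae_restrict_mem hD] with x hx
    rw [Pi.add_apply, convF_congr (Lp.coeFn_add f g)]
    simp only [convF, Pi.add_apply, mul_add]
    exact integral_add (h.integrable (Lp.memLp f) hx) (h.integrable (Lp.memLp g) hx)
  map_smul' c f := by
    rw [RingHom.id_apply, ← MemLp.toLp_const_smul, MemLp.toLp_eq_toLp_iff]
    refine Eventually.of_forall fun x => ?_
    rw [Pi.smul_apply, convF_congr (Lp.coeFn_smul c f)]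
    simp only [convF, Pi.smul_apply, smul_eq_mul, mul_left_comm _ c]
    exact integral_const_mul _ _

lemma norm_convLin_le [IsFiniteMeasure (volOn D)] (hD : MeasurableSet D) (h : IsKernel D k M)
    (f : L2 D) : ‖convLin hD h f‖ ≤ sqrtArea D * M * ‖f‖ := by
  rw [mul_assoc]
  refine norm_le_of_ae_bound (mul_nonneg h.nonneg (norm_nonneg _)) ?_
  filter_upwards [ae_restrict_mem hD, (h.memLp_convF hD (Lp.memLp f)).coeFn_toLp] with x hx hx'
  exact (congrArg norm hx').le.trans (h.norm_convF_le (Lp.memLp f) hx)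

open Classical in
/-- Convolution over `D` as an operator on `L²(D)`, and `0` if this does not make sense. -/
def convL (D : Set Plane) [IsFiniteMeasure (volOn D)] (k : Plane → ℂ) : L2 D →L[ℂ] L2 D :=
  if h : MeasurableSet D ∧ ∃ M, IsKernel D k M then
    (convLin h.1 h.2.choose_spec).mkContinuous _ (norm_convLin_le h.1 h.2.choose_spec) else 0

/-- The diagonal `y = x` is null, so the value at the origin is immaterial; the Green function and
its expansion may differ there. -/
lemma convF_congr_kernel (hD : MeasurableSet D) (he : ∀ x ∈ D, ∀ y ∈ D, x ≠ y → k (x - y) = k' (x - y))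
    (f : Plane → ℂ) {x : Plane} (hx : x ∈ D) : convF D k f x = convF D k' f x := by
  refine integral_congr_ae ?_
  have h0 : ∀ᵐ y ∂volOn D, y ≠ x := by
    refine ae_restrict_of_ae ?_
    rw [ae_iff]; simp
  filter_upwards [ae_restrict_mem hD, h0] with y hy hy'
  rw [he x hx y hy hy'.symm]

variable [IsFiniteMeasure (volOn D)]

lemma convL_ae (hD : MeasurableSet D) (h : IsKernel D k M) (f : L2 D) :
    convL D k f =ᵐ[volOn D] convF D k f := by
  have h' : MeasurableSet D ∧ ∃ M, IsKernel D k M := ⟨hD, M, h⟩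
  rw [convL, dif_pos h']
  exact (h'.2.choose_spec.memLp_convF hD (Lp.memLp f)).coeFn_toLp

lemma norm_convL_apply_le (hD : MeasurableSet D) (h : IsKernel D k M) (f : L2 D) :
    ∀ᵐ x ∂volOn D, ‖convL D k f x‖ ≤ M * ‖f‖ := by
  filter_upwards [ae_restrict_mem hD, convL_ae hD h f] with x hx hx'
  rw [hx']
  exact h.norm_convF_le (Lp.memLp f) hx

lemma norm_convL_le (hD : MeasurableSet D) (h : IsKernel D k M) :
    ‖convL D k‖ ≤ sqrtArea D * M := by
  refine ContinuousLinearMap.opNorm_le_bound _ (mul_nonneg sqrtArea_nonneg h.nonneg) fun f => ?_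
  rw [mul_assoc]
  exact norm_le_of_ae_bound (mul_nonneg h.nonneg (norm_nonneg _)) (norm_convL_apply_le hD h f)

lemma convL_add (hD : MeasurableSet D) (h : IsKernel D k M) (h' : IsKernel D k' M') :
    convL D (fun x => k x + k' x) = convL D k + convL D k' := by
  ext1 f
  refine Lp.ext ?_
  rw [add_apply]
  filter_upwards [ae_restrict_mem hD, convL_ae hD (h.add h') f, convL_ae hD h f, convL_ae hD h' f,
    Lp.coeFn_add (convL D k f) (convL D k' f)] with x hx e e1 e2 e3
  rw [e, e3, Pi.add_apply, e1, e2]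
  simp only [convF, add_mul]
  exact integral_add (h.integrable (Lp.memLp f) hx) (h'.integrable (Lp.memLp f) hx)

lemma convL_smul (hD : MeasurableSet D) (h : IsKernel D k M) (c : ℂ) :
    convL D (fun x => c * k x) = c • convL D k := by
  ext1 f
  refine Lp.ext ?_
  rw [smul_apply]
  filter_upwards [convL_ae hD (h.smul c) f, convL_ae hD h f,
    Lp.coeFn_smul c (convL D k f)] with x e e1 e3
  rw [e, e3, Pi.smul_apply, e1]
  simp only [convF, mul_assoc]
  exact integral_const_mul _ _

lemma convL_sub (hD : MeasurableSet D) (h : IsKernel D k M) (h' : IsKernel D k' M') :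
    convL D (fun x => k x - k' x) = convL D k - convL D k' := by
  have := convL_add hD h (h'.smul (-1))
  rw [convL_smul hD h'] at this
  simpa [sub_eq_add_neg] using this

/-- Convolution with a real even kernel is symmetric. -/
lemma inner_convL (hD : MeasurableSet D) (h : IsKernel D k M) (hreal : ∀ x, conj (k x) = k x)
    (heven : ∀ x, k (-x) = k x) (f g : L2 D) :
    inner ℂ (convL D k f) g = inner ℂ f (convL D k g) := by
  rw [L2.inner_def, L2.inner_def]
  have hf : MemLp (fun x => conj (f x)) 2 (volOn D) := (Lp.memLp f).star
  have key := h.integral_convF_mul hD hf (Lp.memLp g)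
  simp only [heven] at key
  refine (integral_congr_ae ?_).trans (key.trans (integral_congr_ae ?_))
  · filter_upwards [convL_ae hD h f] with x hx
    rw [hx, RCLike.inner_apply, mul_comm]
    congr 1
    rw [convF, convF, ← integral_conj]
    congr 1; ext y
    rw [map_mul, hreal]
  · filter_upwards [convL_ae hD h g] with x hx
    rw [hx, RCLike.inner_apply, mul_comm]

end ConvolutionOperators

/-! ### Compactness of convolution operators -/

section Compactness

/-- The image of the unit ball under `ev` is bounded in finite dimension, so it has a finite
`ε/3`-net. Points with nearby `ev`-values have nearby images under `T`; the radius `2` allows for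
differences of points of the ball. -/
lemma isCompactOperator_of_approx {X Y : Type*} [NormedAddCommGroup X] [NormedSpace ℂ X]
    [NormedAddCommGroup Y] [NormedSpace ℂ Y] [CompleteSpace Y] (T : X →L[ℂ] Y)
    (h : ∀ ε > 0, ∃ (n : ℕ) (ev : X →L[ℂ] (Fin n → ℂ)), ∀ f, ‖f‖ ≤ 2 → ‖T f‖ ≤ ε + ‖ev f‖) :
    IsCompactOperator T := by
  have key : TotallyBounded (T '' Metric.closedBall 0 1) := by
    rw [Metric.totallyBounded_iff]
    intro ε hε
    obtain ⟨n, ev, hev⟩ := h (ε / 3) (by positivity)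
    have hb : TotallyBounded (ev '' Metric.closedBall 0 1) := by
      have h1 : Bornology.IsBounded (ev '' Metric.closedBall 0 1) :=
        ev.lipschitz.isBounded_image Metric.isBounded_closedBall
      exact (Metric.isCompact_of_isClosed_isBounded isClosed_closure h1.closure).totallyBounded.subset
        subset_closure
    obtain ⟨t, ht, htf, hcov⟩ := Metric.finite_approx_of_totallyBounded hb (ε / 3) (by positivity)
    have hpre : ∀ y ∈ t, ∃ x, ‖x‖ ≤ 1 ∧ ev x = y := fun y hy => by
      obtain ⟨x, hx, hxy⟩ := ht hy
      exact ⟨x, by simpa using hx, hxy⟩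
    choose! s hs1 hs2 using hpre
    refine ⟨(fun y => T (s y)) '' t, htf.image _, ?_⟩
    rintro _ ⟨x, hx, rfl⟩
    have hx1 : ‖x‖ ≤ 1 := by simpa using hx
    obtain ⟨y, hy, hxy⟩ := Set.mem_iUnion₂.1 (hcov ⟨x, hx, rfl⟩)
    refine Set.mem_iUnion₂.2 ⟨T (s y), ⟨y, hy, rfl⟩, ?_⟩
    rw [Metric.mem_ball, dist_eq_norm] at hxy ⊢
    rw [← hs2 y hy, ← map_sub] at hxy
    rw [← map_sub]
    have := hev (x - s y) ((norm_sub_le _ _).trans (by linarith [hs1 y hy]))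
    linarith
  have := (isCompactOperator_iff_isCompact_closure_image_closedBall (T : X →ₗ[ℂ] Y) zero_lt_one)
  exact this.2 (key.closure.isCompact_of_isClosed isClosed_closure)

variable {D : Set Plane} [IsFiniteMeasure (volOn D)]

/-- As in Arzelà–Ascoli: `g` is uniformly continuous, so the images of a bounded set are
equicontinuous, hence known up to a small error from their values on a finite net of the bounded set
`D`. -/
lemma isCompactOperator_convL_of_continuous (hD : MeasurableSet D) (hb : Bornology.IsBounded D)
    {g : Plane → ℂ} (hg : Continuous g) (hgc : HasCompactSupport g) :
    IsCompactOperator (convL D g) := by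
  obtain ⟨b, hgb⟩ := hg.bounded_above_of_compact_support hgc
  have hb0 : 0 ≤ b := (norm_nonneg _).trans (hgb 0)
  have hk := isKernel_of_bound hg.measurable hb0 hD fun x _ y _ => hgb (x - y)
  have huc : UniformContinuous g := hg.uniformContinuous_of_tendsto_cocompact (hgc.is_zero_at_infty)
  have hs0 : 0 ≤ sqrtArea D := sqrtArea_nonneg
  refine isCompactOperator_of_approx _ fun ε hε => ?_
  set a := sqrtArea D + 1 with ha
  have ha0 : 0 < a := by positivity
  obtain ⟨δ, hδ, hδg⟩ := Metric.uniformContinuous_iff.1 huc (ε / (2 * a ^ 2)) (by positivity)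
  have hDt : TotallyBounded D :=
    (Metric.isCompact_of_isClosed_isBounded isClosed_closure hb.closure).totallyBounded.subset
      subset_closure
  obtain ⟨t, htD, htf, hcov⟩ := Metric.finite_approx_of_totallyBounded hDt δ hδ
  obtain ⟨n, e, he⟩ := htf.fin_param
  have hyD : ∀ i, e i ∈ D := fun i => htD (he.2 ▸ Set.mem_range_self i)
  -- The weight `a` pays for the factor `sqrtArea D ≤ a` between the sup norm and the L² norm.
  set ev : L2 D →L[ℂ] (Fin n → ℂ) := ContinuousLinearMap.pi fun i =>
    (a : ℂ) • innerSL ℂ ((hk.memLp (hyD i)).star.toLp _) with hev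
  have hev' : ∀ f i, ev f i = a * convF D g f (e i) := by
    intro f i
    rw [hev, ContinuousLinearMap.pi_apply, smul_apply, innerSL_apply_apply, L2.inner_def, smul_eq_mul]
    congr 1
    refine integral_congr_ae ?_
    filter_upwards [(hk.memLp (hyD i)).star.coeFn_toLp] with x hx
    rw [hx, RCLike.inner_apply, Pi.star_apply, RCLike.star_def, RCLike.conj_conj, mul_comm]
  refine ⟨n, ev, fun f hf => ?_⟩
  have hpt : ∀ᵐ x ∂volOn D, ‖convL D g f x‖ ≤ (ε + ‖ev f‖) / a := by
    filter_upwards [ae_restrict_mem hD, convL_ae hD hk f] with x hx hx'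
    obtain ⟨y, hy, hxy⟩ := Set.mem_iUnion₂.1 (hcov hx)
    obtain ⟨i, rfl⟩ : ∃ i, e i = y := by
      have : y ∈ Set.range e := he.2 ▸ hy
      exact this
    have h1 : ‖convF D g f (e i)‖ ≤ ‖ev f‖ / a := by
      rw [le_div_iff₀ ha0]
      have := norm_le_pi_norm (ev f) i
      rw [hev', norm_mul, Complex.norm_real, Real.norm_of_nonneg ha0.le] at this
      linarith
    have h2 : ‖convF D g f x - convF D g f (e i)‖ ≤ ε / a := by
      have e1 : convF D g f x - convF D g f (e i)
          = ∫ z in D, (g (x - z) - g (e i - z)) * f z := by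
        rw [convF, convF, ← integral_sub (hk.integrable (Lp.memLp f) hx)
          (hk.integrable (Lp.memLp f) (hyD i))]
        congr 1; ext z; ring
      rw [e1]
      refine (norm_integral_mul_le ((hk.memLp hx).sub (hk.memLp (hyD i))) (Lp.memLp f)).trans ?_
      have h3 : (eLpNorm ((fun z => g (x - z)) - fun z => g (e i - z)) 2 (volOn D)).toReal
          ≤ sqrtArea D * (ε / (2 * a ^ 2)) := by
        have h4 := eLpNorm_le_of_ae_bound (p := 2) (μ := volOn D) (C := ε / (2 * a ^ 2))
          (f := (fun z => g (x - z)) - fun z => g (e i - z)) (Eventually.of_forall fun z => by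
            have := hδg (a := x - z) (b := e i - z) (by simpa [dist_eq_norm] using hxy)
            rw [dist_eq_norm] at this
            exact this.le)
        refine ENNReal.toReal_le_of_le_ofReal (by positivity) (h4.trans (le_of_eq ?_))
        rw [ENNReal.ofReal_mul sqrtArea_nonneg, sqrtArea, ENNReal.ofReal_toReal
          (ENNReal.rpow_ne_top_of_nonneg (by norm_num) (measure_ne_top _ _))]
        norm_num
      have hf' : (eLpNorm f 2 (volOn D)).toReal ≤ 2 := hf
      refine (mul_le_mul h3 hf' ENNReal.toReal_nonneg (by positivity)).trans ?_
      rw [show sqrtArea D * (ε / (2 * a ^ 2)) * 2 = sqrtArea D / a * (ε / a) by field_simp]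
      refine mul_le_of_le_one_left (by positivity) ?_
      rw [div_le_one ha0]; linarith
    rw [hx']
    have h5 := norm_le_norm_add_norm_sub' (convF D g f x) (convF D g f (e i))
    rw [add_div]
    linarith
  refine (norm_le_of_ae_bound (by positivity) hpt).trans ?_
  rw [mul_div_assoc', div_le_iff₀ ha0, mul_comm]
  exact mul_le_mul_of_nonneg_left (by linarith) (by positivity)

/-- Convolution operators with square integrable kernels are compact. -/
theorem isCompactOperator_convL (hD : MeasurableSet D) (hb : Bornology.IsBounded D)
    {k k' : Plane → ℂ} (hk : Measurable k) (hk' : Measurable k') (hk2 : MemLp k 2 volume)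
    (he : ∀ x ∈ D, ∀ y ∈ D, k' (x - y) = k (x - y)) : IsCompactOperator (convL D k') := by
  have hpos : ∀ n : ℕ, 0 < 1 / ((n : ℝ) + 1) := fun n => by positivity
  have h := fun n : ℕ => hk2.exists_hasCompactSupport_eLpNorm_sub_le (by simp)
    (ε := ENNReal.ofReal (1 / ((n : ℝ) + 1))) (by simpa using hpos n)
  choose g hgc hg hgcont hgm using h
  have hK : IsKernel D k' _ := IsKernel.of_eLpNorm hk hk' (M := (eLpNorm k 2 volume).toReal)
    ENNReal.toReal_nonneg (by rw [ENNReal.ofReal_toReal hk2.eLpNorm_ne_top]) he hD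
  -- The operator norm is at most `sqrtArea D` times the L² norm of the kernel, so L² approximation
  -- by continuous kernels is norm approximation of operators.
  refine isCompactOperator_of_tendsto (l := atTop) (F := fun n => convL D (g n)) ?_
    (Eventually.of_forall fun n => isCompactOperator_convL_of_continuous hD hb (hgcont n) (hgc n))
  rw [tendsto_iff_norm_sub_tendsto_zero]
  have hlim : Tendsto (fun n : ℕ => sqrtArea D * (1 / ((n : ℝ) + 1))) atTop (nhds 0) := by
    simpa using tendsto_one_div_add_atTop_nhds_zero_nat.const_mul (sqrtArea D)
  refine squeeze_zero (fun _ => norm_nonneg _) (fun n => ?_) hlim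
  have hgk : IsKernel D (g n) _ := IsKernel.of_eLpNorm (hgcont n).measurable (hgcont n).measurable
    (M := (eLpNorm (g n) 2 volume).toReal) ENNReal.toReal_nonneg
    (by rw [ENNReal.ofReal_toReal (hgm n).eLpNorm_ne_top]) (fun _ _ _ _ => rfl) hD
  rw [← norm_neg, neg_sub, ← convL_sub hD hK hgk]
  refine norm_convL_le hD (IsKernel.of_eLpNorm (k := fun x => k x - g n x)
    (hk.sub (hgcont n).measurable) (hk'.sub (hgcont n).measurable) (hpos n).le (hg n)
    (fun x hx y hy => by rw [he x hx y hy]) hD)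

end Compactness

/-! ### Bessel series and the expansion of the Green function -/

section Bessel

/-- On the ball of radius `R` the terms are dominated by `R^k / k!`, so the series is a locally
uniform limit of polynomials. -/
lemma differentiable_series {c : ℕ → ℂ} (hc : ∀ k, ‖c k‖ ≤ 1 / (k.factorial : ℝ)) :
    Differentiable ℂ fun z : ℂ => ∑' k, c k * (z / 4) ^ k := by
  have key : ∀ R : ℝ, 0 < R → DifferentiableOn ℂ (fun z : ℂ => ∑' k, c k * (z / 4) ^ k)
      (Metric.ball 0 R) := by
    intro R hR
    refine Complex.differentiableOn_tsum_of_summable_norm (u := fun k => R ^ k / k.factorial)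
      (Real.summable_pow_div_factorial R) (fun k => ?_) Metric.isOpen_ball fun k w hw => ?_
    · exact (((differentiable_id.div_const 4).pow k).const_mul (c k)).differentiableOn
    · rw [norm_mul, norm_pow, norm_div]
      have h1 : ‖w‖ / ‖(4 : ℂ)‖ ≤ R := by
        have : ‖(4 : ℂ)‖ = 4 := by norm_num
        rw [this]
        have := mem_ball_zero_iff.1 hw
        linarith [norm_nonneg w]
      calc ‖c k‖ * (‖w‖ / ‖(4 : ℂ)‖) ^ k ≤ 1 / (k.factorial : ℝ) * R ^ k :=
            mul_le_mul (hc k) (pow_le_pow_left₀ (by positivity) h1 k) (by positivity) (by positivity)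
        _ = R ^ k / k.factorial := by ring
  intro z
  have hz : z ∈ Metric.ball (0 : ℂ) (‖z‖ + 1) := by simp
  exact (key (‖z‖ + 1) (by positivity) z hz).differentiableAt (Metric.isOpen_ball.mem_nhds hz)

/-- `J₀(w) = jser (w²)`. -/
def jser (z : ℂ) : ℂ := ∑' k : ℕ, (-1) ^ k / ((k.factorial : ℂ) ^ 2) * (z / 4) ^ k

/-- The entire part of `Y₀`, as a function of the square. -/
def hser (z : ℂ) : ℂ :=
  ∑' k : ℕ, (-1) ^ k * ((harmonic k : ℚ) : ℂ) / ((k.factorial : ℂ) ^ 2) * (z / 4) ^ k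

lemma one_le_factorial (k : ℕ) : (1 : ℝ) ≤ k.factorial := by
  exact_mod_cast Nat.succ_le_of_lt k.factorial_pos

lemma differentiable_jser : Differentiable ℂ jser := by
  refine differentiable_series fun k => ?_
  rw [norm_div, norm_pow, norm_pow, norm_neg, norm_one, one_pow, Complex.norm_natCast]
  have := one_le_factorial k
  exact one_div_le_one_div_of_le (by positivity) (by nlinarith)

lemma harmonic_le (k : ℕ) : harmonic k ≤ k := by
  induction k with
  | zero => simp
  | succ n ih =>
    rw [harmonic_succ]
    push_cast
    have : ((n : ℚ) + 1)⁻¹ ≤ 1 := inv_le_one_of_one_le₀ (by linarith [Nat.cast_nonneg (α := ℚ) n])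
    linarith

lemma harmonic_nonneg (k : ℕ) : 0 ≤ harmonic k := by
  unfold harmonic
  exact Finset.sum_nonneg fun i _ => by positivity

lemma differentiable_hser : Differentiable ℂ hser := by
  refine differentiable_series fun k => ?_
  rw [norm_div, norm_mul, norm_pow, norm_pow, norm_neg, norm_one, one_pow, one_mul,
    Complex.norm_natCast]
  have h1 := one_le_factorial k
  have h2 : ‖((harmonic k : ℚ) : ℂ)‖ ≤ k.factorial := by
    have e : ((harmonic k : ℚ) : ℂ) = (((harmonic k : ℚ) : ℝ) : ℂ) := by push_cast; rfl
    rw [e, Complex.norm_real, Real.norm_of_nonneg (by exact_mod_cast harmonic_nonneg k)]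
    have h3 : ((harmonic k : ℚ) : ℝ) ≤ k := by exact_mod_cast harmonic_le k
    have h4 : (k : ℝ) ≤ k.factorial := by exact_mod_cast Nat.self_le_factorial k
    linarith
  rw [div_le_div_iff₀ (by positivity) (by positivity)]
  nlinarith

lemma jser_zero : jser 0 = 1 := by
  unfold jser
  rw [tsum_eq_single 0 (fun k hk => by simp [hk])]
  simp

lemma hser_zero : hser 0 = 0 := by
  unfold hser
  rw [tsum_eq_single 0 (fun k hk => by simp [hk])]
  simp

lemma besselJ0_eq (w : ℂ) : besselJ0 w = jser (w ^ 2) := by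
  unfold besselJ0 jser
  congr 1; ext k
  rw [pow_mul, div_pow]
  norm_num

lemma besselY0_eq (w : ℂ) : besselY0 w = (2 / (Real.pi : ℂ)) *
    ((Complex.log (w / 2) + (Real.eulerMascheroniConstant : ℂ)) * jser (w ^ 2) - hser (w ^ 2)) := by
  unfold besselY0 hser
  rw [besselJ0_eq]
  congr 3; ext k
  rw [pow_mul, div_pow]
  norm_num

lemma C2Bound.add {A B : ℝ → ℂ} {T M M' : ℝ} (hA : C2Bound A T M) (hB : C2Bound B T M') :
    C2Bound (fun t => A t + B t) T (M + M') := by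
  have hd : ∀ {F : ℝ → ℂ}, ContDiff ℝ (⊤ : ℕ∞) F → ContDiff ℝ (⊤ : ℕ∞) (deriv F) := fun hF =>
    hF.iterate_deriv 1
  have hdf : ∀ {F : ℝ → ℂ}, ContDiff ℝ (⊤ : ℕ∞) F → ∀ t, HasDerivAt F (deriv F t) t := fun hF t =>
    (hF.differentiable (by simp) t).hasDerivAt
  have e1 : deriv (fun t => A t + B t) = fun t => deriv A t + deriv B t := by
    ext t; exact ((hdf hA.smooth t).fun_add (hdf hB.smooth t)).deriv
  have e2 : deriv (deriv (fun t => A t + B t)) = fun t => deriv (deriv A) t + deriv (deriv B) t := by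
    rw [e1]
    ext t; exact ((hdf (hd hA.smooth) t).fun_add (hdf (hd hB.smooth) t)).deriv
  refine ⟨hA.smooth.add hB.smooth, fun t ht => ?_, fun t ht => ?_, fun t ht => ?_⟩
  · exact (norm_add_le _ _).trans (add_le_add (hA.b0 t ht) (hB.b0 t ht))
  · rw [e1]; exact (norm_add_le _ _).trans (add_le_add (hA.b1 t ht) (hB.b1 t ht))
  · rw [e2]; exact (norm_add_le _ _).trans (add_le_add (hA.b2 t ht) (hB.b2 t ht))

lemma C2Bound.const_mul {A : ℝ → ℂ} {T M : ℝ} (hA : C2Bound A T M) (c : ℂ) :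
    C2Bound (fun t => c * A t) T (‖c‖ * M) := by
  have e1 : deriv (fun t => c * A t) = fun t => c * deriv A t := by
    ext t; exact deriv_const_mul_field c
  have e2 : deriv (deriv (fun t => c * A t)) = fun t => c * deriv (deriv A) t := by
    rw [e1]
    ext t; exact deriv_const_mul_field c
  refine ⟨contDiff_const.mul hA.smooth, fun t ht => ?_, fun t ht => ?_, fun t ht => ?_⟩
  · rw [norm_mul]; exact mul_le_mul_of_nonneg_left (hA.b0 t ht) (norm_nonneg _)
  · rw [e1, norm_mul]; exact mul_le_mul_of_nonneg_left (hA.b1 t ht) (norm_nonneg _)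
  · rw [e2, norm_mul]; exact mul_le_mul_of_nonneg_left (hA.b2 t ht) (norm_nonneg _)

lemma C2Bound.mono {A : ℝ → ℂ} {T M M' : ℝ} (hA : C2Bound A T M) (h : M ≤ M') : C2Bound A T M' :=
  ⟨hA.smooth, fun t ht => (hA.b0 t ht).trans h, fun t ht => (hA.b1 t ht).trans h,
    fun t ht => (hA.b2 t ht).trans h⟩

lemma c2Bound_zero {T : ℝ} : C2Bound (fun _ => 0) T 0 := by
  refine ⟨contDiff_const, ?_, ?_, ?_⟩ <;> simp

/-- Dilations of an entire function depend in a Lipschitz way on the dilation. -/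
lemma exists_c2Bound_dilation {F : ℂ → ℂ} (hF : Differentiable ℂ F) {T : ℝ} (hT : 0 ≤ T) :
    ∃ c > 0, ∀ z z' : ℂ, ‖z‖ ≤ 1 → ‖z'‖ ≤ 1 →
      C2Bound (fun t : ℝ => F (z * t) - F (z' * t)) T (c * ‖z - z'‖) := by
  have hd : ∀ {F : ℂ → ℂ}, Differentiable ℂ F → Differentiable ℂ (deriv F) := fun hF => by
    have h2 := (hF.contDiff (n := 2)).iterate_deriv' 1 1
    exact h2.differentiable (by simp)
  have hb : ∀ {F : ℂ → ℂ}, Differentiable ℂ F →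
      ∃ c, 0 ≤ c ∧ ∀ w ∈ Metric.closedBall (0 : ℂ) T, ‖F w‖ ≤ c := fun hF => by
    obtain ⟨c, hc⟩ :=
      (isCompact_closedBall (0 : ℂ) T).exists_bound_of_continuousOn hF.continuous.continuousOn
    exact ⟨c, (norm_nonneg _).trans (hc 0 (by simpa using hT)), hc⟩
  -- The `m`-th derivative in `t` of `F (z t)` is `z^m` times that of `F` at `z t`; Lipschitz
  -- dependence on `z` follows from the mean value inequality over the unit disc.
  have hlip : ∀ (m : ℕ) {F : ℂ → ℂ}, Differentiable ℂ F → ∃ c, 0 ≤ c ∧ ∀ t ∈ Set.Icc (0 : ℝ) T,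
      ∀ z z' : ℂ, ‖z‖ ≤ 1 → ‖z'‖ ≤ 1 →
        ‖z ^ m * F (z * t) - z' ^ m * F (z' * t)‖ ≤ c * ‖z - z'‖ := by
    intro m F hF
    obtain ⟨c0, hc0, h0⟩ := hb hF
    obtain ⟨c1, hc1, h1⟩ := hb (hd hF)
    refine ⟨m * c0 + T * c1, by positivity, fun t ht z z' hz hz' => ?_⟩
    have hder : ∀ w : ℂ, HasDerivAt (fun w : ℂ => w ^ m * F (w * t))
        (m * w ^ (m - 1) * F (w * t) + w ^ m * (deriv F (w * t) * t)) w := fun w => by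
      have h2 : HasDerivAt (fun w : ℂ => F (w * t)) (deriv F (w * t) * t) w := by
        have := (hF (w * t)).hasDerivAt.comp w ((hasDerivAt_id w).mul_const (t : ℂ))
        simpa using! this
      exact (hasDerivAt_pow m w).mul h2
    refine (convex_closedBall (0 : ℂ) 1).norm_image_sub_le_of_norm_hasDerivWithin_le
      (f := fun w : ℂ => w ^ m * F (w * t)) (fun w _ => (hder w).hasDerivWithinAt) (fun w hw => ?_)
      (by simpa using hz') (by simpa using hz)
    have hw1 : ‖w‖ ≤ 1 := by simpa using hw
    have ht' : ‖(t : ℂ)‖ ≤ T := by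
      rw [Complex.norm_real, Real.norm_of_nonneg ht.1]; exact ht.2
    have hwt : w * t ∈ Metric.closedBall (0 : ℂ) T := by
      rw [mem_closedBall_zero_iff, norm_mul]
      nlinarith [norm_nonneg w, norm_nonneg (t : ℂ)]
    refine (norm_add_le _ _).trans (add_le_add ?_ ?_)
    · rw [norm_mul, norm_mul, Complex.norm_natCast, norm_pow]
      refine mul_le_mul ?_ (h0 _ hwt) (norm_nonneg _) (by positivity)
      exact mul_le_of_le_one_right (by positivity) (pow_le_one₀ (norm_nonneg _) hw1)
    · rw [norm_mul, norm_mul, norm_pow, mul_comm T]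
      calc ‖w‖ ^ m * (‖deriv F (w * t)‖ * ‖(t : ℂ)‖) ≤ 1 * (c1 * T) :=
            mul_le_mul (pow_le_one₀ (norm_nonneg _) hw1)
              (mul_le_mul (h1 _ hwt) ht' (norm_nonneg _) hc1) (by positivity) zero_le_one
        _ = c1 * T := one_mul _
  obtain ⟨c0, hc0, h0⟩ := hlip 0 hF
  obtain ⟨c1, hc1, h1⟩ := hlip 1 (hd hF)
  obtain ⟨c2, hc2, h2⟩ := hlip 2 (hd (hd hF))
  refine ⟨c0 + c1 + c2 + 1, by positivity, fun z z' hz hz' => ?_⟩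
  have hder : ∀ {F : ℂ → ℂ}, Differentiable ℂ F → ∀ (z : ℂ) (t : ℝ),
      HasDerivAt (fun t : ℝ => F (z * t)) (z * deriv F (z * t)) t := fun {F} hF z t => by
    have h3 : HasDerivAt (fun t : ℝ => z * (t : ℂ)) z t := by
      simpa using (Complex.ofRealCLM.hasDerivAt (x := t)).const_mul z
    have := (hF (z * t)).hasDerivAt.comp t h3
    rw [mul_comm] at this
    exact this
  have hsm : ∀ z : ℂ, ContDiff ℝ (⊤ : ℕ∞) (fun t : ℝ => F (z * t)) := fun z => by
    have h4 : ContDiff ℝ (⊤ : ℕ∞) F := (hF.contDiff (n := (⊤ : ℕ∞))).restrict_scalars ℝ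
    exact h4.comp (contDiff_const.mul Complex.ofRealCLM.contDiff)
  have e1 : deriv (fun t : ℝ => F (z * t) - F (z' * t))
      = fun t : ℝ => z * deriv F (z * t) - z' * deriv F (z' * t) := by
    ext t; exact ((hder hF z t).fun_sub (hder hF z' t)).deriv
  have e2 : deriv (deriv (fun t : ℝ => F (z * t) - F (z' * t)))
      = fun t : ℝ => z ^ 2 * deriv (deriv F) (z * t) - z' ^ 2 * deriv (deriv F) (z' * t) := by
    rw [e1]; ext t
    rw [(((hder (hd hF) z t).const_mul z).fun_sub ((hder (hd hF) z' t).const_mul z')).deriv]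
    ring
  have hn := norm_nonneg (z - z')
  have m0 := mul_nonneg hc0 hn
  have m1 := mul_nonneg hc1 hn
  have m2 := mul_nonneg hc2 hn
  refine ⟨(hsm z).sub (hsm z'), fun t ht => ?_, fun t ht => ?_, fun t ht => ?_⟩
  · have := h0 t ht z z' hz hz'
    simp only [pow_zero, one_mul] at this
    nlinarith
  · have := h1 t ht z z' hz hz'
    simp only [pow_one] at this
    rw [e1]
    nlinarith
  · have := h2 t ht z z' hz hz'
    rw [e2]
    nlinarith

/-- The constant in the expansion of the Green function at low frequencies. -/
def greenConst (ω : ℂ) : ℂ :=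
  Complex.I / 4 - 1 / (2 * Real.pi) * (Complex.log (ω / 2) + Real.eulerMascheroniConstant)

/-- The logarithmic part of the remainder in the expansion of the Green function. -/
def remA (z : ℂ) (t : ℝ) : ℂ := -(1 / (4 * Real.pi)) * (jser (z * t) - jser (0 * t))

/-- The regular part of the remainder in the expansion of the Green function. -/
def remB (κ z : ℂ) (t : ℝ) : ℂ :=
  κ * (jser (z * t) - jser (0 * t)) + 1 / (2 * Real.pi) * (hser (z * t) - hser (0 * t))

/-- The kernel of the Newtonian potential. -/
def newtonKernel (x : Plane) : ℂ := ((-(1 / (2 * Real.pi)) * Real.log ‖x‖ : ℝ) : ℂ)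

lemma newtonKernel_eq (x : Plane) :
    newtonKernel x = rk (fun _ => -(1 / (4 * Real.pi))) (fun _ => 0) x := by
  simp only [newtonKernel, rk, Real.log_pow]
  push_cast
  ring

/-- The low frequency expansion of the Green function. -/
lemma green_eq {ω : ℂ} (hω : ω ≠ 0) {x : Plane} (hx : x ≠ 0) :
    green ω x = greenConst ω + newtonKernel x
      + rk (remA (ω ^ 2)) (remB (greenConst ω) (ω ^ 2)) x := by
  have hr : 0 < ‖x‖ := norm_pos_iff.2 hx
  -- A positive real factor does not change the argument, so the principal logarithm splits without
  -- branch correction.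
  have hlog : Complex.log (ω * (‖x‖ : ℂ) / 2) = Complex.log (ω / 2) + (Real.log ‖x‖ : ℝ) := by
    rw [show ω * (‖x‖ : ℂ) / 2 = (ω / 2) * (‖x‖ : ℝ) by ring,
      Complex.log_mul_ofReal _ hr _ (div_ne_zero hω two_ne_zero), Complex.ofReal_log hr.le]
    ring
  have hπ : (Real.pi : ℂ) ≠ 0 := by exact_mod_cast Real.pi_ne_zero
  rw [green, hankelH0, besselJ0_eq, besselY0_eq, hlog, mul_pow]
  simp only [rk, remA, remB, newtonKernel, greenConst, Real.log_pow, zero_mul, jser_zero, hser_zero]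
  push_cast
  field_simp
  ring_nf
  simp only [Complex.I_sq]
  ring

end Bessel

/-! ### Kernels mapping L² into H² -/

section H2Kernels

/-- Kernels whose convolution operators over `D` are bounded by `M` from `L²` to `L^∞`, and whose
first two weak derivatives are bounded by `M` on `L²`. -/
structure IsH2Kernel (D : Set Plane) (k : Plane → ℂ) (M : ℝ) : Prop extends IsKernel D k M where
  grad : ∀ f, MemLp f 2 (volOn D) → ∀ φ ∈ testSpace D, ∀ i,
    ‖∫ x in D, convF D k f x * pd i φ x‖
      ≤ M * (eLpNorm f 2 (volOn D)).toReal * (eLpNorm φ 2 (volOn D)).toReal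
  hess : ∀ f, MemLp f 2 (volOn D) → ∀ φ ∈ testSpace D, ∀ i j,
    ‖∫ x in D, convF D k f x * pd i (pd j φ) x‖
      ≤ M * (eLpNorm f 2 (volOn D)).toReal * (eLpNorm φ 2 (volOn D)).toReal

variable {D : Set Plane} {k k' : Plane → ℂ} {M M' : ℝ}

lemma IsH2Kernel.mono (h : IsH2Kernel D k M) (hM : M ≤ M') : IsH2Kernel D k M' where
  toIsKernel := h.toIsKernel.mono hM
  grad f hf φ hφ i := (h.grad f hf φ hφ i).trans (by gcongr)
  hess f hf φ hφ i j := (h.hess f hf φ hφ i j).trans (by gcongr)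

lemma testSpace_memLp {φ : Plane → ℂ} (hφ : φ ∈ testSpace D) : MemLp φ 2 (volOn D) :=
  (hφ.1.memLp 2).restrict D

lemma rk_neg (A B : ℝ → ℂ) (x : Plane) : rk A B (-x) = rk A B x := by
  simp only [rk, norm_neg]

/-- Fubini and evenness put the convolution on the test function. As that vanishes off `D` and `k =
k'` on `D - D`, the result is a convolution over the plane, to which the L² bounds on derivatives
apply. -/
lemma integral_convF_mul_test [IsFiniteMeasure (volOn D)] (hD : MeasurableSet D)
    (hk : IsKernel D k M) (heven : ∀ x, k (-x) = k x) (he : ∀ x ∈ D, ∀ y ∈ D, k (x - y) = k' (x - y))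
    {f ψ : Plane → ℂ} (hf : MemLp f 2 (volOn D)) (hψ : ψ ∈ testSpace D) :
    ∫ x in D, convF D k f x * ψ x = ∫ y in D, f y * cv k' ψ y := by
  rw [hk.integral_convF_mul hD hf (testSpace_memLp hψ)]
  refine integral_congr_ae ?_
  filter_upwards [ae_restrict_mem hD] with y hy
  congr 1
  simp only [heven]
  have hcv : cv k' ψ y = ∫ t, k' (y - t) * ψ t := by
    rw [cv, convolution_eq_swap]; rfl
  rw [hcv, convF]
  have hz : ∀ x, x ∉ D → k' (y - x) * ψ x = 0 := fun x hx => by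
    have : ψ x = 0 := by
      by_contra h
      exact hx (hψ.2 (subset_tsupport _ h))
    rw [this, mul_zero]
  rw [← setIntegral_eq_integral_of_forall_compl_eq_zero hz]
  refine setIntegral_congr_fun hD fun x hx => ?_
  rw [he y hy x hx]

/-- Radial kernels are bounded in terms of the `C²` bounds of their profiles. -/
theorem exists_isH2Kernel [IsFiniteMeasure (volOn D)] (hD : MeasurableSet D)
    (hb : Bornology.IsBounded D) : ∃ T, 0 ≤ T ∧ (∃ c > 0, ∀ (A B : ℝ → ℂ) (M : ℝ),
      C2Bound A T M → C2Bound B T M → IsH2Kernel D (rk A B) (c * M)) ∧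
      ∀ (A B : ℝ → ℂ) (M : ℝ), C2Bound A T M → C2Bound B T M →
        IsCompactOperator (convL D (rk A B)) := by
  obtain ⟨R, hR⟩ := hb.subset_closedBall 0
  have hT : (0 : ℝ) ≤ (2 * R) ^ 2 := by positivity
  obtain ⟨c, hc, h⟩ := exists_radial_bound hT
  have hdist : ∀ x ∈ D, ∀ y ∈ D, ‖x - y‖ ^ 2 ≤ (2 * R) ^ 2 := fun x hx y hy => by
    have h1 : ‖x‖ ≤ R := by simpa using hR hx
    have h2 : ‖y‖ ≤ R := by simpa using hR hy
    exact pow_le_pow_left₀ (norm_nonneg _) ((norm_sub_le _ _).trans (by linarith)) 2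
  -- Differences of points of `D` have norm at most `2 R`; the extra `1` is the transition zone of
  -- the cutoff.
  refine ⟨(2 * R) ^ 2 + 1, by positivity, ⟨c, hc, fun A B M hA hB => ?_⟩, fun A B M hA hB => ?_⟩
  · obtain ⟨k, hkm, hk, hk2, hk3⟩ := h A B M hA hB
    have hM : 0 ≤ M := hA.nonneg (by positivity)
    have he : ∀ x ∈ D, ∀ y ∈ D, rk A B (x - y) = k (x - y) := fun x hx y hy =>
      (hk _ (hdist x hx y hy)).symm
    have hK : IsKernel D (rk A B) (c * M) :=
      IsKernel.of_eLpNorm hkm (measurable_rk hA.smooth hB.smooth) (by positivity) hk2 he hD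
    have key : ∀ f, MemLp f 2 (volOn D) → ∀ φ ∈ testSpace D, ∀ ψ ∈ testSpace D,
        eLpNorm (cv k ψ) 2 volume ≤ ENNReal.ofReal (c * M) * eLpNorm φ 2 volume →
        ‖∫ x in D, convF D (rk A B) f x * ψ x‖
          ≤ c * M * (eLpNorm f 2 (volOn D)).toReal * (eLpNorm φ 2 (volOn D)).toReal := by
      intro f hf φ hφ ψ hψ hle
      rw [integral_convF_mul_test hD hK (rk_neg A B) he hf hψ]
      have hφ2 := eLpNorm_volOn_of_tsupport hφ.2 2
      have hcv : AEStronglyMeasurable (cv k ψ) volume := by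
        have hkl : MemLp k 2 volume := ⟨hkm.aestronglyMeasurable, hk2.trans_lt ENNReal.ofReal_lt_top⟩
        exact (hψ.1.compact.continuous_convolution_right _ (hkl.locallyIntegrable one_le_two)
          hψ.1.continuous).aestronglyMeasurable
      have hle' : eLpNorm (cv k ψ) 2 (volOn D)
          ≤ ENNReal.ofReal (c * M) * eLpNorm φ 2 (volOn D) := by
        rw [hφ2]
        exact (eLpNorm_mono_measure _ Measure.restrict_le_self).trans hle
      have hfin : ENNReal.ofReal (c * M) * eLpNorm φ 2 (volOn D) ≠ ⊤ :=
        ENNReal.mul_ne_top ENNReal.ofReal_ne_top (testSpace_memLp hφ).eLpNorm_ne_top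
      have hcvm : MemLp (cv k ψ) 2 (volOn D) := ⟨hcv.restrict, hle'.trans_lt hfin.lt_top⟩
      refine (norm_integral_mul_le hf hcvm).trans ?_
      have := ENNReal.toReal_mono hfin hle'
      rw [ENNReal.toReal_mul, ENNReal.toReal_ofReal (by positivity)] at this
      calc _ ≤ (eLpNorm f 2 (volOn D)).toReal * (c * M * (eLpNorm φ 2 (volOn D)).toReal) :=
            mul_le_mul_of_nonneg_left this ENNReal.toReal_nonneg
        _ = _ := by ring
    exact ⟨hK, fun f hf φ hφ i => key f hf φ hφ _ (testSpace_pd hφ i) (hk3 φ hφ.1 i i).1,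
      fun f hf φ hφ i j => key f hf φ hφ _ (testSpace_pd (testSpace_pd hφ j) i) (hk3 φ hφ.1 i j).2⟩
  · obtain ⟨k, hkm, hk, hk2, -⟩ := h A B M hA hB
    exact isCompactOperator_convL hD hb hkm (measurable_rk hA.smooth hB.smooth)
      ⟨hkm.aestronglyMeasurable, hk2.trans_lt ENNReal.ofReal_lt_top⟩
      fun x hx y hy => (hk _ (hdist x hx y hy)).symm

end H2Kernels

/-! ### Dependence of the Green function on the frequency -/

section LowFrequency

lemma re_one_add_pos {s : ℂ} (hs : ‖s‖ ≤ 1 / 4) : 0 < (1 + s).re := by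
  have := (abs_le.1 ((Complex.abs_re_le_norm s).trans hs)).1
  simp only [Complex.add_re, Complex.one_re]; linarith

lemma one_add_ne_zero {s : ℂ} (hs : ‖s‖ ≤ 1 / 4) : 1 + s ≠ 0 := fun h => by
  have := re_one_add_pos hs
  rw [h] at this; simp at this

lemma norm_log_sub_le {s t : ℂ} (hs : ‖s‖ ≤ 1 / 4) (ht : ‖t‖ ≤ 1 / 4) :
    ‖Complex.log (1 + s) - Complex.log (1 + t)‖ ≤ 2 * ‖s - t‖ := by
  refine (convex_closedBall (0 : ℂ) (1 / 4)).norm_image_sub_le_of_norm_hasDerivWithin_le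
    (f := fun w : ℂ => Complex.log (1 + w)) (f' := fun w => 1 / (1 + w)) (fun w hw => ?_)
    (fun w hw => ?_) (by simpa using ht) (by simpa using hs)
  · have hw' : ‖w‖ ≤ 1 / 4 := by simpa using hw
    exact (((hasDerivAt_id w).const_add 1).clog
      (Or.inl (by simpa using re_one_add_pos hw'))).hasDerivWithinAt
  · have hw' : ‖w‖ ≤ 1 / 4 := by simpa using hw
    rw [norm_div, norm_one, div_le_iff₀ (norm_pos_iff.2 (one_add_ne_zero hw'))]
    have h1 : 1 - ‖w‖ ≤ ‖1 + w‖ := by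
      have := norm_sub_norm_le (1 : ℂ) (-w)
      rw [norm_neg, norm_one, sub_neg_eq_add] at this
      exact this
    linarith

lemma norm_log_le {s : ℂ} (hs : ‖s‖ ≤ 1 / 4) : ‖Complex.log (1 + s)‖ ≤ 1 / 2 := by
  have := norm_log_sub_le hs (t := 0) (by simp)
  simp only [add_zero, Complex.log_one, sub_zero] at this
  linarith

/-- Both `ω / 2` and `1 + s` lie in the right half plane, so their arguments add up to less than `π`
in modulus and the principal logarithm is additive. -/
lemma greenConst_mul {ω s : ℂ} (hω : 0 < ω.re) (hs : ‖s‖ ≤ 1 / 4) :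
    greenConst (ω * (1 + s)) = greenConst ω - 1 / (2 * Real.pi) * Complex.log (1 + s) := by
  have h0 : ω / 2 ≠ 0 := div_ne_zero (fun h => by simp [h] at hω) two_ne_zero
  have h2 : 0 < (ω / 2).re := by
    rw [show ω / 2 = ω / ((2 : ℝ) : ℂ) by norm_num, Complex.div_ofReal_re]; linarith
  have a1 := Complex.abs_arg_lt_pi_div_two_iff.2 (Or.inl h2)
  have a2 := Complex.abs_arg_lt_pi_div_two_iff.2 (Or.inl (re_one_add_pos hs))
  rw [abs_lt] at a1 a2
  have : Complex.log (ω * (1 + s) / 2) = Complex.log (ω / 2) + Complex.log (1 + s) := by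
    rw [show ω * (1 + s) / 2 = (ω / 2) * (1 + s) by ring]
    exact Complex.log_mul h0 (one_add_ne_zero hs) ⟨by linarith, by linarith⟩
  rw [greenConst, greenConst, this]
  ring

/-- The size of the remainder in the low frequency expansion. -/
def remSize (ω : ℂ) : ℝ := ‖ω‖ ^ 2 * (1 + ‖greenConst ω‖)

lemma remSize_nonneg (ω : ℂ) : 0 ≤ remSize ω := by unfold remSize; positivity

/-- The remainder in the low frequency expansion. -/
def remKernel (ω : ℂ) : Plane → ℂ := rk (remA (ω ^ 2)) (remB (greenConst ω) (ω ^ 2))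

/-- The profiles are entire functions dilated by `(ω (1 + s))²`, minus their values at dilation `0`;
they are therefore `O(|ω|²)`, up to a factor `greenConst`. Changing `s` to `t` moves the dilation by
`O(|ω|² |s - t|)` and `greenConst` by `O(|s - t|)`. -/
lemma exists_rem_c2Bound {T : ℝ} (hT : 0 ≤ T) : ∃ c > 0, ∀ ω : ℂ, 0 < ω.re → ‖ω‖ ≤ 1 / 2 →
    ∀ s t : ℂ, ‖s‖ ≤ 1 / 4 → ‖t‖ ≤ 1 / 4 →
      (C2Bound (remA ((ω * (1 + s)) ^ 2)) T (c * remSize ω) ∧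
        C2Bound (remB (greenConst (ω * (1 + s))) ((ω * (1 + s)) ^ 2)) T (c * remSize ω)) ∧
      C2Bound (fun r => remA ((ω * (1 + s)) ^ 2) r - remA ((ω * (1 + t)) ^ 2) r) T
        (c * remSize ω * ‖s - t‖) ∧
      C2Bound (fun r => remB (greenConst (ω * (1 + s))) ((ω * (1 + s)) ^ 2) r
        - remB (greenConst (ω * (1 + t))) ((ω * (1 + t)) ^ 2) r) T (c * remSize ω * ‖s - t‖) := by
  obtain ⟨c₁, hc₁, hj⟩ := exists_c2Bound_dilation differentiable_jser hT
  obtain ⟨c₂, hc₂, hh⟩ := exists_c2Bound_dilation differentiable_hser hT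
  have hπ4 : ‖-(1 / (4 * (Real.pi : ℂ)))‖ ≤ 1 := by
    rw [norm_neg, norm_div, norm_mul, Complex.norm_real, Real.norm_of_nonneg Real.pi_pos.le, norm_one,
      show ‖(4 : ℂ)‖ = 4 by norm_num, div_le_one (by positivity)]
    linarith [Real.pi_gt_three]
  have hπ2 : ‖1 / (2 * (Real.pi : ℂ))‖ ≤ 1 := by
    rw [norm_div, norm_mul, Complex.norm_real, Real.norm_of_nonneg Real.pi_pos.le, norm_one,
      Complex.norm_two, div_le_one (by positivity)]
    linarith [Real.pi_gt_three]
  refine ⟨20 * (c₁ + c₂), by positivity, fun ω hω hω1 s t hs ht => ?_⟩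
  set κ := ‖greenConst ω‖ with hκ
  have hκ0 : 0 ≤ κ := norm_nonneg _
  set a := ‖ω‖ ^ 2 with ha
  have ha0 : 0 ≤ a := by positivity
  have ha1 : a ≤ 1 / 4 := by
    rw [ha]; nlinarith [norm_nonneg ω]
  have hz : ∀ {s : ℂ}, ‖s‖ ≤ 1 / 4 → ‖(ω * (1 + s)) ^ 2‖ ≤ 2 * a := fun hs => by
    rw [mul_pow, norm_mul, norm_pow ω, mul_comm]
    exact mul_le_mul_of_nonneg_right (BifModel.norm_one_add_sq_le hs) ha0
  have hz1 : ∀ {s : ℂ}, ‖s‖ ≤ 1 / 4 → ‖(ω * (1 + s)) ^ 2‖ ≤ 1 := fun hs => (hz hs).trans (by linarith)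
  have hzd : ‖(ω * (1 + s)) ^ 2 - (ω * (1 + t)) ^ 2‖ ≤ 3 * a * ‖s - t‖ := by
    rw [show (ω * (1 + s)) ^ 2 - (ω * (1 + t)) ^ 2 = ω ^ 2 * (2 + s + t) * (s - t) by ring,
      norm_mul, norm_mul, norm_pow]
    have : ‖2 + s + t‖ ≤ 3 := norm_add₃_le.trans (by rw [Complex.norm_two]; linarith)
    nlinarith [norm_nonneg (s - t), mul_nonneg ha0 (norm_nonneg (s - t))]
  have hκs : ∀ {s : ℂ}, ‖s‖ ≤ 1 / 4 → ‖greenConst (ω * (1 + s))‖ ≤ κ + 1 := fun hs => by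
    rw [greenConst_mul hω hs]
    refine (norm_sub_le _ _).trans (add_le_add_right ?_ _)
    rw [norm_mul]
    nlinarith [norm_log_le hs, norm_nonneg (1 / (2 * (Real.pi : ℂ)))]
  have hκd : ‖greenConst (ω * (1 + s)) - greenConst (ω * (1 + t))‖ ≤ 2 * ‖s - t‖ := by
    rw [greenConst_mul hω hs, greenConst_mul hω ht, sub_sub_sub_cancel_left, ← mul_sub, norm_mul,
      norm_sub_rev]
    have := norm_log_sub_le hs ht
    nlinarith [norm_nonneg (1 / (2 * (Real.pi : ℂ))), norm_nonneg (Complex.log (1 + s) - Complex.log (1 + t))]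
  have h0 : ‖(0 : ℂ)‖ ≤ 1 := by simp
  have hn := norm_nonneg (s - t)
  have js := hj _ 0 (hz1 hs) h0
  have hs' := hh _ 0 (hz1 hs) h0
  rw [sub_zero] at js hs'
  have jd := hj _ _ (hz1 hs) (hz1 ht)
  have hd := hh _ _ (hz1 hs) (hz1 ht)
  have hsize : remSize ω = a * (1 + κ) := rfl
  rw [hsize]
  have n1 := norm_nonneg (greenConst (ω * (1 + s)))
  have n2 := norm_nonneg ((ω * (1 + s)) ^ 2)
  refine ⟨⟨(js.const_mul _).mono ?_, ((js.const_mul _).add (hs'.const_mul _)).mono ?_⟩, ?_, ?_⟩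
  · calc _ ≤ 1 * (c₁ * (2 * a)) := mul_le_mul hπ4
          (mul_le_mul_of_nonneg_left (hz hs) hc₁.le) (by positivity) zero_le_one
      _ ≤ _ := by
        have : 0 ≤ (18 * c₁ * a + 20 * c₂ * a + 20 * (c₁ + c₂) * (a * κ)) := by positivity
        linarith
  · calc _ ≤ (κ + 1) * (c₁ * (2 * a)) + 1 * (c₂ * (2 * a)) := add_le_add
          (mul_le_mul (hκs hs) (mul_le_mul_of_nonneg_left (hz hs) hc₁.le) (by positivity) (by positivity))
          (mul_le_mul hπ2 (mul_le_mul_of_nonneg_left (hz hs) hc₂.le) (by positivity) zero_le_one)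
      _ ≤ _ := by
        have : 0 ≤ 18 * c₁ * a + 18 * c₂ * a + 18 * c₁ * (a * κ) + 20 * c₂ * (a * κ) := by positivity
        linarith
  · have e : (fun r => remA ((ω * (1 + s)) ^ 2) r - remA ((ω * (1 + t)) ^ 2) r)
        = fun r : ℝ => -(1 / (4 * (Real.pi : ℂ)))
          * (jser ((ω * (1 + s)) ^ 2 * r) - jser ((ω * (1 + t)) ^ 2 * r)) := by
      ext r; simp only [remA]; ring
    rw [e]
    refine (jd.const_mul _).mono ?_
    calc _ ≤ 1 * (c₁ * (3 * a * ‖s - t‖)) := mul_le_mul hπ4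
          (mul_le_mul_of_nonneg_left hzd hc₁.le) (by positivity) zero_le_one
      _ ≤ _ := by
        have : 0 ≤ (17 * c₁ * a + 20 * c₂ * a + 20 * (c₁ + c₂) * (a * κ)) * ‖s - t‖ := by positivity
        linarith
  -- Product rule for differences: the variation of `greenConst` multiplies a factor that is already
  -- `O(|ω|²)`.
  · have e : (fun r => remB (greenConst (ω * (1 + s))) ((ω * (1 + s)) ^ 2) r
        - remB (greenConst (ω * (1 + t))) ((ω * (1 + t)) ^ 2) r) = fun r : ℝ =>
        ((greenConst (ω * (1 + s)) - greenConst (ω * (1 + t)))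
            * (jser ((ω * (1 + s)) ^ 2 * r) - jser (0 * r))
          + greenConst (ω * (1 + t))
            * (jser ((ω * (1 + s)) ^ 2 * r) - jser ((ω * (1 + t)) ^ 2 * r)))
          + 1 / (2 * (Real.pi : ℂ))
            * (hser ((ω * (1 + s)) ^ 2 * r) - hser ((ω * (1 + t)) ^ 2 * r)) := by
      ext r; simp only [remB]; ring
    rw [e]
    refine (((js.const_mul _).add (jd.const_mul _)).add (hd.const_mul _)).mono ?_
    calc _ ≤ 2 * ‖s - t‖ * (c₁ * (2 * a)) + (κ + 1) * (c₁ * (3 * a * ‖s - t‖))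
            + 1 * (c₂ * (3 * a * ‖s - t‖)) := by
          refine add_le_add (add_le_add ?_ ?_) ?_
          · exact mul_le_mul hκd (mul_le_mul_of_nonneg_left (hz hs) hc₁.le) (by positivity) (by positivity)
          · exact mul_le_mul (hκs ht) (mul_le_mul_of_nonneg_left hzd hc₁.le) (by positivity) (by positivity)
          · exact mul_le_mul hπ2 (mul_le_mul_of_nonneg_left hzd hc₂.le) (by positivity) zero_le_one
      _ ≤ _ := by
        have : 0 ≤ (13 * c₁ * a + 17 * c₂ * a + 17 * c₁ * (a * κ) + 20 * c₂ * (a * κ)) * ‖s - t‖ := by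
          positivity
        linarith

/-- The expansion of the Green function, with bounds for all the kernels. -/
theorem exists_lowFreq {D : Set Plane} [IsFiniteMeasure (volOn D)] (hD : MeasurableSet D)
    (hb : Bornology.IsBounded D) : ∃ c > 0, IsH2Kernel D newtonKernel c ∧
      IsCompactOperator (convL D newtonKernel) ∧
      ∀ ω : ℂ, 0 < ω.re → ‖ω‖ ≤ 1 / 2 → ∀ s t : ℂ, ‖s‖ ≤ 1 / 4 → ‖t‖ ≤ 1 / 4 →
        IsH2Kernel D (remKernel (ω * (1 + s))) (c * remSize ω) ∧
        IsH2Kernel D (fun x => remKernel (ω * (1 + s)) x - remKernel (ω * (1 + t)) x)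
          (c * remSize ω * ‖s - t‖) := by
  obtain ⟨T, hT, ⟨c₁, hc₁, h1⟩, h2⟩ := exists_isH2Kernel hD hb
  obtain ⟨c₂, hc₂, h3⟩ := exists_rem_c2Bound hT
  have hA : C2Bound (fun _ => -(1 / (4 * (Real.pi : ℂ)))) T 1 := by
    refine ⟨contDiff_const, fun t _ => ?_, by simp, by simp⟩
    rw [norm_neg, norm_div, norm_mul, Complex.norm_real, Real.norm_of_nonneg Real.pi_pos.le, norm_one,
      show ‖(4 : ℂ)‖ = 4 by norm_num, div_le_one (by positivity)]
    linarith [Real.pi_gt_three]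
  have hB : C2Bound (fun _ => (0 : ℂ)) T 1 := c2Bound_zero.mono zero_le_one
  have hN : newtonKernel = rk (fun _ => -(1 / (4 * (Real.pi : ℂ)))) (fun _ => 0) :=
    funext newtonKernel_eq
  refine ⟨c₁ + c₁ * c₂, by positivity, ?_, ?_, fun ω hω hω1 s t hs ht => ?_⟩
  · rw [hN]
    exact (h1 _ _ _ hA hB).mono (by have : 0 < c₁ * c₂ := by positivity
                                    linarith)
  · rw [hN]; exact h2 _ _ _ hA hB
  · obtain ⟨⟨g1, g2⟩, g3, g4⟩ := h3 ω hω hω1 s t hs ht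
    have hr := remSize_nonneg ω
    constructor
    · refine (h1 _ _ _ g1 g2).mono ?_
      have := mul_nonneg hc₁.le hr
      linarith
    · have e : (fun x => remKernel (ω * (1 + s)) x - remKernel (ω * (1 + t)) x)
          = rk (fun r => remA ((ω * (1 + s)) ^ 2) r - remA ((ω * (1 + t)) ^ 2) r)
            (fun r => remB (greenConst (ω * (1 + s))) ((ω * (1 + s)) ^ 2) r
              - remB (greenConst (ω * (1 + t))) ((ω * (1 + t)) ^ 2) r) := by
        ext x; simp only [remKernel, rk]; ring
      rw [e]
      refine (h1 _ _ _ g3 g4).mono ?_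
      have := mul_nonneg (mul_nonneg hc₁.le hr) (norm_nonneg (s - t))
      linarith

end LowFrequency

/-! ### The volume potential as an operator on L²(D) -/

section Operators

variable {D : Set Plane}

/-- The area of `D`. -/
def area (D : Set Plane) : ℝ := (volume D).toReal

lemma area_eq_real : (volOn D).real Set.univ = area D := by
  simp [area, Measure.real]

/-- Functions whose first two weak derivatives are bounded by `C` on `L²(D)`. -/
def HasTestBound (D : Set Plane) (f : Plane → ℂ) (C : ℝ) : Prop :=
  ∀ φ ∈ testSpace D,
    (∀ i, ‖∫ x in D, f x * pd i φ x‖ ≤ C * (eLpNorm φ 2 (volOn D)).toReal) ∧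
    ∀ i j, ‖∫ x in D, f x * pd i (pd j φ) x‖ ≤ C * (eLpNorm φ 2 (volOn D)).toReal

lemma HasTestBound.mono {f : Plane → ℂ} {C C' : ℝ} (h : HasTestBound D f C) (hC : C ≤ C') :
    HasTestBound D f C' := fun φ hφ =>
  ⟨fun i => ((h φ hφ).1 i).trans (by gcongr), fun i j => ((h φ hφ).2 i j).trans (by gcongr)⟩

lemma HasTestBound.congr {f g : Plane → ℂ} {C : ℝ} (h : HasTestBound D f C)
    (hfg : f =ᵐ[volOn D] g) : HasTestBound D g C := by
  have e : ∀ ψ : Plane → ℂ, ∫ x in D, g x * ψ x = ∫ x in D, f x * ψ x := fun ψ =>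
    integral_congr_ae (by filter_upwards [hfg] with x hx; rw [hx])
  intro φ hφ
  simp only [e]
  exact h φ hφ

lemma HasTestBound.add {f g : L2 D} {C C' : ℝ} (hf : HasTestBound D f C) (hg : HasTestBound D g C') :
    HasTestBound D (f + g : L2 D) (C + C') := by
  have e : ∀ ψ ∈ testSpace D, ∫ x in D, (f + g : L2 D) x * ψ x
      = (∫ x in D, f x * ψ x) + ∫ x in D, g x * ψ x := fun ψ hψ => by
    have hi : ∀ h : L2 D, Integrable (fun x => h x * ψ x) (volOn D) := fun h =>
      (Lp.memLp h).integrable_mul (testSpace_memLp hψ)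
    rw [← integral_add (hi f) (hi g)]
    refine integral_congr_ae ?_
    filter_upwards [Lp.coeFn_add f g] with x hx
    rw [hx, Pi.add_apply, add_mul]
  intro φ hφ
  refine ⟨fun i => ?_, fun i j => ?_⟩
  · rw [e _ (testSpace_pd hφ i), add_mul]
    exact norm_add_le_of_le ((hf φ hφ).1 i) ((hg φ hφ).1 i)
  · rw [e _ (testSpace_pd (testSpace_pd hφ j) i), add_mul]
    exact norm_add_le_of_le ((hf φ hφ).2 i j) ((hg φ hφ).2 i j)

lemma HasTestBound.smul {f : L2 D} {C : ℝ} (hf : HasTestBound D f C) (c : ℂ) :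
    HasTestBound D (c • f : L2 D) (‖c‖ * C) := by
  have e : ∀ ψ : Plane → ℂ, ∫ x in D, (c • f : L2 D) x * ψ x = c * ∫ x in D, f x * ψ x := fun ψ => by
    rw [← integral_const_mul]
    refine integral_congr_ae ?_
    filter_upwards [Lp.coeFn_smul c f] with x hx
    rw [hx, Pi.smul_apply, smul_eq_mul, mul_assoc]
  intro φ hφ
  simp only [e, norm_mul, mul_assoc]
  exact ⟨fun i => mul_le_mul_of_nonneg_left ((hf φ hφ).1 i) (norm_nonneg c),
    fun i j => mul_le_mul_of_nonneg_left ((hf φ hφ).2 i j) (norm_nonneg c)⟩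

lemma integral_pd_eq_zero {φ : Plane → ℂ} (hφ : φ ∈ testSpace D) (i : Fin 2) :
    ∫ x in D, pd i φ x = 0 := by
  have h0 : ∀ x, x ∉ D → pd i φ x = 0 := fun x hx => by
    by_contra h
    exact hx ((testSpace_pd hφ i).2 (subset_tsupport _ h))
  rw [setIntegral_eq_integral_of_forall_compl_eq_zero h0]
  have := integral_mul_fderiv_eq_neg_fderiv_mul_of_integrable (μ := (volume : Measure Plane))
    (f := fun _ : Plane => (1 : ℂ)) (g := φ) (v := EuclideanSpace.single i 1)
    (by simp) (by simp only [one_mul]; exact (hφ.1.pd i).integrable) (by simpa using hφ.1.integrable)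
    (fun _ _ => differentiableAt_const _) (fun x _ => hφ.1.differentiable x)
  simpa [pd] using this

variable [IsFiniteMeasure (volOn D)]

/-- The constant function `1` in `L²(D)`. -/
def oneL (D : Set Plane) [IsFiniteMeasure (volOn D)] : L2 D := Lp.const 2 (volOn D) 1

lemma oneL_ae : oneL D =ᵐ[volOn D] fun _ => 1 := Lp.coeFn_const 2 (volOn D) 1

lemma inner_oneL (f : L2 D) : inner ℂ (oneL D) f = ∫ x in D, f x := by
  rw [L2.inner_def]
  refine integral_congr_ae ?_
  filter_upwards [oneL_ae (D := D)] with x hx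
  simp [hx, RCLike.inner_apply]

lemma inner_oneL_self : inner ℂ (oneL D) (oneL D) = (area D : ℂ) := by
  rw [inner_oneL, integral_congr_ae oneL_ae, integral_const, area_eq_real]
  simp

lemma norm_oneL_sq : ‖oneL D‖ ^ 2 = area D := by
  have h := inner_self_eq_norm_sq_to_K (𝕜 := ℂ) (oneL D)
  rw [inner_oneL_self] at h
  exact Complex.ofReal_injective (by push_cast; exact h.symm)

/-- Constants have no derivatives. This is why the large `greenConst` never enters the H² estimates.
-/
lemma hasTestBound_oneL : HasTestBound D (oneL D) 0 := by
  have e : ∀ ψ : Plane → ℂ, ∫ x in D, oneL D x * ψ x = ∫ x in D, ψ x := fun ψ =>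
    integral_congr_ae (by filter_upwards [oneL_ae (D := D)] with x hx; rw [hx, one_mul])
  intro φ hφ
  simp only [e]
  refine ⟨fun i => ?_, fun i j => ?_⟩
  · rw [integral_pd_eq_zero hφ]; simp
  · rw [integral_pd_eq_zero (testSpace_pd hφ j)]; simp

/-- The projection to the constants. -/
def meanL (D : Set Plane) [IsFiniteMeasure (volOn D)] : L2 D →L[ℂ] L2 D :=
  ((area D : ℂ)⁻¹ • innerSL ℂ (oneL D)).smulRight (oneL D)

lemma meanL_apply (f : L2 D) : meanL D f = ((area D : ℂ)⁻¹ * inner ℂ (oneL D) f) • oneL D := by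
  simp [meanL]

lemma meanL_oneL (hA : 0 < area D) : meanL D (oneL D) = oneL D := by
  rw [meanL_apply, inner_oneL_self, inv_mul_cancel₀ (by exact_mod_cast hA.ne'), one_smul]

lemma meanL_meanL (hA : 0 < area D) (f : L2 D) : meanL D (meanL D f) = meanL D f := by
  rw [meanL_apply f, map_smul, meanL_oneL hA]

lemma inner_meanL (f g : L2 D) : inner ℂ (meanL D f) g = inner ℂ f (meanL D g) := by
  rw [meanL_apply, meanL_apply, inner_smul_left, inner_smul_right, map_mul, map_inv₀,
    Complex.conj_ofReal, inner_conj_symm]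
  ring

lemma isKernel_const (hD : MeasurableSet D) (c : ℂ) : ∃ M, IsKernel D (fun _ => c) M :=
  ⟨_, isKernel_of_bound measurable_const (norm_nonneg c) hD fun _ _ _ _ => le_rfl⟩

lemma convL_const (hD : MeasurableSet D) (hA : 0 < area D) (c : ℂ) :
    convL D (fun _ => c) = (area D * c) • meanL D := by
  obtain ⟨M, hM⟩ := isKernel_const hD c
  ext1 f
  refine Lp.ext ?_
  rw [smul_apply, meanL_apply, smul_smul, inner_oneL]
  filter_upwards [convL_ae hD hM f, Lp.coeFn_smul (area D * c * ((area D : ℂ)⁻¹ * ∫ x in D, f x)) (oneL D),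
    oneL_ae (D := D)] with x h1 h2 h3
  have : (area D : ℂ) ≠ 0 := by exact_mod_cast hA.ne'
  rw [h1, h2, Pi.smul_apply, h3, convF, integral_const_mul]
  simp only [smul_eq_mul]
  field_simp

lemma HasTestBound.convL {k : Plane → ℂ} {M : ℝ} (hD : MeasurableSet D) (hk : IsH2Kernel D k M)
    (f : L2 D) : HasTestBound D (convL D k f) (M * ‖f‖) := by
  refine HasTestBound.congr (fun φ hφ => ?_) (convL_ae hD hk.toIsKernel f).symm
  rw [Lp.norm_def]
  exact ⟨hk.grad f (Lp.memLp f) φ hφ, hk.hess f (Lp.memLp f) φ hφ⟩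

/-- The kernel of the volume potential, up to its value at the origin. -/
def greenKernel (ω : ℂ) (x : Plane) : ℂ := greenConst ω + (newtonKernel x + remKernel ω x)

/-- The regularizing part of the volume potential. -/
def regL (D : Set Plane) [IsFiniteMeasure (volOn D)] (ω : ℂ) : L2 D →L[ℂ] L2 D :=
  convL D newtonKernel + convL D (remKernel ω)

variable {ω : ℂ} {c c' : ℝ}

lemma exists_isKernel_greenKernel (hD : MeasurableSet D) (hN : IsKernel D newtonKernel c)
    (hr : IsKernel D (remKernel ω) c') : ∃ M, IsKernel D (greenKernel ω) M := by
  obtain ⟨M, hM⟩ := isKernel_const hD (greenConst ω)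
  exact ⟨_, hM.add (hN.add hr)⟩

/-- The logarithmic divergence is confined to one direction, that of the constants; `regL` stays
bounded at low frequency. -/
lemma convL_greenKernel (hD : MeasurableSet D) (hA : 0 < area D) (hN : IsKernel D newtonKernel c)
    (hr : IsKernel D (remKernel ω) c') :
    convL D (greenKernel ω) = (area D * greenConst ω) • meanL D + regL D ω := by
  obtain ⟨M, hM⟩ := isKernel_const hD (greenConst ω)
  have : greenKernel ω = fun x => (fun _ => greenConst ω) x + (fun x => newtonKernel x + remKernel ω x) x :=
    rfl
  rw [this, convL_add hD hM (hN.add hr), convL_const hD hA, convL_add hD hN hr, regL]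

lemma volPotential_eq (hD : MeasurableSet D) (hω : ω ≠ 0) {f : Plane → ℂ} {g : L2 D}
    (hf : f =ᵐ[volOn D] g) (hN : IsKernel D newtonKernel c) (hr : IsKernel D (remKernel ω) c') :
    volPotential D ω f =ᵐ[volOn D] convL D (greenKernel ω) g := by
  obtain ⟨M, hM⟩ := exists_isKernel_greenKernel hD hN hr
  filter_upwards [ae_restrict_mem hD, convL_ae hD hM g] with x hx h1
  rw [h1, ← convF_congr hf]
  exact convF_congr_kernel (k := green ω) hD (fun x _ y _ hxy => by
    rw [green_eq hω (sub_ne_zero.2 hxy), greenKernel, remKernel, add_assoc]) f hx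

/-- The Lippmann-Schwinger equation as an equation in `L²(D)`. -/
lemma lippmannSchwinger_iff (hD : MeasurableSet D) (hω : ω ≠ 0) (hN : IsKernel D newtonKernel c)
    (hr : IsKernel D (remKernel ω) c') {τ : ℝ} {u f : Plane → ℂ} {w g : L2 D}
    (hu : u =ᵐ[volOn D] w) (hf : f =ᵐ[volOn D] g) :
    (u =ᵐ[volOn D] fun x => (τ : ℂ) * ω ^ 2 * volPotential D ω f x) ↔
      w = ((τ : ℂ) * ω ^ 2) • convL D (greenKernel ω) g := by
  have h1 := volPotential_eq hD hω hf hN hr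
  have h2 := Lp.coeFn_smul ((τ : ℂ) * ω ^ 2) (convL D (greenKernel ω) g)
  constructor
  · intro h
    refine Lp.ext ?_
    filter_upwards [hu, h1, h2, h] with x a1 a2 a3 a4
    rw [← a1, a4, a3, Pi.smul_apply, smul_eq_mul, a2]
  · intro h
    rw [← h] at h2
    filter_upwards [hu, h1, h2] with x a1 a2 a3
    rw [a1, a3, Pi.smul_apply, smul_eq_mul, a2]

lemma sqrtArea_pos (hA : 0 < area D) : 0 < ‖oneL D‖ := by
  have := norm_oneL_sq (D := D)
  by_contra h
  have h0 : ‖oneL D‖ = 0 := le_antisymm (not_lt.1 h) (norm_nonneg _)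
  rw [h0] at this; simp at this; linarith

/-- Functions which are bounded up to a constant are bounded. -/
lemma ae_bound_of_eq_add (hA : 0 < area D) {w y : L2 D} {z : ℂ} {Y : ℝ} (h : w = z • oneL D + y)
    (hY : ∀ᵐ x ∂volOn D, ‖y x‖ ≤ Y) :
    ∀ᵐ x ∂volOn D, ‖w x‖ ≤ (‖w‖ + ‖y‖) / ‖oneL D‖ + Y := by
  -- The coefficient is recovered from the norms of `w` and `y`, not from `greenConst`, so the bound
  -- is uniform.
  have h1 : ‖z‖ ≤ (‖w‖ + ‖y‖) / ‖oneL D‖ := by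
    rw [le_div_iff₀ (sqrtArea_pos hA), ← norm_smul]
    have : z • oneL D = w - y := by rw [h]; abel
    rw [this]
    exact norm_sub_le _ _
  have h2 := Lp.coeFn_add (z • oneL D) y
  rw [← h] at h2
  filter_upwards [h2, Lp.coeFn_smul z (oneL D), oneL_ae (D := D), hY] with x a1 a2 a3 a4
  rw [a1, Pi.add_apply, a2, Pi.smul_apply, a3]
  refine norm_add_le_of_le ?_ a4
  simpa using h1

end Operators

/-! ### The truncated cubic nonlinearity -/

section Truncation

/-- The truncated and rescaled cubic nonlinearity. -/
def truncCube (b M : ℝ) (z : ℂ) : ℂ := (((min (|b| * ‖z‖) |M|) ^ 2 : ℝ) : ℂ) * z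

/-- With truncated moduli `p ≤ q`, the difference is `q² (x - y) - (q + p)(q - p) x`. If `p = |M|`,
then `q = p`; otherwise `|b| ‖x‖ ≤ |M|`, so `(q - p) ‖x‖ ≤ |M| ‖x - y‖`. This gives `M² + 2 M²`. -/
lemma norm_truncCube_sub_le {b M : ℝ} {x y : ℂ} (hxy : ‖x‖ ≤ ‖y‖) :
    ‖truncCube b M x - truncCube b M y‖ ≤ 3 * M ^ 2 * ‖x - y‖ := by
  set p := min (|b| * ‖x‖) |M| with hp
  set q := min (|b| * ‖y‖) |M| with hq
  have hb := abs_nonneg b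
  have hM := abs_nonneg M
  have hp0 : 0 ≤ p := by positivity
  have hpq : p ≤ q := min_le_min_right _ (by gcongr)
  have hqM : q ≤ |M| := min_le_right _ _
  have hd : q - p ≤ |b| * ‖x - y‖ ∧ (q - p) * ‖x‖ ≤ |M| * ‖x - y‖ := by
    have h1 : ‖y‖ - ‖x‖ ≤ ‖x - y‖ := by rw [norm_sub_rev]; exact norm_sub_norm_le _ _
    rcases le_total (|b| * ‖x‖) |M| with h | h
    · have hpe : p = |b| * ‖x‖ := min_eq_left h
      have h2 : q - p ≤ |b| * ‖x - y‖ := by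
        have : q ≤ |b| * ‖y‖ := min_le_left _ _
        nlinarith
      refine ⟨h2, (mul_le_mul_of_nonneg_right h2 (norm_nonneg x)).trans ?_⟩
      nlinarith [norm_nonneg (x - y)]
    · have hpe : p = |M| := min_eq_right h
      have : q - p ≤ 0 := by linarith
      exact ⟨this.trans (by positivity),
        (mul_nonpos_of_nonpos_of_nonneg this (norm_nonneg x)).trans (by positivity)⟩
  have e : truncCube b M x - truncCube b M y
      = ((q ^ 2 : ℝ) : ℂ) * (x - y) - (((q + p) * (q - p) : ℝ) : ℂ) * x := by
    simp only [truncCube, ← hp, ← hq]; push_cast; ring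
  have hn := norm_nonneg (x - y)
  have h1 : q ^ 2 * ‖x - y‖ ≤ |M| ^ 2 * ‖x - y‖ := by gcongr
  have h2 : (q + p) * ((q - p) * ‖x‖) ≤ (|M| + |M|) * (|M| * ‖x - y‖) :=
    mul_le_mul (by linarith) hd.2 (mul_nonneg (by linarith) (norm_nonneg x)) (by positivity)
  rw [e]
  refine (norm_sub_le _ _).trans ?_
  rw [norm_mul, norm_mul, Complex.norm_real, Complex.norm_real, Real.norm_of_nonneg (by positivity),
    Real.norm_of_nonneg (mul_nonneg (by linarith) (by linarith))]
  rw [← sq_abs M]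
  nlinarith

lemma lipschitzWith_truncCube (b M : ℝ) :
    LipschitzWith (3 * M ^ 2).toNNReal (truncCube b M) := by
  refine LipschitzWith.of_dist_le_mul fun x y => ?_
  rw [dist_eq_norm, dist_eq_norm, Real.coe_toNNReal _ (by positivity)]
  rcases le_total ‖x‖ ‖y‖ with h | h
  · exact norm_truncCube_sub_le h
  · rw [norm_sub_rev, norm_sub_rev x]; exact norm_truncCube_sub_le h

lemma truncCube_zero (b M : ℝ) : truncCube b M 0 = 0 := by simp [truncCube]

variable {D : Set Plane}

/-- The truncated and rescaled cubic nonlinearity on `L²(D)`. -/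
def truncL (b M : ℝ) (w : L2 D) : L2 D :=
  (lipschitzWith_truncCube b M).compLp (truncCube_zero b M) w

lemma truncL_ae (b M : ℝ) (w : L2 D) : truncL b M w =ᵐ[volOn D] fun x => truncCube b M (w x) :=
  (lipschitzWith_truncCube b M).coeFn_compLp (truncCube_zero b M) w

lemma norm_truncL_sub_le (b M : ℝ) (w w' : L2 D) :
    ‖truncL b M w - truncL b M w'‖ ≤ 3 * M ^ 2 * ‖w - w'‖ := by
  have h := (lipschitzWith_truncCube b M).norm_compLp_sub_le (truncCube_zero b M) w w'
  rwa [Real.coe_toNNReal _ (by positivity)] at h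

lemma truncL_zero (b M : ℝ) : truncL b M (0 : L2 D) = 0 :=
  (lipschitzWith_truncCube b M).compLp_zero (truncCube_zero b M)

lemma norm_truncL_le (b M : ℝ) (w : L2 D) : ‖truncL b M w‖ ≤ 3 * M ^ 2 * ‖w‖ := by
  simpa [truncL_zero] using norm_truncL_sub_le b M w 0

lemma truncL_ae_of_bound {b M : ℝ} (hb : 0 ≤ b) (hM : 0 ≤ M) {w : L2 D}
    (h : ∀ᵐ x ∂volOn D, b * ‖w x‖ ≤ M) :
    truncL b M w =ᵐ[volOn D] fun x => (b : ℂ) ^ 2 * (‖w x‖ : ℂ) ^ 2 * w x := by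
  filter_upwards [truncL_ae b M w, h] with x h1 h2
  rw [h1, truncCube, abs_of_nonneg hb, abs_of_nonneg hM, min_eq_left h2]
  push_cast; ring

/-- The nonlinearity is homogeneous where it is not truncated. -/
lemma truncL_eq_smul {b M M' : ℝ} (hb : 0 ≤ b) (hM : 0 ≤ M) (hM' : 0 ≤ M') {w : L2 D}
    (h : ∀ᵐ x ∂volOn D, b * ‖w x‖ ≤ M) (h' : ∀ᵐ x ∂volOn D, ‖w x‖ ≤ M') :
    truncL b M w = ((b : ℂ) ^ 2) • truncL 1 M' w := by
  refine Lp.ext ?_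
  filter_upwards [truncL_ae_of_bound hb hM h,
    truncL_ae_of_bound zero_le_one hM' (by simpa using h'),
    Lp.coeFn_smul ((b : ℂ) ^ 2) (truncL 1 M' w)] with x h1 h2 h3
  rw [h1, h3, Pi.smul_apply, h2, smul_eq_mul]
  simp [mul_assoc]

/-- The pairing is the integral of `min(|v|, M)² |v|²`, positive unless `v = 0`. This nondegeneracy
makes the frequency determine the amplitude. -/
lemma inner_truncL_ne_zero {M : ℝ} (hM : 0 < M) {v : L2 D} (hv : v ≠ 0) :
    inner ℂ v (truncL 1 M v) ≠ 0 := by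
  set F : Plane → ℝ := fun x => (min ‖v x‖ M) ^ 2 * ‖v x‖ ^ 2 with hF
  have e : inner ℂ v (truncL 1 M v) = ((∫ x in D, F x : ℝ) : ℂ) := by
    rw [L2.inner_def, ← integral_complex_ofReal]
    refine integral_congr_ae ?_
    filter_upwards [truncL_ae 1 M v] with x hx
    have h1 : v x * conj (v x) = (‖v x‖ : ℂ) ^ 2 := Complex.mul_conj' _
    rw [hx, RCLike.inner_apply, truncCube, mul_assoc, h1, hF, abs_one, one_mul, abs_of_pos hM]
    push_cast; ring
  rw [e]
  have hint : Integrable F (volOn D) := by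
    have h2 : Integrable (fun x => ‖v x‖ ^ 2) (volOn D) := (Lp.memLp v).integrable_norm_pow two_ne_zero
    refine (h2.const_mul (M ^ 2)).mono' ?_ (Eventually.of_forall fun x => ?_)
    · have hm := (Lp.memLp v).1.norm
      exact ((hm.inf aestronglyMeasurable_const).pow 2).mul (hm.pow 2)
    · rw [Real.norm_of_nonneg (by positivity)]
      have : 0 ≤ min ‖v x‖ M := by positivity
      exact mul_le_mul_of_nonneg_right (pow_le_pow_left₀ this (min_le_right _ _) 2) (by positivity)
  intro h
  have h0 : ∫ x in D, F x = 0 := by exact_mod_cast h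
  rw [integral_eq_zero_iff_of_nonneg (fun x => by positivity) hint] at h0
  apply hv
  refine Lp.ext ?_
  filter_upwards [h0, Lp.coeFn_zero ℂ 2 (volOn D)] with x hx hz
  rw [hz]
  by_contra hne
  have : 0 < ‖v x‖ := norm_pos_iff.2 hne
  have h3 : 0 < F x := by positivity
  exact h3.ne' hx

end Truncation

/-- Low frequencies with bounded coupling `τ ω²`. -/
structure IsLowFreq (Λ τ : ℝ) (ω : ℂ) : Prop where
  re_pos : 0 < ω.re
  norm_le : ‖ω‖ ≤ 1 / 2
  rem_le : remSize ω ≤ 1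
  coupling : ‖(τ : ℂ) * ω ^ 2‖ ≤ Λ

lemma IsLowFreq.norm_coupling_le {Λ τ : ℝ} {ω s : ℂ} (hω : IsLowFreq Λ τ ω) (hs : ‖s‖ ≤ 1 / 4) :
    ‖((τ : ℂ) * ω ^ 2) * (1 + s) ^ 2‖ ≤ 2 * Λ := by
  rw [norm_mul, mul_comm]
  exact mul_le_mul (BifModel.norm_one_add_sq_le hs) hω.coupling (norm_nonneg _) zero_le_two

/-! ### A priori estimates from the Lippmann–Schwinger equation -/

section Linear

variable {D : Set Plane} [IsFiniteMeasure (volOn D)]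

/-- The common hypotheses on the domain: the Newtonian kernel and the remainders in the low
frequency expansion are bounded with constant `c`. -/
structure IsDomain2 (D : Set Plane) [IsFiniteMeasure (volOn D)] (c : ℝ) : Prop where
  meas : MeasurableSet D
  area_pos : 0 < area D
  pos : 0 < c
  newton : IsH2Kernel D newtonKernel c
  compact : IsCompactOperator (convL D newtonKernel)
  rem : ∀ ω : ℂ, 0 < ω.re → ‖ω‖ ≤ 1 / 2 → ∀ s t : ℂ, ‖s‖ ≤ 1 / 4 → ‖t‖ ≤ 1 / 4 →
    IsH2Kernel D (remKernel (ω * (1 + s))) (c * remSize ω) ∧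
    IsH2Kernel D (fun x => remKernel (ω * (1 + s)) x - remKernel (ω * (1 + t)) x)
      (c * remSize ω * ‖s - t‖)

variable {c Λ τ : ℝ} {ω s : ℂ}

lemma IsLowFreq.ne_zero (h : IsLowFreq Λ τ ω) (hs : ‖s‖ ≤ 1 / 4) : ω * (1 + s) ≠ 0 :=
  mul_ne_zero (fun h0 => by have := h.re_pos; simp [h0] at this) (one_add_ne_zero hs)

/-- The coupling operator `λ R K^ω`. -/
def coupling (D : Set Plane) [IsFiniteMeasure (volOn D)] (τ : ℝ) (ω : ℂ) (R : L2 D →L[ℂ] L2 D)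
    (s : ℂ) : L2 D →L[ℂ] L2 D :=
  ((τ : ℂ) * ω ^ 2) • R ∘L convL D (greenKernel (ω * (1 + s)))

/-- `R` is a preconditioner: by injectivity no information is lost, and the freedom in its choice
serves to remove the divergence of `greenConst`. -/
lemma bifResidual_coupling_iff {R : L2 D →L[ℂ] L2 D} (hR : Function.Injective R) {w g : L2 D} :
    bifResidual R (coupling D τ ω R) s w g = 0 ↔
      w = ((τ : ℂ) * (ω * (1 + s)) ^ 2) • convL D (greenKernel (ω * (1 + s))) (w + g) := by
  have e : bifResidual R (coupling D τ ω R) s w g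
      = R (w - ((τ : ℂ) * (ω * (1 + s)) ^ 2) • convL D (greenKernel (ω * (1 + s))) (w + g)) := by
    rw [bifResidual, map_sub, map_smul, coupling, smul_apply, ContinuousLinearMap.comp_apply, smul_smul]
    congr 2
    ring
  rw [e, map_eq_zero_iff R hR, sub_eq_zero]

variable (hd : IsDomain2 D c) (hω : IsLowFreq Λ τ ω)
include hd hω

lemma IsDomain2.rem_kernel (hs : ‖s‖ ≤ 1 / 4) : IsH2Kernel D (remKernel (ω * (1 + s))) c :=
  (hd.rem ω hω.re_pos hω.norm_le s s hs hs).1.mono (by nlinarith [hd.pos, hω.rem_le])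

lemma norm_regL_apply_le (hs : ‖s‖ ≤ 1 / 4) (f : L2 D) :
    ∀ᵐ x ∂volOn D, ‖regL D (ω * (1 + s)) f x‖ ≤ 2 * c * ‖f‖ := by
  filter_upwards [norm_convL_apply_le hd.meas hd.newton.toIsKernel f,
    norm_convL_apply_le hd.meas (hd.rem_kernel hω hs).toIsKernel f,
    Lp.coeFn_add (convL D newtonKernel f) (convL D (remKernel (ω * (1 + s))) f)] with x h1 h2 h3
  have : regL D (ω * (1 + s)) f x = convL D newtonKernel f x + convL D (remKernel (ω * (1 + s))) f x :=
    h3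
  rw [this]
  exact (norm_add_le_of_le h1 h2).trans (by linarith)

lemma norm_regL_le (hs : ‖s‖ ≤ 1 / 4) (f : L2 D) :
    ‖regL D (ω * (1 + s)) f‖ ≤ sqrtArea D * (2 * c * ‖f‖) :=
  norm_le_of_ae_bound (by have := hd.pos; positivity) (norm_regL_apply_le hd hω hs f)

lemma hasTestBound_regL (hs : ‖s‖ ≤ 1 / 4) (f : L2 D) :
    HasTestBound D (regL D (ω * (1 + s)) f) (2 * c * ‖f‖) :=
  ((HasTestBound.convL hd.meas hd.newton f).add
    (HasTestBound.convL hd.meas (hd.rem_kernel hω hs) f)).mono (by linarith)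

/-- The Newtonian kernel does not depend on the frequency and cancels; only the remainders are left.
-/
lemma hasTestBound_regL_sub (hs : ‖s‖ ≤ 1 / 4) (f : L2 D) :
    HasTestBound D ((regL D (ω * (1 + s)) - regL D (ω * (1 + 0))) f : L2 D) (c * ‖s‖ * ‖f‖) := by
  have h0 : ‖(0 : ℂ)‖ ≤ 1 / 4 := by simp
  have hk := (hd.rem ω hω.re_pos hω.norm_le s 0 hs h0).2
  have e : regL D (ω * (1 + s)) - regL D (ω * (1 + 0))
      = convL D (fun x => remKernel (ω * (1 + s)) x - remKernel (ω * (1 + 0)) x) := by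
    rw [convL_sub hd.meas (hd.rem_kernel hω hs).toIsKernel (hd.rem_kernel hω h0).toIsKernel, regL, regL]
    abel
  rw [e]
  refine (HasTestBound.convL hd.meas hk f).mono ?_
  rw [sub_zero]
  have := hd.pos
  have h1 : c * remSize ω ≤ c * 1 := by gcongr; exact hω.rem_le
  have : 0 ≤ ‖s‖ * ‖f‖ := by positivity
  nlinarith

/-- The volume potential is a constant, up to a regular part. -/
lemma exists_eq_oneL_add {w g : L2 D} (hs : ‖s‖ ≤ 1 / 4)
    (h : w = ((τ : ℂ) * (ω * (1 + s)) ^ 2) • convL D (greenKernel (ω * (1 + s))) (w + g)) :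
    ∃ z : ℂ, w = z • oneL D + (((τ : ℂ) * ω ^ 2) * (1 + s) ^ 2) • regL D (ω * (1 + s)) (w + g) := by
  refine ⟨((τ : ℂ) * ω ^ 2) * (1 + s) ^ 2 * (area D * greenConst (ω * (1 + s)))
    * ((area D : ℂ)⁻¹ * inner ℂ (oneL D) (w + g)), ?_⟩
  conv_lhs => rw [h]
  rw [convL_greenKernel hd.meas hd.area_pos hd.newton.toIsKernel (hd.rem_kernel hω hs).toIsKernel,
    add_apply, smul_apply, meanL_apply, smul_add, smul_smul, smul_smul]
  congr 2 <;> ring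

/-- States are bounded in terms of their `L²` norms. -/
lemma ae_bound_of_lippmannSchwinger {w g : L2 D} (hs : ‖s‖ ≤ 1 / 4) (hg : ‖g‖ ≤ ‖w‖)
    (h : w = ((τ : ℂ) * (ω * (1 + s)) ^ 2) • convL D (greenKernel (ω * (1 + s))) (w + g)) :
    ∀ᵐ x ∂volOn D, ‖w x‖ ≤ ((1 + sqrtArea D * (8 * Λ * c)) / ‖oneL D‖ + 8 * Λ * c) * ‖w‖ := by
  obtain ⟨z, hz⟩ := exists_eq_oneL_add hd hω hs h
  set κ := ((τ : ℂ) * ω ^ 2) * (1 + s) ^ 2 with hκ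
  have hκ2 : ‖κ‖ ≤ 2 * Λ := hω.norm_coupling_le hs
  have hΛ : 0 ≤ 2 * Λ := (norm_nonneg _).trans hκ2
  have hc := hd.pos
  have hwg : ‖w + g‖ ≤ 2 * ‖w‖ := (norm_add_le _ _).trans (by linarith)
  have hy : ∀ᵐ x ∂volOn D, ‖(κ • regL D (ω * (1 + s)) (w + g) : L2 D) x‖ ≤ 8 * Λ * c * ‖w‖ := by
    filter_upwards [Lp.coeFn_smul κ (regL D (ω * (1 + s)) (w + g)),
      norm_regL_apply_le hd hω hs (w + g)] with x h1 h2
    rw [h1, Pi.smul_apply, norm_smul]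
    calc _ ≤ 2 * Λ * (2 * c * (2 * ‖w‖)) := by
          refine mul_le_mul hκ2 (h2.trans (by gcongr)) (norm_nonneg _) hΛ
      _ = _ := by ring
  have hy2 := norm_le_of_ae_bound (by nlinarith [norm_nonneg w, mul_nonneg hΛ hc.le, mul_nonneg (mul_nonneg hΛ hc.le) (norm_nonneg w)]) hy
  filter_upwards [ae_bound_of_eq_add hd.area_pos hz hy] with x hx
  refine hx.trans ?_
  have h1 := sqrtArea_pos hd.area_pos
  calc _ ≤ (‖w‖ + sqrtArea D * (8 * Λ * c * ‖w‖)) / ‖oneL D‖ + 8 * Λ * c * ‖w‖ := by gcongr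
    _ = _ := by ring

lemma hasTestBound_of_lippmannSchwinger {w g : L2 D} (hs : ‖s‖ ≤ 1 / 4)
    (h : w = ((τ : ℂ) * (ω * (1 + s)) ^ 2) • convL D (greenKernel (ω * (1 + s))) (w + g)) :
    ∃ C, 0 ≤ C ∧ HasTestBound D w C := by
  obtain ⟨z, hz⟩ := exists_eq_oneL_add hd hω hs h
  have hb := ((hasTestBound_oneL (D := D)).smul z).add
    ((hasTestBound_regL hd hω hs (w + g)).smul (((τ : ℂ) * ω ^ 2) * (1 + s) ^ 2))
  rw [← hz] at hb
  have := hd.pos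
  exact ⟨_, by positivity, hb⟩

/-- The difference of a state and a linear state. -/
lemma hasTestBound_sub {w g φ : L2 D} (hs : ‖s‖ ≤ 1 / 4)
    (h : w = ((τ : ℂ) * (ω * (1 + s)) ^ 2) • convL D (greenKernel (ω * (1 + s))) (w + g))
    (hφ : φ = ((τ : ℂ) * (ω * (1 + 0)) ^ 2) • convL D (greenKernel (ω * (1 + 0))) (φ + 0)) :
    HasTestBound D (w - φ : L2 D) (Λ * c * (4 * (‖w - φ‖ + ‖g‖) + 7 * ‖s‖ * ‖φ‖)) := by
  have h0 : ‖(0 : ℂ)‖ ≤ 1 / 4 := by simp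
  obtain ⟨z, hz⟩ := exists_eq_oneL_add hd hω hs h
  obtain ⟨z', hz'⟩ := exists_eq_oneL_add hd hω h0 hφ
  set κ := (τ : ℂ) * ω ^ 2 with hκ
  have hκ1 : ‖κ‖ ≤ Λ := hω.coupling
  have hΛ : 0 ≤ Λ := (norm_nonneg _).trans hκ1
  have hc := hd.pos
  set G := regL D (ω * (1 + s)) with hG
  set G₀ := regL D (ω * (1 + 0)) with hG₀
  -- The constant parts merge into one multiple of `1`, invisible to derivatives. In the bound, `4 =
  -- 2 · 2` comes from `(1 + s)²` and `regL`, and `7 = 3 · 2 + 1` from the variations of `(1 + s)²`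
  -- and of `regL`.
  have e : w - φ = (z - z') • oneL D + ((κ * (1 + s) ^ 2) • G (w - φ + g)
      + ((κ * ((1 + s) ^ 2 - 1)) • G φ + κ • (G - G₀) φ)) := by
    conv_lhs => rw [hz, hz']
    simp only [add_zero, one_pow, mul_one, map_add, map_sub, sub_apply, smul_add, smul_sub, sub_smul,
      mul_sub]
    abel
  have hb := ((hasTestBound_oneL (D := D)).smul (z - z')).add
    (((hasTestBound_regL hd hω hs (w - φ + g)).smul (κ * (1 + s) ^ 2)).add
    (((hasTestBound_regL hd hω hs φ).smul (κ * ((1 + s) ^ 2 - 1))).add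
      ((hasTestBound_regL_sub hd hω hs φ).smul κ)))
  rw [← e] at hb
  refine hb.mono ?_
  have b1 : ‖κ * (1 + s) ^ 2‖ ≤ 2 * Λ := hω.norm_coupling_le hs
  have b2 : ‖κ * ((1 + s) ^ 2 - 1)‖ ≤ Λ * (3 * ‖s‖) := by
    rw [norm_mul]
    exact mul_le_mul hκ1 (BifModel.norm_one_add_sq_sub_le hs) (norm_nonneg _) hΛ
  have b3 : ‖w - φ + g‖ ≤ ‖w - φ‖ + ‖g‖ := norm_add_le _ _
  calc _ ≤ ‖z - z'‖ * 0 + (2 * Λ * (2 * c * (‖w - φ‖ + ‖g‖)) + (Λ * (3 * ‖s‖) * (2 * c * ‖φ‖)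
        + Λ * (c * ‖s‖ * ‖φ‖))) := by gcongr
    _ = _ := by ring

end Linear

/-! ### Invariance under changes on null sets -/

section Congruence

variable {D : Set Plane} {f f' : Plane → ℂ}

lemma HasWeakPartial.congr_left {i : Fin 2} {g : Plane → ℂ} (h : HasWeakPartial D i f g)
    (hf : f =ᵐ[volOn D] f') : HasWeakPartial D i f' g := fun φ h1 h2 h3 => by
  rw [← h φ h1 h2 h3]
  exact integral_congr_ae (by filter_upwards [hf] with x hx; rw [hx])

lemma IsH2Jet.congr {g : Fin 2 → Plane → ℂ} {H : Fin 2 → Fin 2 → Plane → ℂ} (h : IsH2Jet D f g H)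
    (hf : f =ᵐ[volOn D] f') : IsH2Jet D f' g H :=
  ⟨h.memLp.ae_eq hf, h.memLp_grad, h.memLp_hess, fun i => (h.grad i).congr_left hf, h.hess⟩

lemma MemH2.congr (h : MemH2 D f) (hf : f =ᵐ[volOn D] f') : MemH2 D f' :=
  let ⟨g, H, hj⟩ := h; ⟨g, H, hj.congr hf⟩

lemma eH2Norm_congr (hf : f =ᵐ[volOn D] f') : eH2Norm D f = eH2Norm D f' := by
  unfold eH2Norm
  refine iInf_congr fun g => iInf_congr fun H => ?_
  rw [eLpNorm_congr_ae hf]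
  exact iInf_congr_Prop ⟨fun h => h.congr hf, fun h => h.congr hf.symm⟩ fun _ => rfl

lemma memH2_of_hasTestBound {w : L2 D} {C : ℝ} (hC : 0 ≤ C) (h : HasTestBound D w C) :
    MemH2 D w ∧ eH2Norm D w ≤ ENNReal.ofReal (‖w‖ + 3 * C) := by
  obtain ⟨h1, h2⟩ := memH2_of_bound (Lp.memLp w) hC (fun φ hφ => (h φ hφ).1) fun φ hφ => (h φ hφ).2
  refine ⟨h1, h2.trans (le_of_eq ?_)⟩
  rw [ENNReal.ofReal_add (norm_nonneg w) (by positivity), Lp.norm_def,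
    ENNReal.ofReal_toReal (Lp.eLpNorm_ne_top w)]

lemma kerr_congr (η : ℝ) (hf : f =ᵐ[volOn D] f') : kerr η f =ᵐ[volOn D] kerr η f' := by
  filter_upwards [hf] with x hx
  simp only [kerr, hx]

lemma IsResonantState.congr {η τ : ℝ} {ω : ℂ} (h : IsResonantState D η τ ω f)
    (hf : f =ᵐ[volOn D] f') : IsResonantState D η τ ω f' where
  memH2 := h.memH2.congr hf
  nontrivial h0 := h.nontrivial (hf.trans h0)
  lippmannSchwinger := by
    have e : volPotential D ω (kerr η f) = volPotential D ω (kerr η f') := by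
      ext x
      exact integral_congr_ae (by filter_upwards [kerr_congr η hf] with y hy; rw [hy])
    rw [← e]
    exact hf.symm.trans h.lippmannSchwinger

lemma IsNearbyPair.congr {τ ρ : ℝ} {ω₀ ω : ℂ} (h : IsNearbyPair D τ ρ ω₀ ω f)
    (hf : f =ᵐ[volOn D] f') : IsNearbyPair D τ ρ ω₀ ω f' :=
  ⟨h.state.congr hf, h.freq_near, by rw [← eLpNorm_congr_ae hf]; exact h.state_small⟩

end Congruence

/-! ### The branch at a single linear resonance -/

section Branch

variable {D : Set Plane} [IsFiniteMeasure (volOn D)] {c Λ τ : ℝ} {ω s : ℂ}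

/-- Nonlinear resonant states of amplitude `β`. -/
lemma isResonantState_smul_iff (hd : IsDomain2 D c) (hω : IsLowFreq Λ τ ω) (hs : ‖s‖ ≤ 1 / 4)
    {β : ℂ} (hβ : β ≠ 0) {M : ℝ} (hM : 0 ≤ M) {w : L2 D} (hw : ∀ᵐ x ∂volOn D, ‖β‖ * ‖w x‖ ≤ M) :
    IsResonantState D 1 τ (ω * (1 + s)) (β • w : L2 D) ↔ w ≠ 0 ∧
      w = ((τ : ℂ) * (ω * (1 + s)) ^ 2) • convL D (greenKernel (ω * (1 + s)))
        (w + truncL ‖β‖ M w) := by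
  set κ := (τ : ℂ) * (ω * (1 + s)) ^ 2
  -- The cubic term commutes with phases: `|β w|² β w = β ‖β‖² |w|² w`, so after division by `β`
  -- only the modulus of the amplitude remains.
  have hk : kerr 1 (β • w : L2 D) =ᵐ[volOn D] (β • (w + truncL ‖β‖ M w) : L2 D) := by
    filter_upwards [Lp.coeFn_smul β w, Lp.coeFn_smul β (w + truncL ‖β‖ M w),
      Lp.coeFn_add w (truncL ‖β‖ M w), truncL_ae_of_bound (norm_nonneg β) hM hw] with x h1 h2 h3 h4
    rw [h2, Pi.smul_apply, h3, Pi.add_apply, h4, kerr, h1, Pi.smul_apply, smul_eq_mul, norm_mul,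
      smul_eq_mul]
    push_cast; ring
  have hls := lippmannSchwinger_iff hd.meas (hω.ne_zero hs) hd.newton.toIsKernel
    (hd.rem_kernel hω hs).toIsKernel (τ := τ) (EventuallyEq.refl _ ⇑(β • w : L2 D)) hk
  have e : (β • w = κ • convL D (greenKernel (ω * (1 + s))) (β • (w + truncL ‖β‖ M w)))
      ↔ w = κ • convL D (greenKernel (ω * (1 + s))) (w + truncL ‖β‖ M w) := by
    rw [map_smul, smul_comm κ β]
    exact (smul_right_injective _ hβ).eq_iff
  constructor
  · intro h
    refine ⟨fun h0 => h.nontrivial ?_, e.1 (hls.1 h.lippmannSchwinger)⟩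
    rw [h0, smul_zero]
    exact Lp.coeFn_zero ℂ 2 (volOn D)
  · rintro ⟨h0, h⟩
    obtain ⟨C, hC, hb⟩ := hasTestBound_of_lippmannSchwinger hd hω hs h
    refine ⟨(memH2_of_hasTestBound (by positivity) (hb.smul β)).1, fun hz => ?_, hls.2 (e.2 h)⟩
    have : β • w = 0 := Lp.ext (hz.trans (Lp.coeFn_zero ℂ 2 (volOn D)).symm)
    exact (smul_ne_zero hβ h0) this

/-- Linear resonances at which the bifurcation problem is `η`-close to the model. -/
structure IsLinearData (m : BifModel (L2 D)) (η Λ τ : ℝ) (ω : ℂ) (φ : L2 D) : Prop where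
  low : IsLowFreq Λ τ ω
  near : ∃ R : L2 D →L[ℂ] L2 D, Function.Injective R ∧ m.Near η R (coupling D τ ω R) φ

set_option maxHeartbeats 1600000 in
/-- The branch of nonlinear resonances at a linear resonance, with uniform constants. -/
theorem exists_uniform_branch (hd : IsDomain2 D c) (m : BifModel (L2 D))
    (hm : ∀ M > 0, m.l (truncL 1 M m.v) ≠ 0) (hΛ : 0 < Λ) :
    ∃ η > 0, ∃ δ > 0, ∃ ρ > 0, ∃ K : ℝ, ∀ (τ : ℝ) (ω : ℂ) (φ : L2 D),
      IsLinearData m η Λ τ ω φ → ∀ a : ℝ, 0 < a → a < δ → ∃ (ω₁ : ℂ) (u : L2 D),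
        IsNearbyPair D τ ρ ω ω₁ u ∧ m.l u = a * m.l φ ∧
        (∀ (ω₂ : ℂ) (u₂ : L2 D), IsNearbyPair D τ ρ ω ω₂ u₂ →
          (‖m.l u₂‖ = a * ‖m.l φ‖ ∨ ω₂ = ω₁) →
          ω₂ = ω₁ ∧ ∃ θ : ℝ, u₂ = Complex.exp (Complex.I * θ) • u) ∧
        eH2Norm D (u - (a : ℂ) • φ : L2 D) ≤ ENNReal.ofReal (K * a ^ 2) ∧
        ‖ω₁ - ω‖ ≤ K * a ^ 2 * ‖ω‖ := by
  have hc := hd.pos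
  set B := (1 + sqrtArea D * (8 * Λ * c)) / ‖oneL D‖ + 8 * Λ * c with hB
  have hsq : 0 ≤ sqrtArea D := sqrtArea_nonneg
  have hB0 : 0 ≤ B := by positivity
  set V := ‖m.v‖ + 1 with hV
  have hV0 : 0 < V := by positivity
  -- `V` bounds normalized solutions in L² and `B V` bounds them in L^∞, so truncation at `M` never
  -- acts on them.
  set M := B * V + 1 with hM
  have hM0 : 0 < M := by positivity
  set γ := ‖m.l (truncL 1 M m.v)‖ with hγ
  have hγ0 : 0 < γ := norm_pos_iff.2 (hm M hM0)
  -- `ε Q` collects `ε` times the norm of the cubic term of a solution and the error of replacing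
  -- the solution by `v` in that term; the last `1` makes the final contradiction with `γ` strict.
  set Q := ‖m.l‖ * (3 * M ^ 2) + ‖truncL 1 M m.v‖ + 3 * M ^ 2 + 1 with hQ
  have hQ0 : 0 < Q := by positivity
  obtain ⟨ε, hε0, hε1, hεQ⟩ : ∃ ε > 0, ε ≤ 1 ∧ ε * Q ≤ γ :=
    ⟨min 1 (γ / Q), by positivity, min_le_left _ _, by
      rw [← le_div_iff₀ hQ0]; exact min_le_right _ _⟩
  obtain ⟨r, hr0, hr4, η₀, hη₀, hη₀r, C, hC0, hbranch⟩ := m.exists_branch ε hε0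
  -- `‖l‖ η ≤ 1/2` keeps `l φ` away from `0`, because `l v = 1`.
  obtain ⟨η, hη0, hηη, hη1, hηl⟩ : ∃ η > 0, η ≤ η₀ ∧ η ≤ 1 ∧ ‖m.l‖ * η ≤ 1 / 2 := by
    refine ⟨min η₀ (min 1 (1 / (2 * (‖m.l‖ + 1)))), by positivity, min_le_left _ _,
      (min_le_right _ _).trans (min_le_left _ _), ?_⟩
    have h : min η₀ (min 1 (1 / (2 * (‖m.l‖ + 1)))) ≤ 1 / (2 * (‖m.l‖ + 1)) :=
      (min_le_right _ _).trans (min_le_right _ _)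
    have h0 : 0 < min η₀ (min 1 (1 / (2 * (‖m.l‖ + 1)))) := by positivity
    rw [le_div_iff₀ (by positivity)] at h
    linarith
  -- At this truncation level the Lipschitz constant `3 M₁²` is at most `η`; a small amplitude
  -- brings `a w` below it.
  set M₁ := η / 3 with hM₁
  have hM₁0 : 0 < M₁ := by positivity
  have hM₁η : 3 * M₁ ^ 2 ≤ η := by
    have : η * η ≤ 1 * η := mul_le_mul_of_nonneg_right hη1 hη0.le
    rw [hM₁]; linarith
  set ρ := min M₁ r with hρ
  have hρ0 : 0 < ρ := by positivity
  set n₀ := 3 * M ^ 2 * V with hn₀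
  have hn₀0 : 0 < n₀ := by positivity
  -- Ensures `a M ≤ ρ` for the state and `C n₀ a² ≤ ρ` for the relative frequency shift, so the
  -- branch lies in the region of uniqueness.
  set δ := min 1 (ρ / (M + C * n₀)) with hδ
  have hδ0 : 0 < δ := by positivity
  set K := C * n₀ + 3 * (Λ * c * (4 * (C * n₀ + n₀) + 7 * (C * n₀) * V)) with hK
  refine ⟨η, hη0, δ, hδ0, ρ, hρ0, K, fun τ ω φ hdata a ha0 haδ => ?_⟩
  obtain ⟨hω, R, hR, hnear⟩ := hdata
  obtain ⟨hap, hU, hE⟩ := hbranch R (coupling D τ ω R) φ (hnear.mono hηη)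
  have ha1 : a ≤ 1 := (haδ.trans_le (min_le_left _ _)).le
  have haρ : a * (M + C * n₀) ≤ ρ := by
    rw [← le_div_iff₀ (by positivity)]; exact (haδ.trans_le (min_le_right _ _)).le
  have haM : a * M ≤ ρ := by linarith [mul_pos ha0 (mul_pos hC0 hn₀0)]
  have haC : C * n₀ * a ^ 2 ≤ ρ := by
    have h1 : a ^ 2 ≤ a := by rw [sq]; exact mul_le_of_le_one_left ha0.le ha1
    have h2 : C * n₀ * a ^ 2 ≤ C * n₀ * a := by gcongr
    linarith [mul_pos ha0 hM0]
  have hρM : ρ ≤ M₁ := min_le_left _ _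
  have hρr : ρ ≤ r := min_le_right _ _
  set α := m.l φ with hα
  have hα0 : α ≠ 0 := fun h => by
    have h1 : m.l (φ - m.v) = -1 := by rw [map_sub, ← hα, h, m.l_v, zero_sub]
    have h2 := (m.l.le_opNorm (φ - m.v)).trans
      (mul_le_mul_of_nonneg_left hnear.φ_near (norm_nonneg m.l))
    rw [h1, norm_neg, norm_one] at h2
    linarith
  -- bounds for normalized solutions
  have hbd : ∀ (s : ℂ) (w g : L2 D), ‖s‖ ≤ r → ‖g‖ ≤ η₀ * ‖w‖ →
      bifResidual R (coupling D τ ω R) s w g = 0 → m.l w = α →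
      ‖w - m.v‖ ≤ ε ∧ ‖w‖ ≤ V ∧ ∀ᵐ x ∂volOn D, ‖w x‖ ≤ M := by
    intro s w g hs hg h hl
    have h1 := (hap s w g hs hg h).2 hl
    have h2 : ‖w‖ ≤ V := by
      have := norm_le_norm_add_norm_sub' w m.v
      linarith
    refine ⟨h1, h2, ?_⟩
    have hg' : ‖g‖ ≤ ‖w‖ := hg.trans (mul_le_of_le_one_left (norm_nonneg w) (by linarith))
    filter_upwards [ae_bound_of_lippmannSchwinger hd hω (hs.trans hr4) hg'
      ((bifResidual_coupling_iff hR).1 h)] with x hx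
    refine hx.trans ?_
    have : B * ‖w‖ ≤ B * V := by gcongr
    linarith
  have hNle : ∀ (b : ℝ) (w : L2 D), ‖truncL b M₁ w‖ ≤ η₀ * ‖w‖ := fun b w =>
    (norm_truncL_le b M₁ w).trans (mul_le_mul_of_nonneg_right (hM₁η.trans hηη) (norm_nonneg w))
  have hNlip : ∀ (b : ℝ) (w w' : L2 D),
      ‖truncL b M₁ w - truncL b M₁ w'‖ ≤ η₀ * ‖w - w'‖ := fun b w w' =>
    (norm_truncL_sub_le b M₁ w w').trans
      (mul_le_mul_of_nonneg_right (hM₁η.trans hηη) (norm_nonneg _))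
  have hN2 : ∀ w : L2 D, (∀ᵐ x ∂volOn D, ‖w x‖ ≤ M) →
      truncL a M₁ w = ((a : ℂ) ^ 2) • truncL 1 M w := fun w hw =>
    truncL_eq_smul ha0.le hM₁0.le hM0.le (by
      filter_upwards [hw] with x hx
      have : a * ‖w x‖ ≤ a * M := by gcongr
      linarith) hw
  have hN3 : ∀ w : L2 D, (∀ᵐ x ∂volOn D, ‖w x‖ ≤ M) → ‖w‖ ≤ V → ‖truncL a M₁ w‖ ≤ n₀ * a ^ 2 := by
    intro w hw hwV
    rw [hN2 w hw, norm_smul, norm_pow, Complex.norm_real, Real.norm_of_nonneg ha0.le, mul_comm]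
    refine mul_le_mul_of_nonneg_right ((norm_truncL_le 1 M w).trans ?_) (by positivity)
    exact mul_le_mul_of_nonneg_left hwV (by positivity)
  have h00 : ‖(0 : ℂ)‖ ≤ r := by simpa using hr0.le
  have hφ : bifResidual R (coupling D τ ω R) 0 φ 0 = 0 := by
    rw [bifResidual, hnear.sol]; simp
  have hz : ∀ w : L2 D, ‖(0 : L2 D)‖ ≤ η₀ * ‖w‖ := fun w => by rw [norm_zero]; positivity
  obtain ⟨-, hφV, hφM⟩ := hbd 0 φ 0 h00 (hz φ) hφ rfl
  -- the branch
  obtain ⟨s, w, hsr, hwα, hw⟩ := hE (truncL a M₁) (truncL_zero a M₁) (hNlip a)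
  obtain ⟨-, hwV, hwM⟩ := hbd s w _ hsr (hNle a w) hw hwα
  -- Comparison with the linear solution `(0, φ)`, which solves the equation with `g = 0`.
  have hclose : ‖w - φ‖ + ‖s‖ ≤ C * n₀ * a ^ 2 := by
    have h := (hU s 0 w φ (truncL a M₁ w) (truncL a M₁ φ) 0 hsr h00 (hNle a w) (hz φ) (hNlip a w φ)
      hw hφ hwα rfl).1
    rw [sub_zero, sub_zero] at h
    refine h.trans ?_
    rw [mul_assoc]
    exact mul_le_mul_of_nonneg_left (hN3 φ hφM hφV) hC0.le
  have hs1 : ‖s‖ ≤ C * n₀ * a ^ 2 := by linarith [norm_nonneg (w - φ)]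
  have hd1 : ‖w - φ‖ ≤ C * n₀ * a ^ 2 := by linarith [norm_nonneg s]
  have hs4 : ‖s‖ ≤ 1 / 4 := hsr.trans hr4
  have ha0' : (a : ℂ) ≠ 0 := by exact_mod_cast ha0.ne'
  have hna : ‖(a : ℂ)‖ = a := by rw [Complex.norm_real, Real.norm_of_nonneg ha0.le]
  have hw0 : w ≠ 0 := fun h => hα0 (by rw [← hwα, h, map_zero])
  have hwa : ∀ᵐ x ∂volOn D, ‖(a : ℂ)‖ * ‖w x‖ ≤ M₁ := by
    filter_upwards [hwM] with x hx
    have : a * ‖w x‖ ≤ a * M := by gcongr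
    rw [hna]; linarith
  have hfreq : ω * (1 + s) - ω = s * ω := by ring
  refine ⟨ω * (1 + s), (a : ℂ) • w, ⟨?_, ?_, ?_⟩, ?_, ?_, ?_, ?_⟩
  · refine (isResonantState_smul_iff hd hω hs4 ha0' hM₁0.le hwa).2 ⟨hw0, ?_⟩
    rw [hna]
    exact (bifResidual_coupling_iff hR).1 hw
  · rw [hfreq, norm_mul]
    exact mul_le_mul_of_nonneg_right (hs1.trans haC) (norm_nonneg ω)
  · rw [eLpNorm_exponent_top]
    refine eLpNormEssSup_le_of_ae_bound ?_
    filter_upwards [hwM, Lp.coeFn_smul (a : ℂ) w] with x hx hx'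
    rw [hx', Pi.smul_apply, norm_smul, hna]
    exact (mul_le_mul_of_nonneg_left hx ha0.le).trans haM
  · rw [map_smul, hwα, smul_eq_mul]
  · -- uniqueness
    intro ω₂ u₂ hu₂ hor
    have hωne : ω ≠ 0 := by simpa using hω.ne_zero (s := 0) (by simp)
    obtain ⟨s₂, rfl⟩ : ∃ s₂, ω₂ = ω * (1 + s₂) := ⟨ω₂ / ω - 1, by field_simp; ring⟩
    have hs₂ρ : ‖s₂‖ ≤ ρ := by
      have h := hu₂.freq_near
      rw [show ω * (1 + s₂) - ω = s₂ * ω by ring, norm_mul] at h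
      exact le_of_mul_le_mul_right h (norm_pos_iff.2 hωne)
    have hs₂4 : ‖s₂‖ ≤ 1 / 4 := (hs₂ρ.trans hρr).trans hr4
    have hu₂ρ : ∀ᵐ x ∂volOn D, ‖u₂ x‖ ≤ M₁ := by
      have h := hu₂.state_small
      rw [eLpNorm_exponent_top, eLpNormEssSup] at h
      filter_upwards [ENNReal.ae_le_essSup (fun x => ‖u₂ x‖ₑ)] with x hx
      have h1 := hx.trans h
      rw [← ofReal_norm, ENNReal.ofReal_le_ofReal_iff hρ0.le] at h1
      exact h1.trans hρM
    -- The complex amplitude of the competitor; dividing by it normalizes the competitor in the same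
    -- way as `w`.
    set β := m.l u₂ / α with hβ
    -- Solutions lie near the line of `v`: one with `l u₂ = 0` would satisfy `‖u₂‖ ≤ ‖u₂‖ / 2`.
    have hβ0 : β ≠ 0 := by
      refine div_ne_zero (fun h => ?_) hα0
      have h1 := hu₂.state
      rw [← one_smul ℂ u₂] at h1
      obtain ⟨hne, h2⟩ := (isResonantState_smul_iff hd hω hs₂4 one_ne_zero hM₁0.le
        (by simpa using hu₂ρ)).1 h1
      have h3 := (hap s₂ u₂ _ (hs₂ρ.trans hρr) (hNle _ u₂)
        ((bifResidual_coupling_iff hR).2 h2)).1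
      rw [h, zero_smul, sub_zero] at h3
      exact hne (norm_le_zero_iff.1 (by linarith))
    set w₂ := β⁻¹ • u₂ with hw₂
    have huw : u₂ = β • w₂ := by rw [hw₂, smul_inv_smul₀ hβ0]
    have hw₂α : m.l w₂ = α := by
      have hl : m.l u₂ = β * α := by rw [hβ, div_mul_cancel₀ _ hα0]
      rw [hw₂, map_smul, hl, smul_eq_mul, inv_mul_cancel_left₀ hβ0]
    have hw₂b : ∀ᵐ x ∂volOn D, ‖β‖ * ‖w₂ x‖ ≤ M₁ := by
      have h := Lp.coeFn_smul β w₂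
      rw [← huw] at h
      filter_upwards [h, hu₂ρ] with x h1 h2
      rwa [h1, Pi.smul_apply, norm_smul] at h2
    have hres₂ : bifResidual R (coupling D τ ω R) s₂ w₂ (truncL ‖β‖ M₁ w₂) = 0 := by
      have h1 := hu₂.state
      rw [huw] at h1
      exact (bifResidual_coupling_iff hR).2
        ((isResonantState_smul_iff hd hω hs₂4 hβ0 hM₁0.le hw₂b).1 h1).2
    obtain ⟨hw₂ε, hw₂V, hw₂M⟩ := hbd s₂ w₂ _ (hs₂ρ.trans hρr) (hNle _ w₂) hres₂ hw₂α
    have hkey := hU s s₂ w w₂ (truncL a M₁ w) (truncL a M₁ w₂) (truncL ‖β‖ M₁ w₂) hsr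
      (hs₂ρ.trans hρr) (hNle a w) (hNle _ w₂) (hNlip a w w₂) hw hres₂ hwα hw₂α
    -- If the frequencies agree and `a ≠ ‖β‖`, the cubic terms differ by `a² - ‖β‖²` times that of
    -- `w₂`, and the first order formula makes `l` of the latter small. But it is close to `l` of
    -- the cubic term of `v`, which has modulus `γ > 0`.
    have hβa : ‖β‖ = a := by
      rcases hor with h | h
      · rw [hβ, norm_div, h, mul_div_cancel_right₀ _ (norm_ne_zero_iff.2 hα0)]
      · have hss : s₂ = s := by
          have := mul_left_cancel₀ hωne h
          exact add_left_cancel this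
        have h2 := hkey.2
        have e2 : truncL ‖β‖ M₁ w₂ = ((‖β‖ : ℂ) ^ 2) • truncL 1 M w₂ :=
          truncL_eq_smul (norm_nonneg β) hM₁0.le hM0.le hw₂b hw₂M
        rw [hss, sub_self, mul_zero, zero_add, hN2 w₂ hw₂M, e2, ← sub_smul, map_smul, norm_smul,
          norm_smul] at h2
        by_contra hne
        have hpos : 0 < ‖(a : ℂ) ^ 2 - (‖β‖ : ℂ) ^ 2‖ := by
          rw [norm_pos_iff, sub_ne_zero]
          intro h3
          have h4 : a ^ 2 = ‖β‖ ^ 2 := by exact_mod_cast h3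
          exact hne ((pow_left_inj₀ (norm_nonneg β) ha0.le two_ne_zero).1 h4.symm)
        have h3 : ‖m.l (truncL 1 M w₂)‖ ≤ ε * ‖truncL 1 M w₂‖ := by
          refine le_of_mul_le_mul_left ?_ hpos
          linarith
        have h4 : ‖truncL 1 M w₂ - truncL 1 M m.v‖ ≤ 3 * M ^ 2 * ε :=
          (norm_truncL_sub_le 1 M w₂ m.v).trans (by gcongr)
        have h5 : γ ≤ ‖m.l (truncL 1 M w₂)‖ + ‖m.l‖ * (3 * M ^ 2 * ε) := by
          have h6 : m.l (truncL 1 M m.v)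
              = m.l (truncL 1 M w₂) - m.l (truncL 1 M w₂ - truncL 1 M m.v) := by
            rw [map_sub]; ring
          rw [hγ, h6]
          exact (norm_sub_le _ _).trans (add_le_add_right ((m.l.le_opNorm _).trans
            (mul_le_mul_of_nonneg_left h4 (norm_nonneg _))) _)
        have h7 : ‖truncL 1 M w₂‖ ≤ ‖truncL 1 M m.v‖ + 3 * M ^ 2 := by
          have h8 := norm_le_norm_add_norm_sub' (truncL 1 M w₂) (truncL 1 M m.v)
          have h9 : 3 * M ^ 2 * ε ≤ 3 * M ^ 2 * 1 := by gcongr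
          linarith
        have h8 : ε * ‖truncL 1 M w₂‖ ≤ ε * (‖truncL 1 M m.v‖ + 3 * M ^ 2) := by gcongr
        have h9 : ε * Q = ε * (‖truncL 1 M m.v‖ + 3 * M ^ 2) + ‖m.l‖ * (3 * M ^ 2 * ε) + ε := by
          rw [hQ]; ring
        linarith
    -- With equal moduli both solutions see the same nonlinearity, so the Lipschitz estimate has
    -- right side zero; only the phase of `β` remains.
    have h1 := hkey.1
    rw [hβa, sub_self, norm_zero, mul_zero] at h1
    have hww : w = w₂ := sub_eq_zero.1 (norm_le_zero_iff.1 (by linarith [norm_nonneg (s - s₂)]))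
    have hss : s = s₂ := sub_eq_zero.1 (norm_le_zero_iff.1 (by linarith [norm_nonneg (w - w₂)]))
    refine ⟨by rw [hss], Complex.arg β, ?_⟩
    rw [huw, ← hww, smul_smul]
    congr 1
    have := Complex.norm_mul_exp_arg_mul_I β
    rw [hβa] at this
    rw [mul_comm Complex.I, mul_comm, this]
  · have htb := hasTestBound_sub hd hω hs4 ((bifResidual_coupling_iff hR).1 hw)
      ((bifResidual_coupling_iff hR).1 hφ)
    set T := Λ * c * (4 * (‖w - φ‖ + ‖truncL a M₁ w‖) + 7 * ‖s‖ * ‖φ‖) with hT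
    have hT1 : T ≤ Λ * c * (4 * (C * n₀ * a ^ 2 + n₀ * a ^ 2) + 7 * (C * n₀ * a ^ 2) * V) := by
      have := hN3 w hwM hwV
      rw [hT]; gcongr
    have e : (a : ℂ) • w - (a : ℂ) • φ = (a : ℂ) • (w - φ) := (smul_sub _ _ _).symm
    rw [e]
    refine (memH2_of_hasTestBound (by positivity) (htb.smul (a : ℂ))).2.trans
      (ENNReal.ofReal_le_ofReal ?_)
    rw [norm_smul, hna]
    have hT0 : 0 ≤ T := by positivity
    -- The difference of `a w` and `a φ` is in fact `O(a³)`; `a ≤ 1` weakens this to the claimed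
    -- order.
    have h1 : a * ‖w - φ‖ ≤ 1 * (C * n₀ * a ^ 2) := mul_le_mul ha1 hd1 (norm_nonneg _) zero_le_one
    have h2 : a * T ≤ 1 * (Λ * c * (4 * (C * n₀ * a ^ 2 + n₀ * a ^ 2) + 7 * (C * n₀ * a ^ 2) * V)) :=
      mul_le_mul ha1 hT1 hT0 zero_le_one
    rw [hK]
    linarith
  · rw [hfreq, norm_mul]
    refine mul_le_mul_of_nonneg_right (hs1.trans ?_) (norm_nonneg ω)
    have : 0 ≤ 3 * (Λ * c * (4 * (C * n₀ + n₀) + 7 * (C * n₀) * V)) := by positivity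
    refine mul_le_mul_of_nonneg_right ?_ (sq_nonneg a)
    rw [hK]
    linarith

end Branch

/-! ### Perturbation bounds for the preconditioned operators -/

section Limits

variable {D : Set Plane} [IsFiniteMeasure (volOn D)] {c Λ τ : ℝ} {ω s t : ℂ}

lemma norm_greenConst_sub_le (hω : 0 < ω.re) (hs : ‖s‖ ≤ 1 / 4) (ht : ‖t‖ ≤ 1 / 4) :
    ‖greenConst (ω * (1 + s)) - greenConst (ω * (1 + t))‖ ≤ ‖s - t‖ := by
  have h2 : ‖1 / (2 * (Real.pi : ℂ))‖ ≤ 1 / 2 := by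
    rw [norm_div, norm_mul, Complex.norm_real, Real.norm_of_nonneg Real.pi_pos.le, norm_one,
      Complex.norm_two, div_le_div_iff₀ (by positivity) two_pos]
    linarith [Real.pi_gt_three]
  rw [greenConst_mul hω hs, greenConst_mul hω ht, sub_sub_sub_cancel_left, ← mul_sub, norm_mul,
    norm_sub_rev]
  calc _ ≤ 1 / 2 * (2 * ‖s - t‖) :=
        mul_le_mul h2 (norm_log_sub_le hs ht) (norm_nonneg _) (by norm_num)
    _ = _ := by ring

variable (hd : IsDomain2 D c) (hω : IsLowFreq Λ τ ω)
include hd hω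

lemma norm_regL_opNorm_le (hs : ‖s‖ ≤ 1 / 4) : ‖regL D (ω * (1 + s))‖ ≤ sqrtArea D * (2 * c) := by
  have := hd.pos
  refine ContinuousLinearMap.opNorm_le_bound _ (mul_nonneg sqrtArea_nonneg (by positivity)) fun f => ?_
  exact (norm_regL_le hd hω hs f).trans (le_of_eq (by ring))

lemma norm_convL_rem_le (hs : ‖s‖ ≤ 1 / 4) :
    ‖convL D (remKernel (ω * (1 + s)))‖ ≤ sqrtArea D * c * remSize ω :=
  (norm_convL_le hd.meas (hd.rem ω hω.re_pos hω.norm_le s s hs hs).1.toIsKernel).trans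
    (le_of_eq (by ring))

lemma norm_regL_sub_le (hs : ‖s‖ ≤ 1 / 4) (ht : ‖t‖ ≤ 1 / 4) :
    ‖regL D (ω * (1 + s)) - regL D (ω * (1 + t))‖ ≤ sqrtArea D * c * remSize ω * ‖s - t‖ := by
  have e : regL D (ω * (1 + s)) - regL D (ω * (1 + t))
      = convL D (fun x => remKernel (ω * (1 + s)) x - remKernel (ω * (1 + t)) x) := by
    rw [convL_sub hd.meas (hd.rem_kernel hω hs).toIsKernel (hd.rem_kernel hω ht).toIsKernel, regL, regL]
    abel
  rw [e]
  exact (norm_convL_le hd.meas (hd.rem ω hω.re_pos hω.norm_le s t hs ht).2.toIsKernel).trans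
    (le_of_eq (by ring))

lemma coupling_eq (R : L2 D →L[ℂ] L2 D) (hs : ‖s‖ ≤ 1 / 4) :
    coupling D τ ω R s = (((τ : ℂ) * ω ^ 2) • R) ∘L
      ((area D * greenConst (ω * (1 + s))) • meanL D + regL D (ω * (1 + s))) := by
  rw [coupling, convL_greenKernel hd.meas hd.area_pos hd.newton.toIsKernel
    (hd.rem_kernel hω hs).toIsKernel, ContinuousLinearMap.smul_comp]

/-- In the difference the divergent value of `greenConst` and the Newtonian part both drop out,
leaving a bounded logarithmic change in the mean direction and the remainders. -/
lemma coupling_sub_eq (R : L2 D →L[ℂ] L2 D) (hs : ‖s‖ ≤ 1 / 4) (ht : ‖t‖ ≤ 1 / 4) :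
    coupling D τ ω R s - coupling D τ ω R t = (((τ : ℂ) * ω ^ 2) • R) ∘L
      ((area D * (greenConst (ω * (1 + s)) - greenConst (ω * (1 + t)))) • meanL D
        + (regL D (ω * (1 + s)) - regL D (ω * (1 + t)))) := by
  rw [coupling_eq hd hω R hs, coupling_eq hd hω R ht, ← ContinuousLinearMap.comp_sub, mul_sub, sub_smul]
  congr 1
  abel

lemma norm_meanSum_le (hs : ‖s‖ ≤ 1 / 4) (ht : ‖t‖ ≤ 1 / 4) :
    ‖(area D * (greenConst (ω * (1 + s)) - greenConst (ω * (1 + t)))) • meanL D‖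
      ≤ area D * ‖meanL D‖ * ‖s - t‖ := by
  rw [norm_smul, norm_mul, Complex.norm_real, Real.norm_of_nonneg hd.area_pos.le]
  calc _ ≤ area D * ‖s - t‖ * ‖meanL D‖ := by
        have := hd.area_pos
        gcongr
        exact norm_greenConst_sub_le hω.re_pos hs ht
    _ = _ := by ring

omit hd in
-- Closeness `η / 2` at `s = 0` and the Lipschitz bound on `‖s‖ ≤ 1/4`, worth at most `η / 4`, give
-- closeness `η` for all `s`.
lemma isLinearData_of_bounds {m : BifModel (L2 D)} {η : ℝ} {φ : L2 D} {R : L2 D →L[ℂ] L2 D}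
    (hR : Function.Injective R) (h1 : ‖R - m.R‖ ≤ η) (h2 : ‖coupling D τ ω R 0 - m.S‖ ≤ η / 2)
    (h3 : ∀ s t : ℂ, ‖s‖ ≤ 1 / 4 → ‖t‖ ≤ 1 / 4 →
      ‖coupling D τ ω R s - coupling D τ ω R t‖ ≤ η * ‖s - t‖)
    (h4 : φ = ((τ : ℂ) * ω ^ 2) • convL D (greenKernel ω) φ) (h5 : ‖φ - m.v‖ ≤ η) :
    IsLinearData m η Λ τ ω φ where
  low := hω
  near := by
    refine ⟨R, hR, h1, fun s hs => ?_, h3, ?_, h5⟩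
    · have h := h3 s 0 hs (by simp)
      rw [sub_zero] at h
      have hη : 0 ≤ η := (norm_nonneg _).trans h1
      have e : coupling D τ ω R s - m.S
          = (coupling D τ ω R s - coupling D τ ω R 0) + (coupling D τ ω R 0 - m.S) := by abel
      rw [e]
      refine (norm_add_le_of_le h h2).trans ?_
      have : η * ‖s‖ ≤ η * (1 / 4) := by gcongr
      linarith
    · conv_lhs => rw [h4]
      rw [coupling, add_zero, mul_one, smul_apply, ContinuousLinearMap.comp_apply, map_smul]

end Limits

/-! ### Case (I): almost constant states -/

section ConstantModel

variable {D : Set Plane} [IsFiniteMeasure (volOn D)] {c : ℝ}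

lemma inner_oneL_meanL (hA : 0 < area D) (f : L2 D) :
    inner ℂ (oneL D) (meanL D f) = inner ℂ (oneL D) f := by
  rw [← inner_meanL, meanL_oneL hA]

/-- The limit model for the resonance with an almost constant state. -/
def constModel (hA : 0 < area D) : BifModel (L2 D) where
  R := ContinuousLinearMap.id ℂ (L2 D)
  S := meanL D
  v := oneL D
  l := (area D : ℂ)⁻¹ • innerSL ℂ (oneL D)
  l' := (area D : ℂ)⁻¹ • innerSL ℂ (oneL D)
  -- Here `v ⊗ l` is the mean projection `P` itself, so the bordered operator is `1 - P + P`.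
  A := ContinuousLinearEquiv.refl ℂ (L2 D)
  A_apply x := by
    rw [meanL_apply]
    simp
  R_v := rfl
  S_v := meanL_oneL hA
  l_v := by
    rw [smul_apply, innerSL_apply_apply, inner_oneL_self, smul_eq_mul,
      inv_mul_cancel₀ (by exact_mod_cast hA.ne')]
  l'_sub x := by
    rw [smul_apply, innerSL_apply_apply, inner_sub_right, inner_oneL_meanL hA]
    simp
  l'_S x := by
    rw [smul_apply, smul_apply, innerSL_apply_apply, innerSL_apply_apply, inner_oneL_meanL hA]

/-- Convergence to the model with an almost constant state. -/
theorem eventually_isLinearData_const (hd : IsDomain2 D c) {ω : ℝ → ℂ} {φ : ℝ → L2 D} {Λ : ℝ}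
    (hlow : ∀ᶠ τ in atTop, IsLowFreq Λ τ (ω τ))
    (h1 : Tendsto (fun τ : ℝ => (τ : ℂ) * ω τ ^ 2) atTop (nhds 0))
    (h2 : Tendsto (fun τ : ℝ => (τ : ℂ) * ω τ ^ 2 * (area D * greenConst (ω τ))) atTop (nhds 1))
    (hφ : Tendsto φ atTop (nhds (oneL D)))
    (hsol : ∀ᶠ τ : ℝ in atTop, φ τ = ((τ : ℂ) * ω τ ^ 2) • convL D (greenKernel (ω τ)) (φ τ))
    {η : ℝ} (hη : 0 < η) :
    ∀ᶠ τ in atTop, IsLinearData (constModel hd.area_pos) η Λ τ (ω τ) (φ τ) := by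
  have hc := hd.pos
  have hA := hd.area_pos
  -- The mean part tends to `P`, while the regular part, and below all variation in `s`, is bounded
  -- and multiplied by `τ ω² → 0`.
  have t1 : Tendsto (fun τ : ℝ => ‖(τ : ℂ) * ω τ ^ 2 * (area D * greenConst (ω τ)) - 1‖ * ‖meanL D‖
      + ‖(τ : ℂ) * ω τ ^ 2‖ * (sqrtArea D * (2 * c))) atTop (nhds 0) := by
    have := ((h2.sub_const 1).norm.mul_const ‖meanL D‖).add (h1.norm.mul_const (sqrtArea D * (2 * c)))
    simpa using this
  have t2 : Tendsto (fun τ : ℝ => ‖(τ : ℂ) * ω τ ^ 2‖ * (area D * ‖meanL D‖ + sqrtArea D * c)) atTop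
      (nhds 0) := by
    have := h1.norm.mul_const (area D * ‖meanL D‖ + sqrtArea D * c)
    simpa using this
  have t3 : Tendsto (fun τ : ℝ => ‖φ τ - oneL D‖) atTop (nhds 0) := by
    simpa using (hφ.sub_const (oneL D)).norm
  filter_upwards [hlow, hsol, t1.eventually (ge_mem_nhds (half_pos hη)), t2.eventually (ge_mem_nhds hη),
    t3.eventually (ge_mem_nhds hη)] with τ hω hs e1 e2 e3
  have h0 : ‖(0 : ℂ)‖ ≤ 1 / 4 := by simp
  refine isLinearData_of_bounds hω (R := ContinuousLinearMap.id ℂ (L2 D)) Function.injective_id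
    (by rw [constModel, sub_self, norm_zero]; exact hη.le) ?_ (fun s t hs ht => ?_) hs e3
  · have e : coupling D τ (ω τ) (ContinuousLinearMap.id ℂ (L2 D)) 0 - meanL D
        = ((τ : ℂ) * ω τ ^ 2 * (area D * greenConst (ω τ)) - 1) • meanL D
          + ((τ : ℂ) * ω τ ^ 2) • regL D (ω τ * (1 + 0)) := by
      rw [coupling_eq hd hω _ h0, ContinuousLinearMap.smul_comp, ContinuousLinearMap.id_comp, smul_add,
        smul_smul, sub_smul, one_smul, add_zero, mul_one]
      abel
    change ‖coupling D τ (ω τ) (ContinuousLinearMap.id ℂ (L2 D)) 0 - meanL D‖ ≤ η / 2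
    rw [e]
    refine le_trans ?_ e1
    refine norm_add_le_of_le (norm_smul _ _).le ?_
    rw [norm_smul]
    exact mul_le_mul_of_nonneg_left (norm_regL_opNorm_le hd hω h0) (norm_nonneg _)
  · rw [coupling_sub_eq hd hω _ hs ht, ContinuousLinearMap.smul_comp, ContinuousLinearMap.id_comp, norm_smul]
    refine le_trans ?_ (mul_le_mul_of_nonneg_right e2 (norm_nonneg (s - t)))
    rw [mul_assoc]
    refine mul_le_mul_of_nonneg_left ?_ (norm_nonneg _)
    rw [add_mul]
    refine norm_add_le_of_le (norm_meanSum_le hd hω hs ht) ((norm_regL_sub_le hd hω hs ht).trans ?_)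
    have : sqrtArea D * c * remSize (ω τ) ≤ sqrtArea D * c * 1 :=
      mul_le_mul_of_nonneg_left hω.rem_le (mul_nonneg sqrtArea_nonneg hc.le)
    rw [mul_one] at this
    gcongr

end ConstantModel

/-! ### Case (II): states of mean zero -/

section EigenModel

variable {D : Set Plane} [IsFiniteMeasure (volOn D)] {c : ℝ}

/-- The Newtonian potential, projected to the functions of mean zero. -/
def projNewtonL (D : Set Plane) [IsFiniteMeasure (volOn D)] : L2 D →L[ℂ] L2 D :=
  (ContinuousLinearMap.id ℂ (L2 D) - meanL D) ∘L convL D newtonKernel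

lemma projNewtonL_apply (f : L2 D) :
    projNewtonL D f = convL D newtonKernel f - meanL D (convL D newtonKernel f) := rfl

/-- A simple eigenpair of the projected Newtonian potential, in `L²(D)`. -/
structure IsEigenL (D : Set Plane) [IsFiniteMeasure (volOn D)] (μ : ℝ) (v : L2 D) : Prop where
  pos : 0 < μ
  mean : meanL D v = 0
  eigen : projNewtonL D v = (μ : ℂ) • v
  inner_self : inner ℂ v v = (1 : ℂ)
  simple : ∀ w : L2 D, meanL D w = 0 → projNewtonL D w = (μ : ℂ) • w → ∃ a : ℂ, w = a • v

lemma projNewtonPotential_ae (hd : IsDomain2 D c) {f : Plane → ℂ} {g : L2 D} (hf : f =ᵐ[volOn D] g) :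
    projNewtonPotential D f =ᵐ[volOn D] projNewtonL D g := by
  have hc : newtonPotential D f = convF D newtonKernel g := convF_congr (k := newtonKernel) hf
  have hK := convL_ae hd.meas hd.newton.toIsKernel g
  set F := convL D newtonKernel g with hF
  have h1 : innerOn D (oneOn D) (newtonPotential D f) = (area D : ℂ)⁻¹ * inner ℂ (oneL D) F := by
    rw [inner_oneL, ← integral_const_mul, innerOn]
    refine integral_congr_ae ?_
    filter_upwards [hK] with x hx
    rw [hc, hx, oneOn, Complex.conj_ofReal, area, one_div, Complex.ofReal_inv]
  rw [projNewtonL_apply, ← hF, meanL_apply]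
  filter_upwards [hK, Lp.coeFn_sub F (((area D : ℂ)⁻¹ * inner ℂ (oneL D) F) • oneL D),
    Lp.coeFn_smul ((area D : ℂ)⁻¹ * inner ℂ (oneL D) F) (oneL D), oneL_ae (D := D)] with x e1 e2 e3 e4
  rw [e2, Pi.sub_apply, e3, Pi.smul_apply, e4, smul_eq_mul, mul_one, projNewtonPotential, h1, hc, e1]

lemma meanL_eq_zero_iff (hA : 0 < area D) {f : Plane → ℂ} {g : L2 D} (hf : f =ᵐ[volOn D] g) :
    meanL D g = 0 ↔ ∫ x in D, f x = 0 := by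
  have h1 : oneL D ≠ 0 := norm_pos_iff.1 (sqrtArea_pos hA)
  rw [meanL_apply, inner_oneL, ← integral_congr_ae hf, smul_eq_zero, or_iff_left h1, mul_eq_zero,
    or_iff_right (inv_ne_zero (by exact_mod_cast hA.ne'))]

lemma isMeanZeroEigen_iff (hd : IsDomain2 D c) {μ : ℝ} {f : Plane → ℂ} {g : L2 D}
    (hf : f =ᵐ[volOn D] g) :
    IsMeanZeroEigen D μ f ↔ meanL D g = 0 ∧ projNewtonL D g = (μ : ℂ) • g := by
  have h1 := projNewtonPotential_ae hd hf
  have h2 := Lp.coeFn_smul (μ : ℂ) g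
  rw [meanL_eq_zero_iff hd.area_pos hf]
  constructor
  · rintro ⟨-, h, h'⟩
    refine ⟨h, Lp.ext ?_⟩
    filter_upwards [h1, h2, h', hf] with x e1 e2 e3 e4
    rw [← e1, e3, e2, Pi.smul_apply, smul_eq_mul, e4]
  · rintro ⟨h, h'⟩
    rw [h'] at h1
    refine ⟨(Lp.memLp g).ae_eq hf.symm, h, ?_⟩
    filter_upwards [h1, h2, hf] with x e1 e2 e4
    rw [e1, e2, Pi.smul_apply, smul_eq_mul, e4]

lemma IsSimpleEigenpair.isEigenL (hd : IsDomain2 D c) {μ : ℝ} {v : Plane → ℂ} (hμ : 0 < μ)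
    (h : IsSimpleEigenpair D μ v) : IsEigenL D μ (h.eigen.memLp.toLp v) := by
  have hv := h.eigen.memLp.coeFn_toLp
  obtain ⟨h1, h2⟩ := (isMeanZeroEigen_iff hd hv.symm).1 h.eigen
  refine ⟨hμ, h1, h2, ?_, fun w hw hw' => ?_⟩
  · rw [inner_self_eq_norm_sq_to_K, Lp.norm_toLp, h.norm_eq_one]
    simp
  · obtain ⟨a, ha⟩ := h.simple w ((isMeanZeroEigen_iff hd (EventuallyEq.refl _ _)).2 ⟨hw, hw'⟩)
    refine ⟨a, Lp.ext ?_⟩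
    filter_upwards [ha, Lp.coeFn_smul a (h.eigen.memLp.toLp v), hv] with x e1 e2 e3
    rw [e1, e2, Pi.smul_apply, smul_eq_mul, e3]

lemma inner_newtonL (hd : IsDomain2 D c) (f g : L2 D) :
    inner ℂ (convL D newtonKernel f) g = inner ℂ f (convL D newtonKernel g) :=
  inner_convL hd.meas hd.newton.toIsKernel (fun x => Complex.conj_ofReal _)
    (fun x => by simp [newtonKernel]) f g

lemma inner_projNewtonL (hd : IsDomain2 D c) (f g : L2 D) :
    inner ℂ f (projNewtonL D g) = inner ℂ (convL D newtonKernel (f - meanL D f)) g := by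
  rw [projNewtonL_apply, inner_newtonL hd, inner_sub_right, inner_sub_left, inner_meanL]

variable {μ : ℝ} {v : L2 D} (hd : IsDomain2 D c) (hv : IsEigenL D μ v)
include hd hv

/-- Injectivity of the bordered operator. Projecting shows that `x` has mean zero; pairing with `v`,
by symmetry of the Newtonian potential, gives `⟨v, x⟩ = 0`; then `x` is an eigenfunction, so by
simplicity a multiple of `v`, to which it is orthogonal. -/
lemma IsEigenL.eq_zero {x : L2 D}
    (hx : x = (μ : ℂ)⁻¹ • projNewtonL D x - (inner ℂ v x : ℂ) • v) : x = 0 := by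
  have hμ : (μ : ℂ) ≠ 0 := by exact_mod_cast hv.pos.ne'
  have hP : meanL D x = 0 := by
    rw [hx, map_sub, map_smul, map_smul, hv.mean, projNewtonL_apply, map_sub, meanL_meanL hd.area_pos]
    simp
  have h1 : inner ℂ v (projNewtonL D x) = μ * inner ℂ v x := by
    have e : convL D newtonKernel v = (μ : ℂ) • v + meanL D (convL D newtonKernel v) := by
      rw [← hv.eigen, projNewtonL_apply, sub_add_cancel]
    rw [inner_projNewtonL hd, hv.mean, sub_zero, e, inner_add_left, inner_meanL, hP, inner_zero_right,
      add_zero, inner_smul_left, Complex.conj_ofReal]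
  have hl : inner ℂ v x = (0 : ℂ) := by
    have h2 : inner ℂ v x = inner ℂ v ((μ : ℂ)⁻¹ • projNewtonL D x - (inner ℂ v x : ℂ) • v) :=
      congrArg (fun y => inner ℂ v y) hx
    rw [inner_sub_right, inner_smul_right, inner_smul_right, h1, hv.inner_self,
      inv_mul_cancel_left₀ hμ, mul_one, sub_self] at h2
    exact h2
  rw [hl, zero_smul, sub_zero] at hx
  obtain ⟨a, ha⟩ := hv.simple x hP (by
    conv_rhs => rw [hx]
    rw [smul_inv_smul₀ hμ])
  have h3 : a = 0 := by
    have := hl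
    rw [ha, inner_smul_right, hv.inner_self, mul_one] at this
    exact this
  rw [ha, h3, zero_smul]

/-- Fredholm alternative: the bordered operator is the identity minus a compact operator, and is
injective by `IsEigenL.eq_zero`. -/
lemma IsEigenL.exists_equiv : ∃ A : L2 D ≃L[ℂ] L2 D, ∀ x,
    A x = x - ((μ : ℂ)⁻¹ • projNewtonL D x - (inner ℂ v x : ℂ) • v) := by
  set T : L2 D →L[ℂ] L2 D := (μ : ℂ)⁻¹ • projNewtonL D - (innerSL ℂ v).smulRight v with hT
  have hTx : ∀ x, T x = (μ : ℂ)⁻¹ • projNewtonL D x - (inner ℂ v x : ℂ) • v := fun x => by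
    simp [hT]
  have hcomp : IsCompactOperator T := by
    have h1 : IsCompactOperator (projNewtonL D) :=
      hd.compact.clm_comp (ContinuousLinearMap.id ℂ (L2 D) - meanL D)
    have h2 : IsCompactOperator ((innerSL ℂ v).smulRight v) :=
      (isCompactOperator_of_locallyCompactSpace_rng
        (ContinuousLinearMap.toSpanSingleton ℂ v)).comp_clm (innerSL ℂ v)
    exact (h1.smul (μ : ℂ)⁻¹).sub h2
  rcases hcomp.hasEigenvalue_or_mem_resolventSet (one_ne_zero (α := ℂ)) with h | h
  · obtain ⟨x, hx⟩ := h.exists_hasEigenvector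
    have h1 : T x = x := by simpa using hx.apply_eq_smul
    exact absurd (hv.eq_zero hd (x := x) (by rw [← hTx, h1])) hx.2
  · obtain ⟨u, hu⟩ := h
    refine ⟨ContinuousLinearEquiv.ofUnit u, fun x => ?_⟩
    have : (ContinuousLinearEquiv.ofUnit u) x = (u : L2 D →L[ℂ] L2 D) x := rfl
    rw [this, hu, map_one, sub_apply, hTx]
    rfl

omit hd in
lemma IsEigenL.smul_newtonL : v = (μ : ℂ)⁻¹ • convL D newtonKernel v
    - meanL D ((μ : ℂ)⁻¹ • convL D newtonKernel v) := by
  have hμ : (μ : ℂ) ≠ 0 := by exact_mod_cast hv.pos.ne'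
  rw [map_smul, ← smul_sub, ← projNewtonL_apply, hv.eigen, inv_smul_smul₀ hμ]

/-- With `Q` the projection to mean zero and `N` the Newtonian potential, `R - S = 1 - μ⁻¹ Q N`. Its
adjoint `1 - μ⁻¹ N Q` annihilates `μ⁻¹ N v`, because `μ⁻¹ Q N v = v`. -/
lemma IsEigenL.inner_newtonL_sub (x : L2 D) :
    innerSL ℂ ((μ : ℂ)⁻¹ • convL D newtonKernel v)
      ((ContinuousLinearMap.id ℂ (L2 D) - meanL D) x
        - ((μ : ℂ)⁻¹ • projNewtonL D - meanL D) x) = 0 := by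
  have e : (ContinuousLinearMap.id ℂ (L2 D) - meanL D) x
      - ((μ : ℂ)⁻¹ • projNewtonL D - meanL D) x = x - (μ : ℂ)⁻¹ • projNewtonL D x := by
    simp only [sub_apply, smul_apply, ContinuousLinearMap.id_apply]; abel
  rw [e, innerSL_apply_apply, inner_sub_right, inner_smul_right, inner_projNewtonL hd,
    ← hv.smul_newtonL, inner_smul_left, map_inv₀, Complex.conj_ofReal, sub_self]

/-- The limit model for the resonances with a state of mean zero. -/
def eigenModel : BifModel (L2 D) where
  R := ContinuousLinearMap.id ℂ (L2 D) - meanL D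
  S := (μ : ℂ)⁻¹ • projNewtonL D - meanL D
  v := v
  l := innerSL ℂ v
  -- `R - S` need not be symmetric, so the cokernel is represented not by `v` but by `μ⁻¹ N v`,
  -- which differs from `v` by its mean.
  l' := innerSL ℂ ((μ : ℂ)⁻¹ • convL D newtonKernel v)
  A := (hv.exists_equiv hd).choose
  A_apply x := by
    rw [(hv.exists_equiv hd).choose_spec x]
    simp only [sub_apply, smul_apply, ContinuousLinearMap.id_apply, innerSL_apply_apply]
    abel
  R_v := by simp [hv.mean]
  S_v := by
    have hμ : (μ : ℂ) ≠ 0 := by exact_mod_cast hv.pos.ne'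
    rw [sub_apply, smul_apply, hv.eigen, hv.mean, inv_smul_smul₀ hμ, sub_zero]
  l_v := by rw [innerSL_apply_apply, hv.inner_self]
  l'_sub := hv.inner_newtonL_sub hd
  l'_S x := by
    have h := hv.inner_newtonL_sub hd x
    rw [map_sub, sub_eq_zero] at h
    rw [← h, innerSL_apply_apply, innerSL_apply_apply, sub_apply, ContinuousLinearMap.id_apply,
      inner_sub_right, ← inner_meanL, ← inner_sub_left, ← hv.smul_newtonL]

/-- Convergence to the model with a state of mean zero. -/
theorem eventually_isLinearData_eigen {ω : ℝ → ℂ} {φ : ℝ → L2 D} {Λ : ℝ}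
    (hlow : ∀ᶠ τ in atTop, IsLowFreq Λ τ (ω τ))
    (h1 : Tendsto (fun τ : ℝ => (τ : ℂ) * ω τ ^ 2) atTop (nhds (μ : ℂ)⁻¹))
    (h2 : Tendsto (fun τ : ℝ => (area D * greenConst (ω τ))⁻¹) atTop (nhds 0))
    (hne : ∀ᶠ τ in atTop, greenConst (ω τ) ≠ 0)
    (hrem : Tendsto (fun τ : ℝ => remSize (ω τ)) atTop (nhds 0))
    (hφ : Tendsto φ atTop (nhds v))
    (hsol : ∀ᶠ τ : ℝ in atTop, φ τ = ((τ : ℂ) * ω τ ^ 2) • convL D (greenKernel (ω τ)) (φ τ))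
    {η : ℝ} (hη : 0 < η) :
    ∀ᶠ τ in atTop, IsLinearData (eigenModel hd hv) η Λ τ (ω τ) (φ τ) := by
  have hc := hd.pos
  have hA := hd.area_pos
  have hμ : (μ : ℂ) ≠ 0 := by exact_mod_cast hv.pos.ne'
  set P := meanL D with hP
  set Q := ContinuousLinearMap.id ℂ (L2 D) - P with hQ
  have hPP : P ∘L P = P := by ext1 f; exact meanL_meanL hA f
  have hQP : Q ∘L P = 0 := by rw [hQ, ContinuousLinearMap.sub_comp, hPP, ContinuousLinearMap.id_comp, sub_self]
  have hlam0 : ∀ᶠ τ : ℝ in atTop, (τ : ℂ) * ω τ ^ 2 ≠ 0 := h1.eventually_ne (inv_ne_zero hμ)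
  have hinv : Tendsto (fun τ : ℝ => ((τ : ℂ) * ω τ ^ 2)⁻¹) atTop (nhds (μ : ℂ)) := by
    simpa using h1.inv₀ (inv_ne_zero hμ)
  have t0 : Tendsto (fun τ : ℝ => ‖((τ : ℂ) * ω τ ^ 2)⁻¹ * (area D * greenConst (ω τ))⁻¹‖ * ‖P‖) atTop
      (nhds 0) := by
    simpa using (hinv.mul h2).norm.mul_const ‖P‖
  have t1 : Tendsto (fun τ : ℝ => ‖(τ : ℂ) * ω τ ^ 2 - (μ : ℂ)⁻¹‖ * ‖projNewtonL D‖
      + (‖(τ : ℂ) * ω τ ^ 2‖ * (‖Q‖ * (sqrtArea D * c * remSize (ω τ)))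
      + ‖(area D * greenConst (ω τ))⁻¹‖ * (‖P‖ * (sqrtArea D * (2 * c))))) atTop (nhds 0) := by
    have := ((h1.sub_const (μ : ℂ)⁻¹).norm.mul_const ‖projNewtonL D‖).add
      ((h1.norm.mul ((hrem.const_mul (sqrtArea D * c)).const_mul ‖Q‖)).add
        (h2.norm.mul_const (‖P‖ * (sqrtArea D * (2 * c)))))
    simpa using this
  have t2 : Tendsto (fun τ : ℝ => ‖(area D * greenConst (ω τ))⁻¹‖ * (area D * ‖P‖)
      + (‖(τ : ℂ) * ω τ ^ 2‖ * (‖Q‖ * (sqrtArea D * c * remSize (ω τ)))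
      + ‖(area D * greenConst (ω τ))⁻¹‖ * (‖P‖ * (sqrtArea D * c)))) atTop (nhds 0) := by
    have := (h2.norm.mul_const (area D * ‖P‖)).add
      ((h1.norm.mul ((hrem.const_mul (sqrtArea D * c)).const_mul ‖Q‖)).add
        (h2.norm.mul_const (‖P‖ * (sqrtArea D * c))))
    simpa using this
  have t3 : Tendsto (fun τ : ℝ => ‖φ τ - v‖) atTop (nhds 0) := by
    simpa using (hφ.sub_const v).norm
  filter_upwards [hlow, hsol, hne, hlam0, t0.eventually (ge_mem_nhds hη),
    t1.eventually (ge_mem_nhds (half_pos hη)), t2.eventually (ge_mem_nhds hη),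
    t3.eventually (ge_mem_nhds hη)] with τ hω hs hκ hlam e0 e1 e2 e3
  have h0 : ‖(0 : ℂ)‖ ≤ 1 / 4 := by simp
  set lam := (τ : ℂ) * ω τ ^ 2 with hlamdef
  set κ := (area D : ℂ) * greenConst (ω τ) with hκdef
  have hκ0 : κ ≠ 0 := mul_ne_zero (by exact_mod_cast hA.ne') hκ
  -- Chosen so that `lam R (κ P + G) = -P + lam Q G - κ⁻¹ P G`: the divergent `κ` is gone, and `R →
  -- Q` as `κ → ∞`.
  set R := Q - (lam⁻¹ * κ⁻¹) • P with hR
  have hlR : lam • R = lam • Q - κ⁻¹ • P := by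
    rw [hR, smul_sub, smul_smul, mul_inv_cancel_left₀ hlam]
  have hlRP : (lam • R) ∘L P = -(κ⁻¹ • P) := by
    rw [hlR, ContinuousLinearMap.sub_comp, ContinuousLinearMap.smul_comp, hQP,
      ContinuousLinearMap.smul_comp, hPP, smul_zero, zero_sub]
  have hinj : Function.Injective R := by
    refine (injective_iff_map_eq_zero R).2 fun x hx => ?_
    have hz : lam⁻¹ * κ⁻¹ ≠ 0 := mul_ne_zero (inv_ne_zero hlam) (inv_ne_zero hκ0)
    have h3 : x - P x - (lam⁻¹ * κ⁻¹) • P x = 0 := hx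
    have h4 := congrArg P h3
    rw [map_sub, map_sub, map_smul, map_zero, meanL_meanL hA, sub_self, zero_sub, neg_eq_zero,
      smul_eq_zero, or_iff_right hz] at h4
    rw [h4] at h3
    simpa using h3
  refine isLinearData_of_bounds hω hinj ?_ ?_ (fun s t hs ht => ?_) hs e3
  · change ‖R - Q‖ ≤ η
    rw [hR, sub_sub_cancel_left, norm_neg, norm_smul]
    exact e0
  · have e : coupling D τ (ω τ) R 0 - ((μ : ℂ)⁻¹ • projNewtonL D - P)
        = (lam - (μ : ℂ)⁻¹) • projNewtonL D + (lam • (Q ∘L convL D (remKernel (ω τ * (1 + 0))))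
          - κ⁻¹ • (P ∘L regL D (ω τ * (1 + 0)))) := by
      rw [coupling_eq hd hω R h0, ContinuousLinearMap.comp_add, ContinuousLinearMap.comp_smul, hlRP,
        hlR, ContinuousLinearMap.sub_comp, ContinuousLinearMap.smul_comp, ContinuousLinearMap.smul_comp]
      have : Q ∘L regL D (ω τ * (1 + 0))
          = projNewtonL D + Q ∘L convL D (remKernel (ω τ * (1 + 0))) := by
        rw [regL, ContinuousLinearMap.comp_add]; rfl
      have h5 : (area D : ℂ) * greenConst (ω τ * (1 + 0)) = κ := by rw [add_zero, mul_one]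
      rw [this, h5, smul_neg, smul_inv_smul₀ hκ0, smul_add, sub_smul]
      abel
    change ‖coupling D τ (ω τ) R 0 - ((μ : ℂ)⁻¹ • projNewtonL D - P)‖ ≤ η / 2
    rw [e]
    refine le_trans ?_ e1
    refine norm_add_le_of_le (norm_smul _ _).le ((norm_sub_le _ _).trans (add_le_add ?_ ?_))
    · rw [norm_smul]
      refine mul_le_mul_of_nonneg_left ((ContinuousLinearMap.opNorm_comp_le _ _).trans ?_) (norm_nonneg _)
      exact mul_le_mul_of_nonneg_left (norm_convL_rem_le hd hω h0) (norm_nonneg _)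
    · rw [norm_smul]
      refine mul_le_mul_of_nonneg_left ((ContinuousLinearMap.opNorm_comp_le _ _).trans ?_) (norm_nonneg _)
      exact mul_le_mul_of_nonneg_left (norm_regL_opNorm_le hd hω h0) (norm_nonneg _)
  · set F := regL D (ω τ * (1 + s)) - regL D (ω τ * (1 + t)) with hF
    set d := greenConst (ω τ * (1 + s)) - greenConst (ω τ * (1 + t)) with hdd
    have hF1 : ‖F‖ ≤ sqrtArea D * c * remSize (ω τ) * ‖s - t‖ := norm_regL_sub_le hd hω hs ht
    have hF2 : ‖F‖ ≤ sqrtArea D * c * ‖s - t‖ := by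
      refine hF1.trans (mul_le_mul_of_nonneg_right ?_ (norm_nonneg _))
      exact mul_le_of_le_one_right (mul_nonneg sqrtArea_nonneg hc.le) hω.rem_le
    -- Since `lam` does not tend to `0`, smallness has two sources: the terms containing `P` carry
    -- the factor `κ⁻¹`, and `Q F` is of size `remSize`.
    have e : coupling D τ (ω τ) R s - coupling D τ (ω τ) R t
        = κ⁻¹ • (-((area D * d) • P)) + (lam • (Q ∘L F) - κ⁻¹ • (P ∘L F)) := by
      rw [coupling_sub_eq hd hω R hs ht, ContinuousLinearMap.comp_add, ContinuousLinearMap.comp_smul,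
        hlRP, hlR, ContinuousLinearMap.sub_comp, ContinuousLinearMap.smul_comp,
        ContinuousLinearMap.smul_comp, smul_neg, smul_neg, smul_comm]
    rw [e]
    refine le_trans ?_ (mul_le_mul_of_nonneg_right e2 (norm_nonneg (s - t)))
    rw [add_mul, add_mul]
    refine norm_add_le_of_le ?_ ((norm_sub_le _ _).trans (add_le_add ?_ ?_))
    · rw [norm_smul, norm_neg, mul_assoc]
      exact mul_le_mul_of_nonneg_left (norm_meanSum_le hd hω hs ht) (norm_nonneg _)
    · rw [norm_smul, mul_assoc, mul_assoc]
      refine mul_le_mul_of_nonneg_left ((ContinuousLinearMap.opNorm_comp_le _ _).trans ?_) (norm_nonneg _)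
      exact mul_le_mul_of_nonneg_left hF1 (norm_nonneg _)
    · rw [norm_smul, mul_assoc, mul_assoc]
      refine mul_le_mul_of_nonneg_left ((ContinuousLinearMap.opNorm_comp_le _ _).trans ?_) (norm_nonneg _)
      exact mul_le_mul_of_nonneg_left hF2 (norm_nonneg _)

end EigenModel

/-! ### Asymptotics of frequency, coupling and Green constant -/

section Asymptotics

variable {w g : ℝ → ℝ} {ω : ℝ → ℂ}

/-- The assumed errors are of lower order than `w`. Only this consequence, `ω ~ w`, is used of the
frequency asymptotics. -/
lemma tendsto_ratio (hw : ∀ᶠ τ in atTop, 0 < w τ)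
    (h : (fun τ => ω τ - (w τ : ℂ)) =O[atTop] g) (hg : Tendsto (fun τ => g τ / w τ) atTop (nhds 0)) :
    Tendsto (fun τ => ω τ / (w τ : ℂ)) atTop (nhds 1) := by
  obtain ⟨C, hC⟩ := h.bound
  rw [tendsto_iff_norm_sub_tendsto_zero]
  have hlim : Tendsto (fun τ => C * ‖g τ / w τ‖) atTop (nhds 0) := by
    simpa using hg.norm.const_mul C
  refine tendsto_of_tendsto_of_tendsto_of_le_of_le' tendsto_const_nhds hlim
    (Eventually.of_forall fun τ => norm_nonneg _) ?_
  filter_upwards [hw, hC] with τ h1 h2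
  have h0 : (w τ : ℂ) ≠ 0 := by exact_mod_cast h1.ne'
  have e : ω τ / (w τ : ℂ) - 1 = (ω τ - w τ) / w τ := by field_simp
  rw [e, norm_div, norm_div, Complex.norm_real, mul_div_assoc']
  gcongr

/-- `log ω = log w + log (ω / w)`: the second term tends to `0`, the first is `-(1/2) log τ` to
leading order, and the factor `-1/(2π)` gives `1/(4π)`. -/
lemma tendsto_greenConst (hw : ∀ᶠ τ in atTop, 0 < w τ)
    (hr : Tendsto (fun τ => ω τ / (w τ : ℂ)) atTop (nhds 1))
    (hlog : Tendsto (fun τ => Real.log (w τ) / Real.log τ) atTop (nhds (-(1 / 2)))) :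
    Tendsto (fun τ => greenConst (ω τ) / (Real.log τ : ℂ)) atTop (nhds (1 / (4 * Real.pi))) := by
  have hL : Tendsto (fun τ : ℝ => ((Real.log τ : ℝ) : ℂ)⁻¹) atTop (nhds 0) := by
    have := (Complex.continuous_ofReal.tendsto 0).comp (tendsto_inv_atTop_zero.comp Real.tendsto_log_atTop)
    simpa [Function.comp_def] using this
  have hlr : Tendsto (fun τ => Complex.log (ω τ / (w τ : ℂ))) atTop (nhds 0) := by
    have := (continuousAt_clog (x := 1) (by simp)).tendsto.comp hr
    simpa [Function.comp_def] using this
  have hlw : Tendsto (fun τ => ((Real.log (w τ) / Real.log τ : ℝ) : ℂ)) atTop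
      (nhds ((-(1 / 2) : ℝ) : ℂ)) := (Complex.continuous_ofReal.tendsto _).comp hlog
  have key := ((((tendsto_const_nhds (x := Complex.I / 4 - 1 / (2 * (Real.pi : ℂ))
    * ((Real.eulerMascheroniConstant : ℂ) - (Real.log 2 : ℝ)))).sub
    (hlr.const_mul (1 / (2 * (Real.pi : ℂ))))).mul hL).sub (hlw.const_mul (1 / (2 * (Real.pi : ℂ)))))
  have hπ : (Real.pi : ℂ) ≠ 0 := by exact_mod_cast Real.pi_ne_zero
  have e0 : (Complex.I / 4 - 1 / (2 * (Real.pi : ℂ))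
      * ((Real.eulerMascheroniConstant : ℂ) - (Real.log 2 : ℝ)) - 1 / (2 * (Real.pi : ℂ)) * 0) * 0
      - 1 / (2 * (Real.pi : ℂ)) * ((-(1 / 2) : ℝ) : ℂ) = 1 / (4 * Real.pi) := by
    push_cast; field_simp; norm_num
  rw [e0] at key
  refine key.congr' ?_
  filter_upwards [hw, hr.eventually_ne one_ne_zero, eventually_gt_atTop 1] with τ h1 h2 h3
  have hw0 : (w τ : ℂ) ≠ 0 := by exact_mod_cast h1.ne'
  have hl : Complex.log (ω τ / 2)
      = (Real.log (w τ) : ℝ) - (Real.log 2 : ℝ) + Complex.log (ω τ / (w τ : ℂ)) := by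
    have e : ω τ / 2 = ((w τ / 2 : ℝ) : ℂ) * (ω τ / (w τ : ℂ)) := by
      push_cast; field_simp
    rw [e, Complex.log_ofReal_mul (by positivity) h2, Real.log_div h1.ne' two_ne_zero]
    push_cast; ring
  have hL0 : ((Real.log τ : ℝ) : ℂ) ≠ 0 := by exact_mod_cast (Real.log_pos h3).ne'
  rw [greenConst, hl]
  push_cast
  field_simp
  ring

variable {p : ℝ}

lemma tendsto_coupling (hw : ∀ᶠ τ in atTop, 0 < w τ)
    (hr : Tendsto (fun τ => ω τ / (w τ : ℂ)) atTop (nhds 1))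
    (hp : Tendsto (fun τ => τ * w τ ^ 2) atTop (nhds p)) :
    Tendsto (fun τ : ℝ => (τ : ℂ) * ω τ ^ 2) atTop (nhds p) := by
  have h1 : Tendsto (fun τ => ((τ * w τ ^ 2 : ℝ) : ℂ)) atTop (nhds (p : ℂ)) :=
    (Complex.continuous_ofReal.tendsto _).comp hp
  have h2 := h1.mul (hr.pow 2)
  rw [one_pow, mul_one] at h2
  refine h2.congr' ?_
  filter_upwards [hw] with τ h
  have hw0 : (w τ : ℂ) ≠ 0 := by exact_mod_cast h.ne'
  push_cast
  field_simp

lemma tendsto_norm_sq (hp : Tendsto (fun τ : ℝ => (τ : ℂ) * ω τ ^ 2) atTop (nhds (p : ℂ))) :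
    Tendsto (fun τ => ‖ω τ‖ ^ 2) atTop (nhds 0) := by
  have := hp.norm.mul tendsto_inv_atTop_zero
  rw [mul_zero] at this
  refine this.congr' ?_
  filter_upwards [eventually_gt_atTop 0] with τ h
  rw [norm_mul, Complex.norm_real, Real.norm_of_nonneg h.le, norm_pow]
  field_simp

/-- `‖ω‖² ‖greenConst ω‖` is `‖τ ω²‖ · (‖greenConst ω‖ / log τ) · (log τ / τ)`: two bounded factors
and one tending to `0`. -/
lemma tendsto_remSize (hp : Tendsto (fun τ : ℝ => (τ : ℂ) * ω τ ^ 2) atTop (nhds (p : ℂ)))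
    (hG : Tendsto (fun τ => greenConst (ω τ) / (Real.log τ : ℂ)) atTop (nhds (1 / (4 * Real.pi)))) :
    Tendsto (fun τ => remSize (ω τ)) atTop (nhds 0) := by
  have h1 : Tendsto (fun τ => Real.log τ / τ) atTop (nhds 0) := by
    have := Real.isLittleO_log_id_atTop.tendsto_div_nhds_zero
    simpa using this
  have h2 := (tendsto_norm_sq hp).add ((hp.norm.mul hG.norm).mul h1)
  rw [mul_zero, add_zero] at h2
  refine h2.congr' ?_
  filter_upwards [eventually_gt_atTop 1] with τ h
  have h0 : 0 < τ := by linarith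
  have hL := Real.log_pos h
  rw [norm_mul, Complex.norm_real, Real.norm_of_nonneg h0.le, norm_pow, norm_div, Complex.norm_real,
    Real.norm_of_nonneg hL.le, remSize]
  field_simp

lemma eventually_isLowFreq (hw : ∀ᶠ τ in atTop, 0 < w τ)
    (hr : Tendsto (fun τ => ω τ / (w τ : ℂ)) atTop (nhds 1))
    (hp : Tendsto (fun τ : ℝ => (τ : ℂ) * ω τ ^ 2) atTop (nhds (p : ℂ)))
    (hG : Tendsto (fun τ => greenConst (ω τ) / (Real.log τ : ℂ)) atTop (nhds (1 / (4 * Real.pi)))) :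
    ∀ᶠ τ in atTop, IsLowFreq (|p| + 1) τ (ω τ) := by
  have hre : Tendsto (fun τ => (ω τ / (w τ : ℂ)).re) atTop (nhds 1) := by
    have h := (Complex.continuous_re.tendsto 1).comp hr
    rwa [Complex.one_re] at h
  have hpn : Tendsto (fun τ : ℝ => ‖(τ : ℂ) * ω τ ^ 2‖) atTop (nhds |p|) := by
    simpa using hp.norm
  filter_upwards [hw, hre.eventually (lt_mem_nhds zero_lt_one),
    hpn.eventually (ge_mem_nhds (lt_add_one |p|)),
    (tendsto_norm_sq hp).eventually (ge_mem_nhds (show (0 : ℝ) < 1 / 4 by norm_num)),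
    (tendsto_remSize hp hG).eventually (ge_mem_nhds zero_lt_one)] with τ h1 h2 h3 h4 h5
  refine ⟨?_, ?_, h5, h3⟩
  · rw [Complex.div_ofReal_re, div_pos_iff_of_pos_right h1] at h2
    exact h2
  · nlinarith [norm_nonneg (ω τ)]

lemma eventually_norm_le (hw : ∀ᶠ τ in atTop, 0 < w τ)
    (hr : Tendsto (fun τ => ω τ / (w τ : ℂ)) atTop (nhds 1)) :
    ∀ᶠ τ in atTop, ‖ω τ‖ ≤ 2 * w τ := by
  have h : Tendsto (fun τ => ‖ω τ / (w τ : ℂ)‖) atTop (nhds 1) := by simpa using hr.norm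
  filter_upwards [hw, h.eventually (ge_mem_nhds one_lt_two)] with τ h1 h2
  rwa [norm_div, Complex.norm_real, Real.norm_of_nonneg h1.le, div_le_iff₀ h1] at h2

lemma tendsto_log_div_sqrt_log :
    Tendsto (fun τ => Real.log (Real.log τ) / Real.sqrt (Real.log τ)) atTop (nhds 0) := by
  have h := (isLittleO_log_rpow_atTop (r := 1 / 2) (by norm_num)).tendsto_div_nhds_zero.comp
    Real.tendsto_log_atTop
  simpa [Function.comp_def, Real.sqrt_eq_rpow] using h

lemma tendsto_log_log_div_log :
    Tendsto (fun τ => Real.log (Real.log τ) / Real.log τ) atTop (nhds 0) := by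
  have h := Real.isLittleO_log_id_atTop.tendsto_div_nhds_zero.comp Real.tendsto_log_atTop
  simpa [Function.comp_def] using h

lemma tendsto_const_div_log (k : ℝ) : Tendsto (fun τ => k / Real.log τ) atTop (nhds 0) :=
  tendsto_const_nhds.div_atTop Real.tendsto_log_atTop

lemma eventually_log_pos : ∀ᶠ τ in atTop, 0 < Real.log τ := Real.tendsto_log_atTop.eventually_gt_atTop 0

/-- The leading order of the frequency with an almost constant state. -/
def constFreq (A τ : ℝ) : ℝ := Real.sqrt (4 * Real.pi / (A * τ * Real.log τ))

/-- The leading order of the frequencies with a state of mean zero. -/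
def eigenFreq (μ τ : ℝ) : ℝ := 1 / Real.sqrt (τ * μ)

variable {A μ : ℝ}

lemma eventually_constFreq_pos (hA : 0 < A) : ∀ᶠ τ in atTop, 0 < constFreq A τ := by
  filter_upwards [eventually_gt_atTop 0, eventually_log_pos] with τ h1 h2
  exact Real.sqrt_pos.2 (by positivity)

lemma constFreq_eq (hA : 0 < A) (τ : ℝ) :
    constFreq A τ = Real.sqrt (4 * Real.pi / A) / Real.sqrt (τ * Real.log τ) := by
  rw [constFreq, mul_assoc, ← div_div, Real.sqrt_div (by positivity)]

lemma tendsto_div_constFreq (hA : 0 < A) :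
    Tendsto (fun τ => Real.log (Real.log τ) / (Real.sqrt τ * Real.log τ) / constFreq A τ) atTop
      (nhds 0) := by
  have h := tendsto_log_div_sqrt_log.const_mul (Real.sqrt (4 * Real.pi / A))⁻¹
  rw [mul_zero] at h
  refine h.congr' ?_
  filter_upwards [eventually_gt_atTop 0, eventually_log_pos] with τ h1 h2
  have h3 : 0 < Real.sqrt (4 * Real.pi / A) := Real.sqrt_pos.2 (by positivity)
  have h4 := Real.sqrt_pos.2 h1
  have h5 := Real.sqrt_pos.2 h2
  rw [constFreq_eq hA τ, Real.sqrt_mul h1.le]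
  have h6 : Real.log τ = Real.sqrt (Real.log τ) * Real.sqrt (Real.log τ) := (Real.mul_self_sqrt h2.le).symm
  set L := Real.sqrt (Real.log τ)
  rw [h6]
  field_simp

lemma tendsto_log_constFreq (hA : 0 < A) :
    Tendsto (fun τ => Real.log (constFreq A τ) / Real.log τ) atTop (nhds (-(1 / 2))) := by
  have h := ((tendsto_const_div_log (Real.log (4 * Real.pi / A))).sub
    ((tendsto_const_nhds (x := (1 : ℝ))).add tendsto_log_log_div_log)).mul_const (1 / 2)
  rw [show ((0 : ℝ) - (1 + 0)) * (1 / 2) = -(1 / 2) by norm_num] at h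
  refine h.congr' ?_
  filter_upwards [eventually_gt_atTop 0, eventually_log_pos] with τ h1 h2
  have e : Real.log (constFreq A τ)
      = (Real.log (4 * Real.pi / A) - (Real.log τ + Real.log (Real.log τ))) / 2 := by
    rw [constFreq, Real.log_sqrt (by positivity), mul_assoc, ← div_div,
      Real.log_div (x := 4 * Real.pi / A) (by positivity) (by positivity), Real.log_mul h1.ne' h2.ne']
  rw [e]
  field_simp

lemma mul_constFreq_sq (hA : 0 < A) {τ : ℝ} (hL : 0 < Real.log τ) (hτ : 0 < τ) :
    τ * constFreq A τ ^ 2 = 4 * Real.pi / A / Real.log τ := by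
  rw [constFreq, Real.sq_sqrt (by positivity)]
  field_simp

lemma eventually_eigenFreq_pos (hμ : 0 < μ) : ∀ᶠ τ in atTop, 0 < eigenFreq μ τ := by
  filter_upwards [eventually_gt_atTop 0] with τ h1
  exact one_div_pos.2 (Real.sqrt_pos.2 (by positivity))

lemma tendsto_div_eigenFreq (hμ : 0 < μ) :
    Tendsto (fun τ => 1 / (Real.sqrt τ * Real.log τ) / eigenFreq μ τ) atTop (nhds 0) := by
  refine (tendsto_const_div_log (Real.sqrt μ)).congr' ?_
  filter_upwards [eventually_gt_atTop 0, eventually_log_pos] with τ h1 h2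
  have h4 := Real.sqrt_pos.2 h1
  have h5 := Real.sqrt_pos.2 hμ
  rw [eigenFreq, Real.sqrt_mul h1.le]
  field_simp

lemma tendsto_log_eigenFreq (hμ : 0 < μ) :
    Tendsto (fun τ => Real.log (eigenFreq μ τ) / Real.log τ) atTop (nhds (-(1 / 2))) := by
  have h := ((tendsto_const_nhds (x := (1 : ℝ))).add
    (tendsto_const_div_log (Real.log μ))).mul_const (-(1 / 2))
  rw [show ((1 : ℝ) + 0) * (-(1 / 2)) = -(1 / 2) by norm_num] at h
  refine h.congr' ?_
  filter_upwards [eventually_gt_atTop 0, eventually_log_pos] with τ h1 h2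
  have e : Real.log (eigenFreq μ τ) = -((Real.log τ + Real.log μ) / 2) := by
    rw [eigenFreq, one_div, Real.log_inv, Real.log_sqrt (by positivity), Real.log_mul h1.ne' hμ.ne']
  rw [e]
  field_simp

lemma mul_eigenFreq_sq (hμ : 0 < μ) {τ : ℝ} (hτ : 0 < τ) : τ * eigenFreq μ τ ^ 2 = μ⁻¹ := by
  rw [eigenFreq, div_pow, Real.sq_sqrt (by positivity)]
  field_simp

end Asymptotics

/-! ### Passage to functions on D and conclusion -/

section Final

variable {D : Set Plane}

lemma exists_isDomain2 [IsFiniteMeasure (volOn D)] (hD : IsOpen D) (hb : Bornology.IsBounded D)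
    (hne : D.Nonempty) : ∃ c, IsDomain2 D c := by
  obtain ⟨c, hc, h1, h2, h3⟩ := exists_lowFreq hD.measurableSet hb
  exact ⟨c, hD.measurableSet,
    ENNReal.toReal_pos (hD.measure_pos volume hne).ne' hb.measure_lt_top.ne, hc, h1, h2, h3⟩

open Classical in
/-- The class of a function in `L²(D)`, and `0` if the function is not square integrable. -/
def toL2 (D : Set Plane) (f : Plane → ℂ) : L2 D := if h : MemLp f 2 (volOn D) then h.toLp f else 0

lemma toL2_ae {f : Plane → ℂ} (h : MemLp f 2 (volOn D)) : toL2 D f =ᵐ[volOn D] f := by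
  rw [toL2, dif_pos h]; exact h.coeFn_toLp

lemma tendsto_toL2 {φs : ℝ → Plane → ℂ} (hφ : ∀ᶠ τ in atTop, MemLp (φs τ) 2 (volOn D))
    {f : Plane → ℂ} {F : L2 D} (hF : F =ᵐ[volOn D] f)
    (h : ∃ C : ℝ, ∀ᶠ τ : ℝ in atTop,
      eLpNorm (fun x => φs τ x - f x) 2 (volOn D) ≤ ENNReal.ofReal (C / Real.log τ)) :
    Tendsto (fun τ => toL2 D (φs τ)) atTop (nhds F) := by
  obtain ⟨C, hC⟩ := h
  rw [tendsto_iff_norm_sub_tendsto_zero]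
  refine tendsto_of_tendsto_of_tendsto_of_le_of_le' tendsto_const_nhds (tendsto_const_div_log |C|)
    (Eventually.of_forall fun τ => norm_nonneg _) ?_
  filter_upwards [hφ, hC, eventually_log_pos] with τ h1 h2 h3
  rw [Lp.norm_def]
  refine ENNReal.toReal_le_of_le_ofReal (by positivity) ?_
  have e : (toL2 D (φs τ) - F : L2 D) =ᵐ[volOn D] fun x => φs τ x - f x := by
    filter_upwards [Lp.coeFn_sub (toL2 D (φs τ)) F, toL2_ae h1, hF] with x e1 e2 e3
    rw [e1, Pi.sub_apply, e2, e3]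
  rw [eLpNorm_congr_ae e]
  exact h2.trans (ENNReal.ofReal_le_ofReal (div_le_div_of_nonneg_right (le_abs_self C) h3.le))

lemma linear_lippmannSchwinger [IsFiniteMeasure (volOn D)] {c Λ τ : ℝ} {ω : ℂ} {φ : Plane → ℂ}
    (hd : IsDomain2 D c) (hω : IsLowFreq Λ τ ω) (h : IsResonantState D 0 τ ω φ) {F : L2 D}
    (hF : F =ᵐ[volOn D] φ) : F = ((τ : ℂ) * ω ^ 2) • convL D (greenKernel ω) F := by
  have h0 : ‖(0 : ℂ)‖ ≤ 1 / 4 := by simp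
  have h1 := hω.ne_zero h0
  have h2 := (hd.rem_kernel hω h0).toIsKernel
  rw [add_zero, mul_one] at h1 h2
  have hk : kerr 0 φ =ᵐ[volOn D] F := by
    filter_upwards [hF] with x hx
    rw [hx]; simp [kerr]
  exact (lippmannSchwinger_iff hd.meas h1 hd.newton.toIsKernel h2 hF.symm hk).1 h.lippmannSchwinger

/-- The branch of nonlinear resonances, from the convergence of the linear problems. -/
theorem hasNonlinearBranch_of_isLinearData [IsFiniteMeasure (volOn D)] {c Λ : ℝ}
    (hd : IsDomain2 D c) (hΛ : 0 < Λ) (m : BifModel (L2 D))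
    (hm : ∀ M > 0, m.l (truncL 1 M m.v) ≠ 0) {ψ : Plane → ℂ}
    (hψ : ∀ (f : Plane → ℂ) (F : L2 D), F =ᵐ[volOn D] f → innerOn D ψ f = m.l F)
    {ωs : ℝ → ℂ} {φs : ℝ → Plane → ℂ} (hφ : ∀ᶠ τ in atTop, MemLp (φs τ) 2 (volOn D))
    (hdata : ∀ η > 0, ∀ᶠ τ in atTop, IsLinearData m η Λ τ (ωs τ) (toL2 D (φs τ)))
    {err : ℝ → ℝ → ℝ} {k : ℝ}
    (herr : ∀ᶠ τ in atTop, ∀ a > 0, 0 ≤ err a τ ∧ a ^ 2 * ‖ωs τ‖ ≤ k * err a τ) :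
    HasNonlinearBranch D ψ ωs φs err := by
  obtain ⟨η, hη, δ, hδ, ρ, hρ, K, H⟩ := exists_uniform_branch hd m hm hΛ
  obtain ⟨τ₀, hτ₀⟩ := eventually_atTop.1 (hφ.and ((hdata η hη).and herr))
  -- As `a > 0`, the condition `a + τ⁻¹ < δ'` forces `τ > |τ₀|`, so the eventual statements hold.
  set δ' := min δ (1 / (|τ₀| + 1)) with hδ'
  set C := max K (|K| * |k|) with hC
  have key : ∀ a τ : ℝ, 0 < a ∧ 0 < τ ∧ a + τ⁻¹ < δ' → ∃ (ω : ℂ) (u : Plane → ℂ),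
      IsNearbyPair D τ ρ (ωs τ) ω u ∧
      innerOn D ψ u = a * innerOn D ψ (φs τ) ∧
      (∀ (ω' : ℂ) (u' : Plane → ℂ), IsNearbyPair D τ ρ (ωs τ) ω' u' →
        (‖innerOn D ψ u'‖ = a * ‖innerOn D ψ (φs τ)‖ ∨ ω' = ω) →
        ω' = ω ∧ ∃ θ : ℝ, u' =ᵐ[volOn D] fun x => Complex.exp (Complex.I * θ) * u x) ∧
      eH2Norm D (fun x => u x - a * φs τ x) ≤ ENNReal.ofReal (C * a ^ 2) ∧
      ‖ω - ωs τ‖ ≤ C * err a τ := by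
    rintro a τ ⟨ha, hτ, haτ⟩
    have haδ : a < δ := by
      have := haτ.trans_le (min_le_left _ _)
      linarith [inv_pos.2 hτ]
    have hττ₀ : τ₀ ≤ τ := by
      have h1 : τ⁻¹ < 1 / (|τ₀| + 1) := by
        have := haτ.trans_le (min_le_right _ _)
        linarith
      rw [← one_div] at h1
      have h2 := lt_of_one_div_lt_one_div (by positivity) h1
      linarith [le_abs_self τ₀]
    obtain ⟨hmem, hlin, hek⟩ := hτ₀ τ hττ₀
    obtain ⟨he0, hek⟩ := hek a ha
    have hae := toL2_ae hmem
    obtain ⟨ω, u, h1, h2, h3, h4, h5⟩ := H τ (ωs τ) _ hlin a ha haδ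
    have e1 := hψ _ _ hae
    have hu : innerOn D ψ u = m.l u := hψ _ _ (EventuallyEq.refl _ _)
    refine ⟨ω, u, h1, by rw [hu, h2, e1], fun ω' u' hn hor => ?_, ?_, ?_⟩
    -- A competitor lies in H², hence has a class in `L²(D)`, to which the uniqueness there applies.
    · have hae' := toL2_ae hn.state.memH2.choose_spec.choose_spec.memLp
      rw [hψ _ _ hae', e1] at hor
      obtain ⟨h6, θ, h7⟩ := h3 ω' _ (hn.congr hae'.symm) hor
      refine ⟨h6, θ, ?_⟩
      have h8 := Lp.coeFn_smul (Complex.exp (Complex.I * θ)) u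
      rw [← h7] at h8
      exact hae'.symm.trans h8
    · have h6 : (fun x => u x - a * φs τ x) =ᵐ[volOn D] (u - (a : ℂ) • toL2 D (φs τ) : L2 D) := by
        filter_upwards [Lp.coeFn_sub u ((a : ℂ) • toL2 D (φs τ)),
          Lp.coeFn_smul (a : ℂ) (toL2 D (φs τ)), hae] with x a1 a2 a3
        rw [a1, Pi.sub_apply, a2, Pi.smul_apply, a3, smul_eq_mul]
      rw [eH2Norm_congr h6]
      exact h4.trans (ENNReal.ofReal_le_ofReal
        (mul_le_mul_of_nonneg_right (le_max_left _ _) (sq_nonneg a)))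
    · calc ‖ω - ωs τ‖ ≤ K * a ^ 2 * ‖ωs τ‖ := h5
        _ ≤ |K| * (a ^ 2 * ‖ωs τ‖) := by
          rw [mul_assoc]
          exact mul_le_mul_of_nonneg_right (le_abs_self K) (by positivity)
        _ ≤ |K| * (|k| * err a τ) :=
          mul_le_mul_of_nonneg_left
            (hek.trans (mul_le_mul_of_nonneg_right (le_abs_self k) he0)) (abs_nonneg K)
        _ ≤ C * err a τ := by
          rw [← mul_assoc]
          exact mul_le_mul_of_nonneg_right (le_max_right _ _) he0
  -- Outside the parameter region the branch takes default values, about which nothing is claimed.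
  choose! ω u h using fun a τ => key a τ
  exact ⟨δ', by positivity, ρ, hρ, C, ω, u, fun a τ ha hτ haτ => h a τ ⟨ha, hτ, haτ⟩⟩

end Final

end Dielectric

end

theorem mainTheorem4 (D : Set Plane) (hDopen : IsOpen D) (hDbdd : Bornology.IsBounded D)
    (hDne : D.Nonempty)
    (ωs : ℝ → ℂ) (φs : ℝ → Plane → ℂ)
    (hlin : ∀ᶠ τ : ℝ in atTop, IsResonantState D 0 τ (ωs τ) (φs τ)) :
    ((fun τ : ℝ => ωs τ
          - (Real.sqrt (4 * Real.pi / ((volume D).toReal * τ * Real.log τ)) : ℂ))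
        =O[atTop] (fun τ : ℝ => Real.log (Real.log τ) / (Real.sqrt τ * Real.log τ)) →
      (∃ C : ℝ, ∀ᶠ τ : ℝ in atTop,
        eLpNorm (fun x => φs τ x - 1) 2 (volOn D) ≤ ENNReal.ofReal (C / Real.log τ)) →
      HasNonlinearBranch D (oneOn D) ωs φs
        (fun a τ => a ^ 2 / Real.sqrt (τ * Real.log τ) + a / (Real.sqrt τ * Real.log τ))) ∧
    (∀ (μ : ℝ) (v : Plane → ℂ), 0 < μ → IsSimpleEigenpair D μ v →
      (fun τ : ℝ => ωs τ - ((1 / Real.sqrt (τ * μ) : ℝ) : ℂ))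
        =O[atTop] (fun τ : ℝ => 1 / (Real.sqrt τ * Real.log τ)) →
      (∃ C : ℝ, ∀ᶠ τ : ℝ in atTop,
        eLpNorm (fun x => φs τ x - v x) 2 (volOn D) ≤ ENNReal.ofReal (C / Real.log τ)) →
      HasNonlinearBranch D v ωs φs
        (fun a τ => a ^ 2 / Real.sqrt τ + a / Real.sqrt (τ * Real.log τ))) := by
  have hfin : IsFiniteMeasure (volOn D) :=
    ⟨by rw [Measure.restrict_apply_univ]; exact hDbdd.measure_lt_top⟩
  obtain ⟨c, hd⟩ := exists_isDomain2 hDopen hDbdd hDne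
  have hA := hd.area_pos
  have hmem : ∀ᶠ τ in atTop, MemLp (φs τ) 2 (volOn D) := by
    filter_upwards [hlin] with τ h using h.memH2.choose_spec.choose_spec.memLp
  refine ⟨fun hω hφ => ?_, fun μ v hμ hv hω hφ => ?_⟩
  · have hw := eventually_constFreq_pos hA
    have hr := tendsto_ratio (w := constFreq (area D)) hw hω (tendsto_div_constFreq hA)
    have hG := tendsto_greenConst hw hr (tendsto_log_constFreq hA)
    have hp' : Tendsto (fun τ => τ * constFreq (area D) τ ^ 2) atTop (nhds 0) := by
      refine (tendsto_const_div_log (4 * Real.pi / area D)).congr' ?_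
      filter_upwards [eventually_gt_atTop 0, eventually_log_pos] with τ h1 h2
      exact (mul_constFreq_sq hA h2 h1).symm
    have hp := tendsto_coupling hw hr hp'
    have hlow := eventually_isLowFreq hw hr hp hG
    -- `τ ω² ~ 4π / (|D| log τ)` and `greenConst ~ log τ / (4π)`: the leading frequency of case (I)
    -- is exactly the one for which the product with `|D|` tends to `1`.
    have hκ : Tendsto (fun τ : ℝ => (τ : ℂ) * ωs τ ^ 2 * (area D * greenConst (ωs τ))) atTop
        (nhds 1) := by
      have h1 := ((hr.pow 2).mul hG).const_mul (4 * Real.pi : ℂ)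
      have hπ : (Real.pi : ℂ) ≠ 0 := by exact_mod_cast Real.pi_ne_zero
      rw [one_pow, one_mul, mul_one_div_cancel (mul_ne_zero (by norm_num : (4 : ℂ) ≠ 0) hπ)] at h1
      refine h1.congr' ?_
      filter_upwards [hw, eventually_gt_atTop 0, eventually_log_pos] with τ h2 h3 h4
      have h5 : (constFreq (area D) τ : ℂ) ≠ 0 := by exact_mod_cast h2.ne'
      have h6 : ((Real.log τ : ℝ) : ℂ) ≠ 0 := by exact_mod_cast h4.ne'
      have h7 : (area D : ℂ) ≠ 0 := by exact_mod_cast hA.ne'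
      have h8 : (τ : ℂ) * (constFreq (area D) τ : ℂ) ^ 2
          = 4 * Real.pi / area D / (Real.log τ : ℝ) := by
        exact_mod_cast congrArg (fun x : ℝ => (x : ℂ)) (mul_constFreq_sq hA h4 h3)
      have h9 : (τ : ℂ) * ωs τ ^ 2
          = (τ * (constFreq (area D) τ : ℂ) ^ 2) * (ωs τ / (constFreq (area D) τ : ℂ)) ^ 2 := by
        field_simp
      rw [h9, h8]
      field_simp
    have hΦ := tendsto_toL2 hmem (oneL_ae (D := D)) hφ
    refine hasNonlinearBranch_of_isLinearData hd (by positivity) (constModel hA) (fun M hM => ?_)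
      (fun f F hF => ?_) hmem
      (fun η hη => eventually_isLinearData_const hd hlow (by simpa using hp) hκ hΦ ?_ hη)
      (k := 2 * Real.sqrt (4 * Real.pi / area D)) ?_
    · have h0 : oneL D ≠ 0 := norm_pos_iff.1 (sqrtArea_pos hA)
      exact mul_ne_zero (inv_ne_zero (by exact_mod_cast hA.ne')) (inner_truncL_ne_zero hM h0)
    · change _ = (area D : ℂ)⁻¹ * inner ℂ (oneL D) F
      rw [inner_oneL, ← integral_const_mul, innerOn]
      refine integral_congr_ae ?_
      filter_upwards [hF] with x hx
      rw [hx, oneOn, Complex.conj_ofReal, area, one_div, Complex.ofReal_inv]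
    · filter_upwards [hlow, hlin, hmem] with τ h1 h2 h3
      exact linear_lippmannSchwinger hd h1 h2 (toL2_ae h3)
    · filter_upwards [eventually_norm_le hw hr, eventually_gt_atTop 0, eventually_log_pos]
        with τ h1 h2 h3 a ha
      refine ⟨by positivity, ?_⟩
      rw [constFreq_eq hA] at h1
      have h4 : 0 ≤ 2 * Real.sqrt (4 * Real.pi / area D) * (a / (Real.sqrt τ * Real.log τ)) := by
        positivity
      -- The relative bound `O(a²)` already yields the first term of the error; the second is
      -- nonnegative and is merely added.
      calc _ ≤ a ^ 2 * (2 * (Real.sqrt (4 * Real.pi / area D) / Real.sqrt (τ * Real.log τ))) := by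
            gcongr
        _ = 2 * Real.sqrt (4 * Real.pi / area D) * (a ^ 2 / Real.sqrt (τ * Real.log τ)) := by ring
        _ ≤ _ := by rw [mul_add]; linarith
  · have hw := eventually_eigenFreq_pos hμ
    have hr := tendsto_ratio (w := eigenFreq μ) hw hω (tendsto_div_eigenFreq hμ)
    have hG := tendsto_greenConst hw hr (tendsto_log_eigenFreq hμ)
    have hp' : Tendsto (fun τ => τ * eigenFreq μ τ ^ 2) atTop (nhds μ⁻¹) := by
      refine tendsto_const_nhds.congr' ?_
      filter_upwards [eventually_gt_atTop 0] with τ h1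
      exact (mul_eigenFreq_sq hμ h1).symm
    have hp := tendsto_coupling hw hr hp'
    have hlow := eventually_isLowFreq hw hr hp hG
    have hπ : (1 / (4 * Real.pi) : ℂ) ≠ 0 := by
      have : (Real.pi : ℂ) ≠ 0 := by exact_mod_cast Real.pi_ne_zero
      exact one_div_ne_zero (mul_ne_zero (by norm_num : (4 : ℂ) ≠ 0) this)
    have hne : ∀ᶠ τ in atTop, greenConst (ωs τ) ≠ 0 := by
      filter_upwards [hG.eventually_ne hπ] with τ h h0
      exact h (by rw [h0, zero_div])
    have hκ : Tendsto (fun τ : ℝ => (area D * greenConst (ωs τ))⁻¹) atTop (nhds 0) := by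
      have h1 : Tendsto (fun τ : ℝ => ((1 / Real.log τ : ℝ) : ℂ)) atTop (nhds ((0 : ℝ) : ℂ)) :=
        (Complex.continuous_ofReal.tendsto 0).comp (tendsto_const_div_log 1)
      have h2 := ((hG.inv₀ hπ).mul h1).const_mul (area D : ℂ)⁻¹
      rw [Complex.ofReal_zero, mul_zero, mul_zero] at h2
      refine h2.congr' ?_
      filter_upwards [eventually_log_pos] with τ h3
      have h6 : ((Real.log τ : ℝ) : ℂ) ≠ 0 := by exact_mod_cast h3.ne'
      rw [mul_inv, inv_div, Complex.ofReal_div, Complex.ofReal_one]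
      field_simp
    have hvL := hv.eigen.memLp.coeFn_toLp
    have hev := hv.isEigenL hd hμ
    have hΦ := tendsto_toL2 hmem hvL hφ
    refine hasNonlinearBranch_of_isLinearData hd (by positivity) (eigenModel hd hev)
      (fun M hM => ?_) (fun f F hF => ?_) hmem
      (fun η hη => eventually_isLinearData_eigen hd hev hlow (by simpa using hp) hκ hne
        (tendsto_remSize hp hG) hΦ ?_ hη)
      (k := 2 / Real.sqrt μ) ?_
    · refine inner_truncL_ne_zero hM fun h0 => ?_
      have := hev.inner_self
      rw [h0, inner_zero_left] at this
      exact zero_ne_one this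
    · change _ = inner ℂ (hv.eigen.memLp.toLp v) F
      rw [L2.inner_def, innerOn]
      refine integral_congr_ae ?_
      filter_upwards [hF, hvL] with x h1 h2
      rw [RCLike.inner_apply, h1, h2, mul_comm]
    · filter_upwards [hlow, hlin, hmem] with τ h1 h2 h3
      exact linear_lippmannSchwinger hd h1 h2 (toL2_ae h3)
    · filter_upwards [eventually_norm_le hw hr, eventually_gt_atTop 0] with τ h1 h2 a ha
      refine ⟨by positivity, ?_⟩
      rw [eigenFreq, Real.sqrt_mul h2.le] at h1
      have h4 : 0 ≤ 2 / Real.sqrt μ * (a / Real.sqrt (τ * Real.log τ)) := by positivity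
      calc _ ≤ a ^ 2 * (2 * (1 / (Real.sqrt τ * Real.sqrt μ))) := by gcongr
        _ = 2 / Real.sqrt μ * (a ^ 2 / Real.sqrt τ) := by
          have := Real.sqrt_pos.2 hμ
          have := Real.sqrt_pos.2 h2
          field_simp
        _ ≤ _ := by rw [mul_add]; linarith
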